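/- **Setup.** Let $M=\{a\in\mathbb Z^5:\sum_i a_i\equiv 0 \bmod 5\}$ and $N=\mathbb Z^5+\mathbb Z(\tfrac15,\dots,\tfrac15)$, paired by the dot product, and put $\deg=(1,\dots,1)\in M$, $\deg^\vee=(\tfrac15,\dots,\tfrac15)\in N$. Let $K\subset M$ and $K^\vee\subset N$ be the sets of elements with nonnegative coordinates, $\Delta=\{m\in K: m\cdot\deg^\vee=1\}$ and $\Delta^\vee=\{n\in K^\vee:\deg\cdot n=1\}$. Points $m\in\Delta$ correspond to the monomials $x^m$ of degree $5$ in $x_0,\dots,x_4$. The vertices of $\Delta^\vee$ are the unit vectors; let $m_0,\dots,m_4$ be the dual basis of $M_{\mathbb Q}$. Let $\mathrm{Fock}_{M\oplus K^\vee}$ be the vertex superalgebra generated by free bosons $m^{bos},n^{bos}$ and free fermions $m^{ferm},n^{ferm}$ ($m\in M$, $n\in N$, extended linearly to $M_{\mathbb C}$, $N_{\mathbb C}$) with $$m^{bos}(z)n^{bos}(w)\sim\frac{m\cdot n}{(z-w)^2},\qquad m^{ferm}(z)n^{ferm}(w)\sim\frac{m\cdot n}{z-w}$$ and all other OPEs nonsingular,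 together with the (even) vertex operators $e^{\int m^{bos}(z)+n^{bos}(z)}$, $m\in M$, $n\in K^\vee$, of the even lattice with form $(m_1+n_1,m_2+n_2)=m_1\cdot n_2+m_2\cdot n_1$, taken with the cocycle $(-1)^{m_1\cdot n_2}$. Its underlying space is $\mathbb C[M\oplus K^\vee]$ tensored with the polynomial algebra in the bosonic creation operators and the exterior algebra in the fermionic creation operators; the field of a basis state is the normally ordered product of the corresponding derivatives of free fields and vertex operator. **Proposition.** Let $F^0,\dots,F^4\in\mathbb C[x_0,\dots,x_4]$ be homogeneous of degree $5$ with $F^i|_{x_i=0}=0$ for every $i$, let $F^i_m$ be the coefficient of $x^m$ in $F^i$, and let $g_n$, $n\in\Delta^\vee$, be any complex numbers. Then $\mathrm{Fock}_{M\oplus K^\vee}$ as described is a vertex superalgebra, and the operator $$D_{(F^\cdot),g}=\mathrm{Res}_{z=0}\Big(\sum_{m\in\Delta,\ 0\le i\le4}F^i_m\,m_i^{ferm}(z)e^{\int m^{bos}(z)}+\sum_{n\in\Delta^\vee}g_n\,n^{ferm}(z)e^{\int n^{bos}(z)}\Big)$$ on it is a differential: it is odd and $D_{(F^\cdot),g}^2=0$.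 Moreover the cohomology $\ker D_{(F^\cdot),g}/\operatorname{im}D_{(F^\cdot),g}$ inherits the structure of a vertex superalgebra: the vacuum is a cocycle, all products $a_{(k)}b$ ($k\in\mathbb Z$) of cocycles are cocycles, and the products $[a]_{(k)}[b]=[a_{(k)}b]$, the class of the vacuum, and the parity of representing cocycles are well defined and make the cohomology a vertex superalgebra. -/

import Mathlib

/-! ## Vertex superalgebras -/

/-- The data of a vertex superalgebra on a complex vector space `V`: a `ℤ/2`-grading by parity, a
vacuum vector, and the `n`-th products `a_(n) b`, i.e. the modes of the state-field correspondence
`Y(a, z) = ∑ₙ a_(n) z^(-n-1)`. -/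
structure VertexData (V : Type*) [AddCommGroup V] [Module ℂ V] where
  /-- `parity 0` is the even part, `parity 1` the odd part. -/
  parity : ZMod 2 → Submodule ℂ V
  /-- The vacuum vector. -/
  vacuum : V
  /-- `prod n a b` is `a_(n) b`. -/
  prod : ℤ → V →ₗ[ℂ] V →ₗ[ℂ] V

/-- The axioms of a vertex superalgebra. The translation operator is `T a = a_(-2) vacuum`. -/
structure VertexData.IsVertexSuperalgebra {V : Type*} [AddCommGroup V] [Module ℂ V]
    (A : VertexData V) : Prop where
  /-- `V` is the direct sum of its even and odd parts. -/
  isInternal : DirectSum.IsInternal A.parity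
  vacuum_even : A.vacuum ∈ A.parity 0
  /-- Products respect the parity. -/
  prod_mem : ∀ (p q : ZMod 2) (n : ℤ) (a b : V), a ∈ A.parity p → b ∈ A.parity q →
    A.prod n a b ∈ A.parity (p + q)
  /-- `Y(a, z)` is a field: `Y(a, z) b` is a Laurent series. -/
  truncation : ∀ a b : V, ∃ N : ℤ, ∀ n : ℤ, N ≤ n → A.prod n a b = 0
  /-- `Y(vacuum, z) = id`. -/
  vacuum_prod : ∀ (n : ℤ) (a : V), A.prod n A.vacuum a = if n = -1 then a else 0
  /-- `Y(a, z) vacuum` is a power series in `z` with constant term `a`. -/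
  prod_vacuum : ∀ a : V, A.prod (-1) a A.vacuum = a
  prod_vacuum_nonneg : ∀ (a : V) (n : ℤ), 0 ≤ n → A.prod n a A.vacuum = 0
  /-- `[T, Y(a, z)] = ∂ Y(a, z)`. -/
  translation : ∀ (n : ℤ) (a b : V),
    A.prod (-2) (A.prod n a b) A.vacuum - A.prod n a (A.prod (-2) b A.vacuum)
      = -(n : ℂ) • A.prod (n - 1) a b
  /-- For homogeneous `a`, `b` there is `N` such that `(z - w)^N` annihilates the supercommutator
  of `Y(a, z)` and `Y(b, w)`. -/
  locality : ∀ (p q : ZMod 2) (a b : V), a ∈ A.parity p → b ∈ A.parity q →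
    ∃ N : ℕ, ∀ (k l : ℤ) (c : V),
      ∑ j ∈ Finset.range (N + 1), ((-1 : ℂ) ^ j * (N.choose j : ℂ)) •
        (A.prod (k + N - j) a (A.prod (l + j) b c)
          - (-1 : ℂ) ^ (p.val * q.val) • A.prod (l + j) b (A.prod (k + N - j) a c)) = 0

/-- The cohomology `ker D / im D` of an operator `D` (with `D ∘ D = 0`). -/
abbrev Cohomology {V : Type*} [AddCommGroup V] [Module ℂ V] (D : V →ₗ[ℂ] V) : Type _ :=
  ↥(LinearMap.ker D) ⧸ (LinearMap.range D).submoduleOf (LinearMap.ker D)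

/-- The class of a cocycle. -/
abbrev Cohomology.mk {V : Type*} [AddCommGroup V] [Module ℂ V] (D : V →ₗ[ℂ] V) :
    ↥(LinearMap.ker D) →ₗ[ℂ] Cohomology D :=
  ((LinearMap.range D).submoduleOf (LinearMap.ker D)).mkQ

/-- `B` is the structure that `ker D / im D` inherits from the structure `A` on `V`:
the vacuum of `B` is the class of the vacuum, parity is the parity of representing cocycles,
and `[a]_(n) [b] = [a_(n) b]` for cocycles `a`, `b`. -/
structure VertexData.InducedOnCohomology {V : Type*} [AddCommGroup V] [Module ℂ V]
    (A : VertexData V) (D : V →ₗ[ℂ] V) (B : VertexData (Cohomology D)) : Prop where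
  vacuum_eq : ∃ h : A.vacuum ∈ LinearMap.ker D,
    B.vacuum = Cohomology.mk D ⟨A.vacuum, h⟩
  parity_eq : ∀ p : ZMod 2,
    B.parity p = ((A.parity p).submoduleOf (LinearMap.ker D)).map (Cohomology.mk D)
  prod_eq : ∀ (n : ℤ) (a b : ↥(LinearMap.ker D)),
    ∃ h : A.prod n (a : V) (b : V) ∈ LinearMap.ker D,
      B.prod n (Cohomology.mk D a) (Cohomology.mk D b)
        = Cohomology.mk D ⟨A.prod n (a : V) (b : V), h⟩

noncomputable section

namespace QuinticFock

/-! ## The dual lattices, the cones and the polytopes -/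

/-- The lattice `M = {a ∈ ℤ⁵ : ∑ aᵢ ≡ 0 mod 5}`. -/
def latM : AddSubgroup (Fin 5 → ℤ) where
  carrier := {a | (5 : ℤ) ∣ ∑ i, a i}
  zero_mem' := by simp
  add_mem' := by
    intro a b ha hb
    simpa [Finset.sum_add_distrib] using dvd_add ha hb
  neg_mem' := by
    intro a ha
    simpa using ha

/-- The lattice `N = ℤ⁵ + ℤ (1/5, …, 1/5)` in `ℚ⁵`. -/
def latN : AddSubgroup (Fin 5 → ℚ) where
  carrier := {v | ∃ (a : Fin 5 → ℤ) (k : ℤ), v = fun i => (a i : ℚ) + (k : ℚ) / 5}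
  zero_mem' := ⟨0, 0, by ext; simp⟩
  add_mem' := by
    rintro _ _ ⟨a, k, rfl⟩ ⟨b, l, rfl⟩
    exact ⟨a + b, k + l, by ext; simp; ring⟩
  neg_mem' := by
    rintro _ ⟨a, k, rfl⟩
    exact ⟨-a, -k, by ext; simp; ring⟩

/-- The dot product pairing `M × N → ℤ`; see `pairing_cast` for its integrality. -/
def pairing (m : latM) (n : latN) : ℤ := ⌊∑ i, ((m : Fin 5 → ℤ) i : ℚ) * (n : Fin 5 → ℚ) i⌋

theorem pairing_cast (m : latM) (n : latN) :
    (pairing m n : ℚ) = ∑ i, ((m : Fin 5 → ℤ) i : ℚ) * (n : Fin 5 → ℚ) i := by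
  obtain ⟨m, c, hc⟩ := m
  obtain ⟨_, a, k, rfl⟩ := n
  have h : ∑ i, (m i : ℚ) * ((a i : ℚ) + (k : ℚ) / 5) = ((∑ i, m i * a i + c * k : ℤ) : ℚ) := by
    have hc' : (∑ i, (m i : ℚ)) = 5 * c := by exact_mod_cast hc
    push_cast
    simp only [mul_add, Finset.sum_add_distrib, ← Finset.sum_mul, hc']
    ring
  simp only [pairing, h, Int.floor_intCast]

/-- The cone `K^∨` in `N`: nonnegative coordinates. -/
def coneKdual : AddSubmonoid latN where
  carrier := {n | ∀ i, 0 ≤ (n : Fin 5 → ℚ) i}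
  zero_mem' := by simp
  add_mem' := by
    intro a b ha hb i
    exact add_nonneg (ha i) (hb i)

/-- The polytope `Δ` (its lattice points): elements of `M` with nonnegative coordinates that pair
to `1` with `deg^∨ = (1/5, …, 1/5)`, i.e. with coordinate sum `5`. -/
def polyΔ : Set latM :=
  {m | (∀ i, 0 ≤ (m : Fin 5 → ℤ) i) ∧ ∑ i, ((m : Fin 5 → ℤ) i : ℚ) * (1 / 5) = 1}

/-- The polytope `Δ^∨` (its lattice points): elements of `K^∨` that pair to `1` with
`deg = (1, …, 1)`. -/
def polyΔdual : Set coneKdual := {n | ∑ i, (1 : ℚ) * ((n : latN) : Fin 5 → ℚ) i = 1}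

/-! ## The Fock space of `M ⊕ K^∨` -/

/-- The labels of the generating fields: `Sum.inl i` stands for `m_i` and `Sum.inr i` for `n_i`,
where the `n_i` are the five unit vectors (vertices of `Δ^∨`, a basis of `N_ℚ`) and the `m_i` form
the dual basis of `M_ℚ`, which again consists of the unit vectors. Only `m_i · n_i = 1` are
nonzero pairings. The lexicographic order serves to fix signs of fermionic monomials. -/
abbrev Gen : Type := Fin 5 ⊕ₗ Fin 5

/-- The generator paired to `1` with a given one: `m_i ↔ n_i`. -/
def Gen.dual (g : Gen) : Gen := toLex (ofLex g).swap

/-- The label `(g, k)` stands for the creation operator `g_(-k-1)`, bosonic or fermionic. -/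
abbrev Mode : Type := Gen ×ₗ ℕ

/-- The generator of a mode label. -/
abbrev Mode.gen (s : Mode) : Gen := (ofLex s).1

/-- The number `k` of the mode label `(g, k)`. -/
abbrev Mode.num (s : Mode) : ℕ := (ofLex s).2

/-- The mode label `(g, k)`. -/
abbrev mode (g : Gen) (k : ℕ) : Mode := toLex (g, k)

/-- The lattice part `M ⊕ K^∨`. -/
abbrev Sector : Type := latM × coneKdual

/-- Labels of the standard basis of the Fock space. The label `(μ, f, S)` stands for
`∏ (g^bos_(-k-1))^{f(g,k)} · g¹^ferm_(-k₁-1) ⋯ gʳ^ferm_(-k_r-1) |μ⟩`, where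
`(g¹,k₁) < ⋯ < (gʳ,k_r)` are the elements of `S`, and `|μ⟩` is the state of `e^{∫ μ^bos}`. -/
abbrev Label : Type := Sector × (Mode →₀ ℕ) × Finset Mode

/-- The Fock space of `M ⊕ K^∨`:
`ℂ[M ⊕ K^∨] ⊗ (polynomials in bosonic creators) ⊗ (exterior algebra on fermionic creators)`. -/
abbrev Fock : Type := Label →₀ ℂ

/-- A basis vector. -/
def ket (μ : Sector) (f : Mode →₀ ℕ) (S : Finset Mode) : Fock := Finsupp.single (μ, f, S) 1

/-- The linear operator with prescribed values on the basis. -/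
def ofBasis (φ : Label → Fock) : Module.End ℂ Fock := Finsupp.linearCombination ℂ φ

/-- The coordinates of `μ = (m, n)` in the basis `m_i, n_i` of `(M ⊕ N)_ℚ`. -/
def Sector.coord (μ : Sector) (g : Gen) : ℂ :=
  match ofLex g with
  | Sum.inl i => (((μ.1 : Fin 5 → ℤ) i : ℤ) : ℂ)
  | Sum.inr i => ((((μ.2 : latN) : Fin 5 → ℚ) i : ℚ) : ℂ)

/-- The symmetric form on `M ⊕ N`: `(m₁ + n₁, m₂ + n₂) = m₁·n₂ + m₂·n₁`. -/
def Sector.form (l μ : Sector) : ℤ := pairing l.1 μ.2 + pairing μ.1 l.2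

/-- The cocycle `(-1)^{m₁·n₂}`. -/
def Sector.cocycle (l μ : Sector) : ℂ := (-1 : ℂ) ^ pairing l.1 μ.2

/-- The modes `g^bos_(n)` of the free boson `g^bos(z) = ∑ g^bos_(n) z^(-n-1)`, with
`m^bos(z) n^bos(w) ∼ m·n / (z-w)²`, i.e. `[g_(p), h_(q)] = p (g·h) δ_{p+q,0}`: creation operators
for `n < 0`, the pairing with the sector for `n = 0`, and `n` times the derivative with respect to
the creator of the dual generator for `n > 0`. -/
def boson (g : Gen) : ℤ → Module.End ℂ Fock
  | Int.negSucc k => ofBasis fun u =>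
      ket u.1 (u.2.1 + Finsupp.single (mode g k) 1) u.2.2
  | Int.ofNat 0 => ofBasis fun u => Sector.coord u.1 g.dual • ket u.1 u.2.1 u.2.2
  | Int.ofNat (k + 1) => ofBasis fun u =>
      (((k + 1 : ℕ) : ℂ) * (u.2.1 (mode g.dual k) : ℂ)) •
        ket u.1 (u.2.1 - Finsupp.single (mode g.dual k) 1) u.2.2

/-- The modes `g^ferm_(n)` of the free fermion `g^ferm(z) = ∑ g^ferm_(n) z^(-n-1)`, with
`m^ferm(z) n^ferm(w) ∼ m·n / (z-w)`, i.e. `{g_(p), h_(q)} = (g·h) δ_{p+q,-1}`: left exterior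
multiplication for `n < 0` and contraction against the creator of the dual generator
for `n ≥ 0`. -/
def fermion (g : Gen) : ℤ → Module.End ℂ Fock
  | Int.negSucc k => ofBasis fun u =>
      if mode g k ∈ u.2.2 then 0
      else (-1 : ℂ) ^ (u.2.2.filter (· < mode g k)).card •
        ket u.1 u.2.1 (insert (mode g k) u.2.2)
  | Int.ofNat k => ofBasis fun u =>
      if mode g.dual k ∈ u.2.2 then
        (-1 : ℂ) ^ (u.2.2.filter (· < mode g.dual k)).card •
          ket u.1 u.2.1 (u.2.2.erase (mode g.dual k))
      else 0

/-- The modes of `l^bos(z)` for a lattice element `l`. -/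
def latticeBoson (l : Sector) (n : ℤ) : Module.End ℂ Fock := ∑ g : Gen, l.coord g • boson g n

/-- The coefficient at `z^p` of `exp (∑_{k ≥ 1} c_k z^k)`. -/
def expCoeff (c : ℕ → Module.End ℂ Fock) (p : ℕ) : Module.End ℂ Fock :=
  ∑ r ∈ Finset.range (p + 1), ((r.factorial : ℂ)⁻¹) •
    PowerSeries.coeff p ((PowerSeries.mk fun k => if k = 0 then 0 else c k) ^ r)

/-- The modes of the vertex operator `e^{∫ l^bos(z)}`,
`exp(∑_{k≥1} l_(-k) z^k / k) exp(-∑_{k≥1} l_(k) z^{-k} / k) e_l z^{l_(0)}`, where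
`e_l |μ⟩ = (-1)^{m₁·n₂} |l + μ⟩`. The term with index `b` takes the coefficient at `z^{-b}` of the
second exponential; the coefficient `a` of the first one is determined by
`a - b + (l, μ) = -n - 1`. Only finitely many terms are nonzero. -/
def vertexOp (l : Sector) (n : ℤ) : Module.End ℂ Fock := ofBasis fun u =>
  l.cocycle u.1 • ∑ᶠ b : ℕ,
    if 0 ≤ (b : ℤ) - n - 1 - l.form u.1 then
      expCoeff (fun k => ((k : ℂ)⁻¹) • latticeBoson l (-(k : ℤ)))
          ((b : ℤ) - n - 1 - l.form u.1).toNat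
        (expCoeff (fun k => (-(k : ℂ)⁻¹) • latticeBoson l (k : ℤ)) b
          (ket (l + u.1) u.2.1 u.2.2))
    else 0

/-- The modes of the normally ordered product `:(1/k!) ∂^k x(z) A(z):` of fields
`x(z) = ∑ x_(n) z^(-n-1)` and `A(z) = ∑ A_(n) z^(-n-1)`, where `σ = -1` if both are odd and
`σ = 1` otherwise: creation operators `x_(n)`, `n < 0`, stand to the left of `A` and annihilation
operators `x_(n)`, `n ≥ 0`, to the right of it. For fields the sums are finite. -/
def normalOrdered (k : ℕ) (x : ℤ → Module.End ℂ Fock) (σ : ℂ) (A : ℤ → Module.End ℂ Fock)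
    (n : ℤ) : Module.End ℂ Fock := ofBasis fun u =>
  (∑ᶠ j : ℕ, ((k + j).choose k : ℂ) • x (-(k : ℤ) - 1 - j) (A (n + j) (ket u.1 u.2.1 u.2.2)))
    + (σ * (-1 : ℂ) ^ k) • ∑ᶠ j : ℕ, ((k + j).choose k : ℂ) •
        A (n - k - 1 - j) (x j (ket u.1 u.2.1 u.2.2))

/-- Normally ordered product of `A` with the fermions `(1/k!) ∂^k g^ferm(z)`, `(g, k)` in a list;
`A` is even. -/
def fermionicProduct (A : ℤ → Module.End ℂ Fock) : List Mode → ℤ → Module.End ℂ Fock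
  | [] => A
  | s :: L => normalOrdered s.num (fermion s.gen) ((-1) ^ L.length) (fermionicProduct A L)

/-- Normally ordered product of `A` with the bosons `(1/k!) ∂^k g^bos(z)`, `(g, k)` in a list. -/
def bosonicProduct (A : ℤ → Module.End ℂ Fock) : List Mode → ℤ → Module.End ℂ Fock
  | [] => A
  | s :: L => normalOrdered s.num (boson s.gen) 1 (bosonicProduct A L)

/-- The field of a basis state: the normally ordered product of derivatives of free bosons, of
derivatives of free fermions, and of the vertex operator of the sector. -/
def labelField (u : Label) : ℤ → Module.End ℂ Fock :=
  bosonicProduct (fermionicProduct (vertexOp u.1) (u.2.2.sort (· ≤ ·)))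
    (Finsupp.toMultiset u.2.1).toList

/-- The lattice vertex superalgebra `Fock_{M ⊕ K^∨}`. -/
def fock : VertexData Fock where
  parity p := Finsupp.supported ℂ ℂ {u : Label | (u.2.2.card : ZMod 2) = p}
  vacuum := ket 0 0 ∅
  prod n := Finsupp.linearCombination ℂ fun u => labelField u n

/-! ## The differential -/

/-- The exponent of the monomial that corresponds to a point of `Δ`. -/
def exponent (m : latM) : Fin 5 →₀ ℕ :=
  Finsupp.equivFunOnFinite.symm fun i => ((m : Fin 5 → ℤ) i).toNat

/-- The state of the field `m_i^ferm(z) e^{∫ m^bos(z)}`. -/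
def stateM (i : Fin 5) (m : latM) : Fock := ket (m, 0) 0 {mode (Sum.inlₗ i) 0}

/-- The state of the field `n^ferm(z) e^{∫ n^bos(z)}`. -/
def stateN (n : coneKdual) : Fock :=
  ∑ i, ((((n : latN) : Fin 5 → ℚ) i : ℚ) : ℂ) • ket (0, n) 0 {mode (Sum.inrₗ i) 0}

/-- The state whose field is
`∑_{m ∈ Δ, i} F^i_m m_i^ferm(z) e^{∫ m^bos(z)} + ∑_{n ∈ Δ^∨} g_n n^ferm(z) e^{∫ n^bos(z)}`. -/
def stateFg (F : Fin 5 → MvPolynomial (Fin 5) ℂ) (g : polyΔdual → ℂ) : Fock :=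
  (∑ᶠ m : polyΔ, ∑ i, (F i).coeff (exponent m) • stateM i m) + ∑ᶠ n : polyΔdual, g n • stateN n

/-- The operator `D_{(F), g}`: the residue at `z = 0`, i.e. the `0`-th mode, of the above field. -/
def diffD (F : Fin 5 → MvPolynomial (Fin 5) ℂ) (g : polyΔdual → ℂ) : Fock →ₗ[ℂ] Fock :=
  fock.prod 0 (stateFg F g)

theorem polyΔ_finite : polyΔ.Finite := by
  refine Set.Finite.of_finite_image (f := fun m : latM => (m : Fin 5 → ℤ)) ?_
    Subtype.val_injective.injOn
  refine (Set.finite_Icc (0 : Fin 5 → ℤ) (fun _ => 5)).subset ?_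
  rintro _ ⟨m, ⟨h0, h1⟩, rfl⟩
  have h5 : ∑ i, (m : Fin 5 → ℤ) i = 5 := by
    rw [← Finset.sum_mul] at h1
    have : (∑ i, ((m : Fin 5 → ℤ) i : ℚ)) = 5 := by linarith
    exact_mod_cast this
  exact ⟨h0, fun i => h5 ▸ Finset.single_le_sum (fun j _ => h0 j) (Finset.mem_univ i)⟩

theorem polyΔdual_finite : polyΔdual.Finite := by
  let φ : (Fin 5 → ℤ) → (Fin 5 → ℚ) := fun a i => (a i : ℚ) / 5
  refine Set.Finite.of_finite_image (f := fun n : coneKdual => ((n : latN) : Fin 5 → ℚ)) ?_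
    (Subtype.val_injective.comp Subtype.val_injective).injOn
  refine ((Set.finite_Icc (0 : Fin 5 → ℤ) (fun _ => 5)).image φ).subset ?_
  rintro _ ⟨⟨⟨_, a, k, rfl⟩, h0⟩, h1, rfl⟩
  have h0' : ∀ i, 0 ≤ (a i : ℚ) + (k : ℚ) / 5 := h0
  have h1' : ∑ i, ((a i : ℚ) + (k : ℚ) / 5) = 1 := by simpa [polyΔdual] using h1
  refine ⟨fun i => 5 * a i + k, ⟨fun i => ?_, fun i => ?_⟩, ?_⟩
  · have := h0' i
    have h : (0 : ℚ) ≤ ((5 * a i + k : ℤ) : ℚ) := by push_cast; linarith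
    exact_mod_cast h
  · have := Finset.single_le_sum (fun j _ => h0' j) (Finset.mem_univ i)
    have h : ((5 * a i + k : ℤ) : ℚ) ≤ (5 : ℤ) := by push_cast; linarith
    exact_mod_cast h
  · ext i
    simp only [φ]
    push_cast
    ring

end QuinticFock

end

/-! The proof joins a statement about arbitrary vertex superalgebras to a computation in this Fock
space.

General part. Let `a` be an odd state with `a_(0) a = 0`. The commutator formula `[a_(0), Y(b, z)] =
Y(a_(0) b, z)` (`prod_prod_zero`) makes `a_(0)` an odd derivation of all products. Applied to `a`
itself it gives `a_(0)² = 0`, and the derivation rule lets all products descend to kernel modulo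
image. The formula is a uniqueness statement: both sides are fields local to every field, they agree
on the vacuum, and a local field that kills the vacuum is zero (`MutLocal.apply_eq_zero`).

The Fock space is a vertex superalgebra by reconstruction. The free fields and vertex operators are
mutually local and translation covariant. Dong's lemma (`IsResProd.mutLocal`) and its analogue for
covariance (`IsResProd.isCovariant`) carry this over to normally ordered products, hence to the
fields of all states. Identities involving vertex operators are checked through
`eq_zero_of_commutators`, which reduces them to matrix coefficients between lattice states. For two
vertex operators these coefficients are those of `(z - w)^(l,μ)` in the two expansion domains. After
multiplication by a high power of `z - w` both become one polynomial, up to a sign `(-1)^(l,μ)` that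
the cocycle absorbs.

The state of the differential is a combination of states `g^ferm_(-1) |l⟩` with `l` in `K ⊕ K^∨`
having a nonzero coordinate at `g`; for the `F`-part this is what `F^i|_{x_i=0} = 0` provides. In
the product of two such fields the vertex operators contribute `(z - w)^(l,ν)` with `(l,ν) ≥ 0`, and
the fermions contribute at most a simple pole, only when their generators are dual. In that case the
two nonzero coordinates force `(l,ν) ≥ 1`, which cancels the pole. So the product is nonsingular and
`a_(0) a = 0`. -/

noncomputable section Expansions


/-! ### Formal distributions and the two expansions of powers of `z - w`. -/

variable {V : Type*} [AddCommGroup V] [Module ℂ V]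

/-- Multiplication of a formal distribution in two variables `z`, `w` by `z - w`. -/
def diffShift : Module.End ℂ (ℤ → ℤ → V) where
  toFun f := fun i j => f (i + 1) j - f i (j + 1)
  map_add' f g := by funext i j; simp only [Pi.add_apply]; abel
  map_smul' r f := by funext i j; simp [smul_sub]

theorem diffShift_apply (f : ℤ → ℤ → V) (i j : ℤ) :
    diffShift f i j = f (i + 1) j - f i (j + 1) := rfl

theorem diffShift_pow_succ_apply (N : ℕ) (f : ℤ → ℤ → V) (i j : ℤ) :
    (diffShift ^ (N + 1)) f i j = (diffShift ^ N) f (i + 1) j - (diffShift ^ N) f i (j + 1) := by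
  rw [pow_succ', Module.End.mul_apply, diffShift_apply]

/-- With `f i j` read as the coefficient of `z^(-i-1) w^(-j-1)`, this is the binomial expansion of
`(z - w)^N`, by Pascal's rule. The right side has the shape of the `locality` axiom, so locality can
be treated as vanishing under a power of one operator. -/
theorem diffShift_pow_apply (N : ℕ) (f : ℤ → ℤ → V) (k l : ℤ) :
    (diffShift ^ N) f k l = ∑ j ∈ Finset.range (N + 1),
      ((-1 : ℂ) ^ j * (N.choose j : ℂ)) • f (k + N - j) (l + j) := by
  induction N generalizing k l with
  | zero => simp
  | succ N ih =>
    rw [diffShift_pow_succ_apply, ih, ih]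
    rw [Finset.sum_range_succ' (fun j => ((-1 : ℂ) ^ j * ((N + 1).choose j : ℂ)) •
        f (k + (N + 1 : ℕ) - j) (l + j)) (N + 1),
      Finset.sum_range_succ (fun j => ((-1 : ℂ) ^ (j + 1) * ((N + 1).choose (j + 1) : ℂ)) •
        f (k + (N + 1 : ℕ) - (j + 1 : ℕ)) (l + (j + 1 : ℕ))) N,
      Finset.sum_range_succ' (fun j => ((-1 : ℂ) ^ j * (N.choose j : ℂ)) •
        f (k + 1 + N - j) (l + j)) N,
      Finset.sum_range_succ (fun j => ((-1 : ℂ) ^ j * (N.choose j : ℂ)) •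
        f (k + N - j) (l + 1 + j)) N]
    have h : ∀ j ∈ Finset.range N,
        ((-1 : ℂ) ^ (j + 1) * ((N + 1).choose (j + 1) : ℂ)) •
          f (k + (N + 1 : ℕ) - (j + 1 : ℕ)) (l + (j + 1 : ℕ))
        = ((-1 : ℂ) ^ (j + 1) * (N.choose (j + 1) : ℂ)) •
          f (k + 1 + N - (j + 1 : ℕ)) (l + (j + 1 : ℕ))
          - ((-1 : ℂ) ^ j * (N.choose j : ℂ)) • f (k + N - j) (l + 1 + j) := by
      intro j _
      rw [show k + ((N + 1 : ℕ) : ℤ) - ((j + 1 : ℕ) : ℤ) = k + N - j by push_cast; ring,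
        show k + 1 + (N : ℤ) - ((j + 1 : ℕ) : ℤ) = k + N - j by push_cast; ring,
        show l + 1 + (j : ℤ) = l + ((j + 1 : ℕ) : ℤ) by push_cast; ring, ← sub_smul]
      congr 1
      rw [Nat.choose_succ_succ]
      push_cast
      ring
    rw [Finset.sum_congr rfl h, Finset.sum_sub_distrib]
    rw [show k + ((N + 1 : ℕ) : ℤ) - ((N + 1 : ℕ) : ℤ) = k + N - N by push_cast; ring,
      show l + ((N + 1 : ℕ) : ℤ) = l + 1 + N by push_cast; ring,
      show k + ((N + 1 : ℕ) : ℤ) - ((0 : ℕ) : ℤ) = k + 1 + N - ((0 : ℕ) : ℤ) by push_cast; ring]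
    simp only [Nat.choose_self, Nat.choose_zero_right, pow_succ]
    have e : ((-1 : ℂ) ^ N * -1 * ((1 : ℕ) : ℂ)) = - ((-1 : ℂ) ^ N * ((1 : ℕ) : ℂ)) := by ring
    rw [e, neg_smul]
    abel

theorem diffShift_pow_eq_zero_of_le {N M : ℕ} (h : N ≤ M) {f : ℤ → ℤ → V}
    (hf : (diffShift ^ N) f = 0) : (diffShift ^ M) f = 0 := by
  rw [← Nat.sub_add_cancel h, pow_add, Module.End.mul_apply, hf, map_zero]

theorem diffShift_pow_comp {W : Type*} [AddCommGroup W] [Module ℂ W] (L : V →ₗ[ℂ] W) (N : ℕ)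
    (f : ℤ → ℤ → V) (i j : ℤ) :
    (diffShift ^ N) (fun i j => L (f i j)) i j = L ((diffShift ^ N) f i j) := by
  simp only [diffShift_pow_apply, map_sum, map_smul]

theorem diffShift_pow_swap (N : ℕ) (f : ℤ → ℤ → V) (i j : ℤ) :
    (diffShift ^ N) (fun i j => f j i) i j = (-1 : ℂ) ^ N • (diffShift ^ N) f j i := by
  induction N generalizing i j with
  | zero => simp
  | succ N ih =>
    rw [diffShift_pow_succ_apply, ih, ih, diffShift_pow_succ_apply, pow_succ, ← smul_sub, mul_smul,
      neg_one_smul, neg_sub]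

/-- Multiplication by `z - w` of formal distributions in `z`, `w`, `u`. -/
def diffShift₁₂ : Module.End ℂ (ℤ → ℤ → ℤ → V) where
  toFun f := fun i j k => f (i + 1) j k - f i (j + 1) k
  map_add' f g := by funext i j k; simp only [Pi.add_apply]; abel
  map_smul' r f := by funext i j k; simp [smul_sub]

/-- Multiplication by `z - u` of formal distributions in `z`, `w`, `u`. -/
def diffShift₁₃ : Module.End ℂ (ℤ → ℤ → ℤ → V) where
  toFun f := fun i j k => f (i + 1) j k - f i j (k + 1)
  map_add' f g := by funext i j k; simp only [Pi.add_apply]; abel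
  map_smul' r f := by funext i j k; simp [smul_sub]

/-- Multiplication by `w - u` of formal distributions in `z`, `w`, `u`. -/
def diffShift₂₃ : Module.End ℂ (ℤ → ℤ → ℤ → V) where
  toFun f := fun i j k => f i (j + 1) k - f i j (k + 1)
  map_add' f g := by funext i j k; simp only [Pi.add_apply]; abel
  map_smul' r f := by funext i j k; simp [smul_sub]

theorem diffShift₁₂_apply (f : ℤ → ℤ → ℤ → V) (i j k : ℤ) :
    diffShift₁₂ f i j k = f (i + 1) j k - f i (j + 1) k := rfl

theorem diffShift₁₃_apply (f : ℤ → ℤ → ℤ → V) (i j k : ℤ) :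
    diffShift₁₃ f i j k = f (i + 1) j k - f i j (k + 1) := rfl

theorem diffShift₂₃_apply (f : ℤ → ℤ → ℤ → V) (i j k : ℤ) :
    diffShift₂₃ f i j k = f i (j + 1) k - f i j (k + 1) := rfl

/-- The identity `w - u = (z - u) - (z - w)`, on which Dong's lemma rests. -/
theorem diffShift₂₃_eq : (diffShift₂₃ : Module.End ℂ (ℤ → ℤ → ℤ → V))
    = -diffShift₁₂ + diffShift₁₃ := by
  ext f i j k
  simp only [LinearMap.add_apply, LinearMap.neg_apply, Pi.add_apply, Pi.neg_apply,
    diffShift₁₂_apply, diffShift₁₃_apply, diffShift₂₃_apply]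
  abel

theorem commute_diffShift₁₂₁₃ :
    Commute (diffShift₁₂ : Module.End ℂ (ℤ → ℤ → ℤ → V)) diffShift₁₃ := by
  refine LinearMap.ext fun f => ?_
  ext i j k
  simp only [Module.End.mul_apply, diffShift₁₂_apply, diffShift₁₃_apply]
  abel

theorem commute_diffShift₁₂₂₃ :
    Commute (diffShift₁₂ : Module.End ℂ (ℤ → ℤ → ℤ → V)) diffShift₂₃ := by
  rw [diffShift₂₃_eq]
  exact (Commute.neg_right (Commute.refl (diffShift₁₂ : Module.End ℂ (ℤ → ℤ → ℤ → V)))).add_right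
    commute_diffShift₁₂₁₃

theorem commute_diffShift₁₃₂₃ :
    Commute (diffShift₁₃ : Module.End ℂ (ℤ → ℤ → ℤ → V)) diffShift₂₃ := by
  rw [diffShift₂₃_eq]
  exact (Commute.neg_right (commute_diffShift₁₂₁₃ (V := V)).symm).add_right (Commute.refl _)

theorem diffShift₁₂_pow_apply (N : ℕ) (f : ℤ → ℤ → ℤ → V) (i j k : ℤ) :
    (diffShift₁₂ ^ N) f i j k = (diffShift ^ N) (fun i j => f i j k) i j := by
  induction N generalizing i j k with
  | zero => rfl
  | succ N ih => rw [pow_succ', Module.End.mul_apply, diffShift₁₂_apply, ih, ih,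
      diffShift_pow_succ_apply]

theorem diffShift₁₃_pow_apply (N : ℕ) (f : ℤ → ℤ → ℤ → V) (i j k : ℤ) :
    (diffShift₁₃ ^ N) f i j k = (diffShift ^ N) (fun i k => f i j k) i k := by
  induction N generalizing i j k with
  | zero => rfl
  | succ N ih => rw [pow_succ', Module.End.mul_apply, diffShift₁₃_apply, ih, ih,
      diffShift_pow_succ_apply]

theorem diffShift₂₃_pow_apply (N : ℕ) (f : ℤ → ℤ → ℤ → V) (i j k : ℤ) :
    (diffShift₂₃ ^ N) f i j k = (diffShift ^ N) (f i) j k := by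
  induction N generalizing i j k with
  | zero => rfl
  | succ N ih => rw [pow_succ', Module.End.mul_apply, diffShift₂₃_apply, ih, ih,
      diffShift_pow_succ_apply]

/-- The coefficient of `x^j` in `(1 - x)^n`. -/
def binomCoeff (n : ℤ) : ℕ → ℂ
  | 0 => 1
  | j + 1 => binomCoeff n j * ((j - n) / (j + 1))

@[simp] theorem binomCoeff_zero_right (n : ℤ) : binomCoeff n 0 = 1 := rfl

theorem binomCoeff_succ_mul (n : ℤ) (j : ℕ) :
    binomCoeff n (j + 1) * (j + 1) = binomCoeff n j * (j - n) := by
  have : (j : ℂ) + 1 ≠ 0 := by exact_mod_cast j.succ_ne_zero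
  rw [binomCoeff]
  field_simp

theorem binomCoeff_succ_succ (n : ℤ) (j : ℕ) :
    binomCoeff (n + 1) (j + 1) = binomCoeff n (j + 1) - binomCoeff n j := by
  induction j with
  | zero => simp [binomCoeff]; ring
  | succ j ih =>
    have h2 : (j : ℂ) + 1 + 1 ≠ 0 := by exact_mod_cast (j + 1).succ_ne_zero
    have e := binomCoeff_succ_mul n j
    have e1 := binomCoeff_succ_mul n (j + 1)
    have e2 := binomCoeff_succ_mul (n + 1) (j + 1)
    push_cast at e1 e2
    apply mul_right_cancel₀ h2
    rw [e2, ih]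
    linear_combination -e1 + e

theorem binomCoeff_zero_left_succ (j : ℕ) : binomCoeff 0 (j + 1) = 0 := by
  induction j with
  | zero => simp [binomCoeff]
  | succ j ih => rw [binomCoeff, ih, zero_mul]

/-- These are the weights in `normalOrdered`, which makes a normally ordered product a residue
product of negative index. -/
theorem binomCoeff_neg (k j : ℕ) : binomCoeff (-(k : ℤ) - 1) j = ((k + j).choose k : ℂ) := by
  induction j with
  | zero => simp
  | succ j ih =>
    have h : (j : ℂ) + 1 ≠ 0 := by exact_mod_cast j.succ_ne_zero
    apply mul_right_cancel₀ h
    rw [binomCoeff_succ_mul, ih]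
    have h2 := Nat.add_one_mul_choose_eq (k + j) j
    have h3 := Nat.choose_symm_add (a := k) (b := j)
    have h4 := Nat.choose_symm_add (a := k) (b := j + 1)
    rw [h3, h4, show k + (j + 1) = k + j + 1 by ring]
    have h5 : ((k + j + 1 : ℕ) : ℂ) * ((k + j).choose j : ℂ)
      = ((k + j + 1).choose (j + 1) : ℂ) * ((j + 1 : ℕ) : ℂ) := by exact_mod_cast h2
    push_cast at h5 ⊢
    linear_combination h5

theorem binomCoeff_natCast (R j : ℕ) : binomCoeff R j = (-1) ^ j * (R.choose j : ℂ) := by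
  induction R generalizing j with
  | zero => cases j with
    | zero => simp
    | succ j => simpa using binomCoeff_zero_left_succ j
  | succ R ih => cases j with
    | zero => simp
    | succ j =>
      push_cast
      rw [binomCoeff_succ_succ, ih, ih, Nat.choose_succ_succ]
      push_cast
      ring

/-- The distributions `f` whose coefficients `f i j k` vanish for large `j`, locally uniformly
in `k` and uniformly in `i`. -/
def TruncatedSnd (f : ℤ → ℤ → ℤ → V) : Prop := ∀ k, ∃ J : ℤ, ∀ j, J ≤ j → ∀ i, f i j k = 0

/-- Multiplication by `(z - w)^n`, expanded in the domain `|z| > |w|`. -/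
def expandMul (n : ℤ) (f : ℤ → ℤ → ℤ → V) : ℤ → ℤ → ℤ → V := fun p m k =>
  ∑ᶠ j : ℕ, binomCoeff n j • f (p + n - j) (m + j) k

theorem finsum_nat_eq_sum_range {M : Type*} [AddCommMonoid M] {f : ℕ → M} {J : ℕ}
    (h : ∀ j, J ≤ j → f j = 0) : ∑ᶠ j, f j = ∑ j ∈ Finset.range J, f j := by
  apply finsum_eq_sum_of_support_subset
  intro j hj
  by_contra hc
  exact hj (h j (by simpa using hc))

/-- The cutoff does not depend on `n` and `p`, and may be enlarged, so several expansions can be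
written over one common range and compared term by term. -/
theorem TruncatedSnd.exists_expandMul {f : ℤ → ℤ → ℤ → V} (hf : TruncatedSnd f) (m k : ℤ) :
    ∃ J₀ : ℕ, ∀ J, J₀ ≤ J → ∀ n p, expandMul n f p m k =
      ∑ j ∈ Finset.range J, binomCoeff n j • f (p + n - j) (m + j) k := by
  obtain ⟨J, hJ⟩ := hf k
  refine ⟨(J - m).toNat, fun J' hJ' n p => finsum_nat_eq_sum_range fun j hj => ?_⟩
  rw [hJ _ (by omega), smul_zero]

set_option linter.unusedSectionVars false in
theorem TruncatedSnd.add {f g : ℤ → ℤ → ℤ → V} (hf : TruncatedSnd f) (hg : TruncatedSnd g) :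
    TruncatedSnd (f + g) := fun k => by
  obtain ⟨J, hJ⟩ := hf k
  obtain ⟨J', hJ'⟩ := hg k
  refine ⟨max J J', fun j hj i => ?_⟩
  simp [hJ j (le_trans (le_max_left _ _) hj), hJ' j (le_trans (le_max_right _ _) hj)]

theorem TruncatedSnd.smul {f : ℤ → ℤ → ℤ → V} (hf : TruncatedSnd f) (r : ℂ) :
    TruncatedSnd (r • f) := fun k => by
  obtain ⟨J, hJ⟩ := hf k
  exact ⟨J, fun j hj i => by simp [hJ j hj]⟩

theorem TruncatedSnd.diff₁₂ {f : ℤ → ℤ → ℤ → V} (hf : TruncatedSnd f) :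
    TruncatedSnd (diffShift₁₂ f) := fun k => by
  obtain ⟨J, hJ⟩ := hf k
  exact ⟨J, fun j hj i => by simp [diffShift₁₂_apply, hJ j hj, hJ (j + 1) (by omega)]⟩

theorem TruncatedSnd.diff₁₃ {f : ℤ → ℤ → ℤ → V} (hf : TruncatedSnd f) :
    TruncatedSnd (diffShift₁₃ f) := fun k => by
  obtain ⟨J, hJ⟩ := hf k
  obtain ⟨J', hJ'⟩ := hf (k + 1)
  refine ⟨max J J', fun j hj i => ?_⟩
  simp [diffShift₁₃_apply, hJ j (le_trans (le_max_left _ _) hj),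
    hJ' j (le_trans (le_max_right _ _) hj)]

theorem TruncatedSnd.diff₂₃ {f : ℤ → ℤ → ℤ → V} (hf : TruncatedSnd f) :
    TruncatedSnd (diffShift₂₃ f) := by
  rw [diffShift₂₃_eq, LinearMap.add_apply, LinearMap.neg_apply, ← neg_one_smul ℂ]
  exact (hf.diff₁₂.smul _).add hf.diff₁₃

theorem TruncatedSnd.pow {L : Module.End ℂ (ℤ → ℤ → ℤ → V)}
    (hL : ∀ f, TruncatedSnd f → TruncatedSnd (L f)) {f : ℤ → ℤ → ℤ → V} (hf : TruncatedSnd f)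
    (N : ℕ) : TruncatedSnd ((L ^ N) f) := by
  induction N with
  | zero => exact hf
  | succ N ih => rw [pow_succ', Module.End.mul_apply]; exact hL _ ih

theorem TruncatedSnd.expandMul_add {f g : ℤ → ℤ → ℤ → V} (hf : TruncatedSnd f)
    (hg : TruncatedSnd g) (n : ℤ) : expandMul n (f + g) = expandMul n f + expandMul n g := by
  funext p m k
  obtain ⟨J₁, h₁⟩ := hf.exists_expandMul m k
  obtain ⟨J₂, h₂⟩ := hg.exists_expandMul m k
  obtain ⟨J₃, h₃⟩ := (hf.add hg).exists_expandMul m k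
  let J := max J₁ (max J₂ J₃)
  rw [Pi.add_apply, Pi.add_apply, Pi.add_apply, h₁ J (by simp [J]), h₂ J (by simp [J]),
    h₃ J (by simp [J]), ← Finset.sum_add_distrib]
  simp

theorem expandMul_smul (r : ℂ) (f : ℤ → ℤ → ℤ → V) (n : ℤ) :
    expandMul n (r • f) = r • expandMul n f := by
  funext p m k
  simp only [expandMul, Pi.smul_apply, smul_comm _ r, ← smul_finsum]

/-- Pascal's rule for `(1 - x)^(n+1)`. Truncation is essential: the two halves of the difference are
summed separately, and one is reindexed. -/
theorem TruncatedSnd.expandMul_diffShift₁₂ {f : ℤ → ℤ → ℤ → V} (hf : TruncatedSnd f) (n : ℤ) :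
    expandMul n (diffShift₁₂ f) = expandMul (n + 1) f := by
  funext p m k
  obtain ⟨J₁, h₁⟩ := hf.diff₁₂.exists_expandMul m k
  obtain ⟨J₂, h₂⟩ := hf.exists_expandMul m k
  obtain ⟨J₃, h₃⟩ := hf k
  let J := max J₁ (max J₂ (J₃ - m).toNat)
  have hJ3 : (J₃ - m).toNat ≤ J := by simp [J]
  -- One term beyond the cutoff: the reindexing by one pushes a boundary term to index `J`, where
  -- `h0` kills it.
  rw [h₁ (J + 1) (by simp [J]; omega), h₂ (J + 1) (by simp [J]; omega)]
  simp only [diffShift₁₂_apply, smul_sub, Finset.sum_sub_distrib]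
  have h0 : ∀ i, f i (m + J + 1) k = 0 := fun i => h₃ _ (by omega) i
  rw [Finset.sum_range_succ' _ J, Finset.sum_range_succ _ J, h0, Finset.sum_range_succ' _ J,
    smul_zero, add_zero, add_sub_right_comm, ← Finset.sum_sub_distrib]
  congr 1
  · refine Finset.sum_congr rfl fun j _ => ?_
    rw [binomCoeff_succ_succ, sub_smul]
    congr 3 <;> push_cast <;> ring
  · simp [add_assoc]

theorem expandMul_zero (f : ℤ → ℤ → ℤ → V) : expandMul 0 f = f := by
  funext p m k
  rw [expandMul, finsum_nat_eq_sum_range (J := 1)]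
  · simp
  · intro j hj
    obtain ⟨j, rfl⟩ := Nat.exists_eq_add_of_le' hj
    rw [binomCoeff_zero_left_succ, zero_smul]

theorem TruncatedSnd.expandMul_diffShift₁₂_pow {f : ℤ → ℤ → ℤ → V} (hf : TruncatedSnd f) (n : ℤ)
    (s : ℕ) : expandMul n ((diffShift₁₂ ^ s) f) = expandMul (n + s) f := by
  induction s generalizing n with
  | zero => simp
  | succ s ih =>
    rw [pow_succ', Module.End.mul_apply, (hf.pow (fun _ h => h.diff₁₂) s).expandMul_diffShift₁₂,
      ih]
    congr 1; push_cast; ring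

theorem TruncatedSnd.expandMul_natCast {f : ℤ → ℤ → ℤ → V} (hf : TruncatedSnd f) (s : ℕ) :
    expandMul s f = (diffShift₁₂ ^ s) f := by
  rw [← zero_add (s : ℤ), ← hf.expandMul_diffShift₁₂_pow, expandMul_zero]

theorem TruncatedSnd.expandMul_diffShift₂₃ {f : ℤ → ℤ → ℤ → V} (hf : TruncatedSnd f) (n : ℤ) :
    expandMul n (diffShift₂₃ f) = diffShift₂₃ (expandMul n f) := by
  funext p m k
  obtain ⟨J₁, h₁⟩ := hf.diff₂₃.exists_expandMul m k
  obtain ⟨J₂, h₂⟩ := hf.exists_expandMul (m + 1) k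
  obtain ⟨J₃, h₃⟩ := hf.exists_expandMul m (k + 1)
  let J := max J₁ (max J₂ J₃)
  rw [h₁ J (by simp [J]), diffShift₂₃_apply, h₂ J (by simp [J]), h₃ J (by simp [J]),
    ← Finset.sum_sub_distrib]
  refine Finset.sum_congr rfl fun j _ => ?_
  rw [diffShift₂₃_apply, smul_sub]
  congr 3; ring

theorem TruncatedSnd.expandMul_diffShift₂₃_pow {f : ℤ → ℤ → ℤ → V} (hf : TruncatedSnd f) (n : ℤ)
    (s : ℕ) : expandMul n ((diffShift₂₃ ^ s) f) = (diffShift₂₃ ^ s) (expandMul n f) := by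
  induction s with
  | zero => simp
  | succ s ih =>
    rw [pow_succ', Module.End.mul_apply, Module.End.mul_apply,
      (hf.pow (fun _ h => h.diff₂₃) s).expandMul_diffShift₂₃, ih]

end Expansions

/-! ### Mutual locality and Dong's lemma. -/

noncomputable section Locality

variable {V : Type*} [AddCommGroup V] [Module ℂ V]

theorem TruncatedSnd.expandMul_diffShift₁₃ {f : ℤ → ℤ → ℤ → V} (hf : TruncatedSnd f) (n : ℤ) :
    expandMul n (diffShift₁₃ f) = diffShift₁₃ (expandMul n f) := by
  funext p m k
  obtain ⟨J₁, h₁⟩ := hf.diff₁₃.exists_expandMul m k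
  obtain ⟨J₂, h₂⟩ := hf.exists_expandMul m k
  obtain ⟨J₃, h₃⟩ := hf.exists_expandMul m (k + 1)
  let J := max J₁ (max J₂ J₃)
  rw [h₁ J (by simp [J]), diffShift₁₃_apply, h₂ J (by simp [J]), h₃ J (by simp [J]),
    ← Finset.sum_sub_distrib]
  refine Finset.sum_congr rfl fun j _ => ?_
  rw [diffShift₁₃_apply, smul_sub]
  congr 3; ring

theorem TruncatedSnd.expandMul_diffShift₁₃_pow {f : ℤ → ℤ → ℤ → V} (hf : TruncatedSnd f) (n : ℤ)
    (s : ℕ) : expandMul n ((diffShift₁₃ ^ s) f) = (diffShift₁₃ ^ s) (expandMul n f) := by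
  induction s with
  | zero => simp
  | succ s ih =>
    rw [pow_succ', Module.End.mul_apply, Module.End.mul_apply,
      (hf.pow (fun _ h => h.diff₁₃) s).expandMul_diffShift₁₃, ih]

@[simp] theorem expandMul_apply_zero (n : ℤ) : expandMul n (0 : ℤ → ℤ → ℤ → V) = 0 := by
  funext p m k
  simp [expandMul]

theorem expandMul_sum {ι : Type*} (S : Finset ι) (f : ι → ℤ → ℤ → ℤ → V)
    (hf : ∀ s ∈ S, TruncatedSnd (f s)) (n : ℤ) :
    expandMul n (∑ s ∈ S, f s) = ∑ s ∈ S, expandMul n (f s) ∧ TruncatedSnd (∑ s ∈ S, f s) := by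
  classical
  induction S using Finset.induction_on with
  | empty => exact ⟨expandMul_apply_zero n, fun k => ⟨0, fun _ _ _ => rfl⟩⟩
  | insert a S ha ih =>
    have h1 := hf a (Finset.mem_insert_self _ _)
    obtain ⟨h2, h3⟩ := ih fun s hs => hf s (Finset.mem_insert_of_mem hs)
    rw [Finset.sum_insert ha, Finset.sum_insert ha]
    exact ⟨by rw [h1.expandMul_add h3, h2], h1.add h3⟩

/-- Exchange of the first two variables of a formal distribution. -/
def swapVars : Module.End ℂ (ℤ → ℤ → ℤ → V) where
  toFun f := fun i j k => f j i k
  map_add' _ _ := rfl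
  map_smul' _ _ := rfl

theorem swapVars_apply (f : ℤ → ℤ → ℤ → V) (i j k : ℤ) : swapVars f i j k = f j i k := rfl

theorem swapVars_swapVars (f : ℤ → ℤ → ℤ → V) : swapVars (swapVars f) = f := rfl

theorem swapVars_diffShift₁₂_pow (s : ℕ) (f : ℤ → ℤ → ℤ → V) :
    swapVars ((diffShift₁₂ ^ s) f) = (-1 : ℂ) ^ s • (diffShift₁₂ ^ s) (swapVars f) := by
  funext i j k
  simp only [Pi.smul_apply, swapVars_apply, diffShift₁₂_pow_apply]
  have h := diffShift_pow_swap s (fun i j => f j i k) j i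
  simpa using h

theorem swapVars_diffShift₁₃_pow (s : ℕ) (f : ℤ → ℤ → ℤ → V) :
    swapVars ((diffShift₁₃ ^ s) f) = (diffShift₂₃ ^ s) (swapVars f) := by
  funext i j k
  simp only [swapVars_apply, diffShift₁₃_pow_apply, diffShift₂₃_pow_apply]
  rfl

theorem swapVars_diffShift₂₃_pow (s : ℕ) (f : ℤ → ℤ → ℤ → V) :
    swapVars ((diffShift₂₃ ^ s) f) = (diffShift₁₃ ^ s) (swapVars f) := by
  rw [← swapVars_swapVars ((diffShift₁₃ ^ s) _), swapVars_diffShift₁₃_pow, swapVars_swapVars]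

/-- Multiplication by `(z - w)^n`, expanded in the domain `|w| > |z|`. -/
def expandMul' (n : ℤ) (f : ℤ → ℤ → ℤ → V) : ℤ → ℤ → ℤ → V :=
  (-1 : ℂ) ^ n • swapVars (expandMul n (swapVars f))

/-- Swapping the variables turns `(z - w)^s` into `(-1)^s (z - w)^s`; the prefactor `(-1)^n` in
`expandMul'` makes the signs combine to `(-1)^(n+s)`. -/
theorem expandMul'_diffShift₁₂_pow {f : ℤ → ℤ → ℤ → V} (hf : TruncatedSnd (swapVars f)) (n : ℤ)
    (s : ℕ) : expandMul' n ((diffShift₁₂ ^ s) f) = expandMul' (n + s) f := by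
  rw [expandMul', swapVars_diffShift₁₂_pow, expandMul_smul, hf.expandMul_diffShift₁₂_pow,
    expandMul', map_smul, smul_smul, zpow_add₀ (by norm_num), zpow_natCast]

theorem expandMul'_natCast {f : ℤ → ℤ → ℤ → V} (hf : TruncatedSnd (swapVars f)) (s : ℕ) :
    expandMul' s f = (diffShift₁₂ ^ s) f := by
  rw [← zero_add (s : ℤ), ← expandMul'_diffShift₁₂_pow hf, expandMul', expandMul_zero]
  simp [swapVars_swapVars]

theorem expandMul'_diffShift₂₃_pow {f : ℤ → ℤ → ℤ → V} (hf : TruncatedSnd (swapVars f)) (n : ℤ)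
    (s : ℕ) : expandMul' n ((diffShift₂₃ ^ s) f) = (diffShift₂₃ ^ s) (expandMul' n f) := by
  rw [expandMul', swapVars_diffShift₂₃_pow, hf.expandMul_diffShift₁₃_pow, swapVars_diffShift₁₃_pow,
    expandMul', map_smul]

/-- Of the `N + K` factors `w - u`, `N` are kept and the other `K` are expanded binomially in `z -
w` and `z - u`. -/
theorem diffShift₂₃_pow_add (N K : ℕ) (f : ℤ → ℤ → ℤ → V) :
    (diffShift₂₃ ^ (N + K)) f = ∑ s ∈ Finset.range (K + 1), ((-1 : ℂ) ^ s * (K.choose s : ℂ)) •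
      (diffShift₁₂ ^ s) ((diffShift₁₃ ^ (K - s)) ((diffShift₂₃ ^ N) f)) := by
  rw [add_comm, pow_add, Module.End.mul_apply]
  generalize (diffShift₂₃ ^ N) f = h
  have e : (diffShift₂₃ : Module.End ℂ (ℤ → ℤ → ℤ → V))
      = (-1 : ℂ) • diffShift₁₂ + diffShift₁₃ := by rw [diffShift₂₃_eq]; module
  rw [e, ((commute_diffShift₁₂₁₃ (V := V)).smul_left (-1 : ℂ)).add_pow, LinearMap.sum_apply]
  refine Finset.sum_congr rfl fun s _ => ?_
  rw [smul_pow]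
  simp only [Module.End.mul_apply, LinearMap.smul_apply, mul_smul, Module.End.natCast_apply,
    map_nsmul, Nat.cast_smul_eq_nsmul]
  rw [smul_comm]

/-- The formal distribution behind Dong's lemma. -/
theorem diffShift₂₃_pow_expandMul_sub {G G' : ℤ → ℤ → ℤ → V} (hG : TruncatedSnd G)
    (hG' : TruncatedSnd (swapVars G')) (N : ℕ) (n : ℤ)
    (h₁₂ : (diffShift₁₂ ^ N) (G - G') = 0)
    (hQ : (diffShift₁₃ ^ N) ((diffShift₂₃ ^ N) G) = 0)
    (hQ' : (diffShift₁₃ ^ N) ((diffShift₂₃ ^ N) G') = 0) :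
    (diffShift₂₃ ^ (N + (2 * N + n.natAbs))) (expandMul n G - expandMul' n G') = 0 := by
  -- With this `K` every binomial index `s ≤ K` satisfies `N ≤ K - s` or `N ≤ n + s`. Either the
  -- powers of `z - u` and `w - u` suffice to kill both distributions, or the power of `z - w`
  -- suffices to kill their difference.
  set K := 2 * N + n.natAbs
  rw [map_sub, ← hG.expandMul_diffShift₂₃_pow, ← expandMul'_diffShift₂₃_pow hG', sub_eq_zero,
    diffShift₂₃_pow_add, diffShift₂₃_pow_add, expandMul', map_sum]
  let h (s : ℕ) := (diffShift₁₃ ^ (K - s)) ((diffShift₂₃ ^ N) G)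
  let h' (s : ℕ) := (diffShift₁₃ ^ (K - s)) ((diffShift₂₃ ^ N) G')
  have hh : ∀ s, TruncatedSnd (h s) := fun s =>
    (hG.pow (fun _ h => h.diff₂₃) N).pow (fun _ h => h.diff₁₃) _
  have hh' : ∀ s, TruncatedSnd (swapVars (h' s)) := fun s => by
    simp only [h', swapVars_diffShift₁₃_pow, swapVars_diffShift₂₃_pow]
    exact (hG'.pow (fun _ h => h.diff₁₃) N).pow (fun _ h => h.diff₂₃) _
  have key : ∀ s ∈ Finset.range (K + 1), expandMul n ((diffShift₁₂ ^ s) (h s))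
      = expandMul' n ((diffShift₁₂ ^ s) (h' s)) := by
    intro s hs
    rw [(hh s).expandMul_diffShift₁₂_pow, expandMul'_diffShift₁₂_pow (hh' s)]
    by_cases hK : N ≤ K - s
    · have e : ∀ g : ℤ → ℤ → ℤ → V, (diffShift₁₃ ^ N) ((diffShift₂₃ ^ N) g) = 0 →
          (diffShift₁₃ ^ (K - s)) ((diffShift₂₃ ^ N) g) = 0 := fun g hg => by
        rw [← Nat.sub_add_cancel hK, pow_add, Module.End.mul_apply, hg, map_zero]
      simp only [h, h', e G hQ, e G' hQ', expandMul', map_zero, expandMul_apply_zero, smul_zero]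
    -- The total exponent of `z - w` is nonnegative here, so both expansions are plain
    -- multiplication by the same polynomial.
    · obtain ⟨r, hr⟩ : ∃ r : ℕ, n + s = r := ⟨(n + s).toNat, by omega⟩
      have hrN : N ≤ r := by omega
      rw [hr, (hh s).expandMul_natCast, expandMul'_natCast (hh' s), ← sub_eq_zero, ← map_sub]
      simp only [h, h']
      rw [← map_sub, ← map_sub]
      have c₁ := (commute_diffShift₁₂₁₃ (V := V)).pow_pow r (K - s)
      have c₂ := (commute_diffShift₁₂₂₃ (V := V)).pow_pow r N
      rw [← Module.End.mul_apply, c₁.eq, Module.End.mul_apply,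
        ← Module.End.mul_apply (diffShift₁₂ ^ r), c₂.eq, Module.End.mul_apply,
        ← Nat.sub_add_cancel hrN, pow_add, Module.End.mul_apply, h₁₂, map_zero, map_zero, map_zero]
  have hs₁ := expandMul_sum (Finset.range (K + 1))
    (fun s => ((-1 : ℂ) ^ s * (K.choose s : ℂ)) • (diffShift₁₂ ^ s) (h s))
    (fun s _ => ((hh s).pow (fun _ h => h.diff₁₂) s).smul _) n
  have hs₂ := expandMul_sum (Finset.range (K + 1))
    (fun s => ((-1 : ℂ) ^ s * (K.choose s : ℂ)) • swapVars ((diffShift₁₂ ^ s) (h' s)))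
    (fun s _ => by
      rw [swapVars_diffShift₁₂_pow]
      exact (((hh' s).pow (fun _ h => h.diff₁₂) s).smul _).smul _) n
  simp only [map_smul]
  rw [hs₁.1, hs₂.1, map_sum, Finset.smul_sum]
  refine Finset.sum_congr rfl fun s hs => ?_
  have hk := key s hs
  rw [expandMul'] at hk
  rw [expandMul_smul, expandMul_smul, map_smul, smul_comm, ← hk]

/-- The supercommutator of two fields, applied to a vector. -/
def superComm (σ : ℂ) (a b : ℤ → Module.End ℂ V) (v : V) : ℤ → ℤ → V :=
  fun i j => a i (b j v) - σ • b j (a i v)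

/-- Mutual locality of fields, with sign `σ` in the supercommutator. -/
def MutLocal (σ : ℂ) (a b : ℤ → Module.End ℂ V) : Prop :=
  ∃ N : ℕ, ∀ v, (diffShift ^ N) (superComm σ a b v) = 0

/-- `a(z)` is a field, i.e. `a(z) v` is a Laurent series for all `v`. -/
def IsTruncated (a : ℤ → Module.End ℂ V) : Prop := ∀ v, ∃ N : ℤ, ∀ n, N ≤ n → a n v = 0

/-- `P(z)` is the `n`-th product of the fields `a(z)` and `b(z)`. -/
def IsResProd (n : ℤ) (σ : ℂ) (a b P : ℤ → Module.End ℂ V) : Prop := ∀ m v,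
  P m v = (∑ᶠ j : ℕ, binomCoeff n j • a (n - j) (b (m + j) v))
    - (σ * (-1) ^ n) • ∑ᶠ j : ℕ, binomCoeff n j • b (n + m - j) (a j v)

theorem IsResProd.exists_sum {n : ℤ} {σ : ℂ} {a b P : ℤ → Module.End ℂ V}
    (hP : IsResProd n σ a b P) (ha : IsTruncated a) (hb : IsTruncated b) (m : ℤ) (v : V) :
    ∃ J₀ : ℕ, ∀ J, J₀ ≤ J → P m v =
      (∑ j ∈ Finset.range J, binomCoeff n j • a (n - j) (b (m + j) v))
        - (σ * (-1) ^ n) • ∑ j ∈ Finset.range J, binomCoeff n j • b (n + m - j) (a j v) := by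
  obtain ⟨J₁, h₁⟩ := hb v
  obtain ⟨J₂, h₂⟩ := ha v
  refine ⟨max (J₁ - m).toNat J₂.toNat, fun J hJ => ?_⟩
  rw [hP, finsum_nat_eq_sum_range (J := J), finsum_nat_eq_sum_range (J := J)]
  · intro j hj
    rw [h₂ j (by omega), map_zero, smul_zero]
  · intro j hj
    rw [h₁ (m + j) (by omega), map_zero, smul_zero]

/-- Since `σ² = 1`, exchanging the fields multiplies the supercommutator by `-σ` and swaps its
variables. -/
theorem MutLocal.symm {σ : ℂ} (hσ : σ * σ = 1) {a b : ℤ → Module.End ℂ V} (h : MutLocal σ a b) :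
    MutLocal σ b a := by
  obtain ⟨N, hN⟩ := h
  refine ⟨N, fun v => ?_⟩
  have e : superComm σ b a v = (-σ) • fun i j => superComm σ a b v j i := by
    funext i j
    simp only [superComm, Pi.smul_apply, smul_sub, smul_smul, neg_mul, hσ, neg_smul, one_smul]
    abel
  rw [e, map_smul]
  funext i j
  rw [Pi.smul_apply, Pi.smul_apply, diffShift_pow_swap, hN]
  simp

theorem MutLocal.sub {σ : ℂ} {a b c : ℤ → Module.End ℂ V} (ha : MutLocal σ a c)
    (hb : MutLocal σ b c) : MutLocal σ (a - b) c := by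
  obtain ⟨N, hN⟩ := ha
  obtain ⟨M, hM⟩ := hb
  refine ⟨max N M, fun v => ?_⟩
  have e : superComm σ (a - b) c v = superComm σ a c v - superComm σ b c v := by
    funext i j
    simp only [superComm, Pi.sub_apply, LinearMap.sub_apply, map_sub, smul_sub]
    abel
  rw [e, map_sub, diffShift_pow_eq_zero_of_le (le_max_left _ _) (hN v),
    diffShift_pow_eq_zero_of_le (le_max_right _ _) (hM v), sub_zero]

/-- Dong's lemma. -/
theorem IsResProd.mutLocal {n : ℤ} {σab σac σbc : ℂ} {a b c P : ℤ → Module.End ℂ V}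
    (hP : IsResProd n σab a b P) (ha : IsTruncated a) (hb : IsTruncated b) (hab : MutLocal σab a b)
    (hac : MutLocal σac a c) (hbc : MutLocal σbc b c) : MutLocal (σac * σbc) P c := by
  obtain ⟨N₁, h₁⟩ := hab
  obtain ⟨N₂, h₂⟩ := hac
  obtain ⟨N₃, h₃⟩ := hbc
  let N := max N₁ (max N₂ N₃)
  replace h₁ v := diffShift_pow_eq_zero_of_le (show N₁ ≤ N by simp [N]) (h₁ v)
  replace h₂ v := diffShift_pow_eq_zero_of_le (show N₂ ≤ N by simp [N]) (h₂ v)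
  replace h₃ v := diffShift_pow_eq_zero_of_le (show N₃ ≤ N by simp [N]) (h₃ v)
  refine ⟨N + (2 * N + n.natAbs), fun v => ?_⟩
  -- `G` and `G'` are the supercommutators with `c(u)` of the two orderings `a(z) b(w)` and `σab
  -- b(w) a(z)`. Each is truncated in the variable its own expansion needs.
  let G : ℤ → ℤ → ℤ → V := fun i j k => a i (b j (c k v)) - (σac * σbc) • c k (a i (b j v))
  let G' : ℤ → ℤ → ℤ → V := fun i j k =>
    σab • (b j (a i (c k v)) - (σac * σbc) • c k (b j (a i v)))
  have hG : TruncatedSnd G := fun k => by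
    obtain ⟨J₁, hJ₁⟩ := hb (c k v)
    obtain ⟨J₂, hJ₂⟩ := hb v
    refine ⟨max J₁ J₂, fun j hj i => ?_⟩
    simp [G, hJ₁ j (le_trans (le_max_left _ _) hj), hJ₂ j (le_trans (le_max_right _ _) hj)]
  have hG' : TruncatedSnd (swapVars G') := fun k => by
    obtain ⟨J₁, hJ₁⟩ := ha (c k v)
    obtain ⟨J₂, hJ₂⟩ := ha v
    refine ⟨max J₁ J₂, fun j hj i => ?_⟩
    simp [swapVars_apply, G', hJ₁ j (le_trans (le_max_left _ _) hj),
      hJ₂ j (le_trans (le_max_right _ _) hj)]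
  have e₁₂ : (diffShift₁₂ ^ N) (G - G') = 0 := by
    funext i j k
    have e : (fun i j => (G - G') i j k) = superComm σab a b (c k v)
        - (σac * σbc) • fun i j => c k (superComm σab a b v i j) := by
      funext i j
      simp only [Pi.sub_apply, G, G', superComm, Pi.smul_apply, map_sub, map_smul]
      module
    rw [diffShift₁₂_pow_apply, e, map_sub, map_smul, h₁]
    simp only [zero_sub, Pi.neg_apply, Pi.smul_apply, Pi.zero_apply]
    rw [diffShift_pow_comp, h₁]
    simp
  -- Moving `c(u)` past one factor at a time splits `G` into a part killed by a power of `w - u` and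
  -- a part killed by a power of `z - u`.
  have hQ : (diffShift₁₃ ^ N) ((diffShift₂₃ ^ N) G) = 0 := by
    let A : ℤ → ℤ → ℤ → V := fun i j k => a i (superComm σbc b c v j k)
    let B : ℤ → ℤ → ℤ → V := fun i j k => σbc • superComm σac a c (b j v) i k
    have e : G = A + B := by
      funext i j k
      simp only [Pi.add_apply, G, A, B, superComm, map_sub, map_smul]
      module
    have hA : (diffShift₂₃ ^ N) A = 0 := by
      funext i j k
      rw [diffShift₂₃_pow_apply, diffShift_pow_comp, h₃]
      simp
    have hB : (diffShift₁₃ ^ N) B = 0 := by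
      funext i j k
      rw [diffShift₁₃_pow_apply]
      have := congrFun (congrFun (h₂ (b j v)) i) k
      simp only [B]
      refine (diffShift_pow_comp (LinearMap.lsmul ℂ V σbc) N (superComm σac a c (b j v))
        i k).trans ?_
      rw [this]
      simp
    rw [e, map_add, hA, zero_add, ← Module.End.mul_apply,
      ((commute_diffShift₁₃₂₃ (V := V)).pow_pow N N).eq, Module.End.mul_apply, hB, map_zero]
  have hQ' : (diffShift₁₃ ^ N) ((diffShift₂₃ ^ N) G') = 0 := by
    let A : ℤ → ℤ → ℤ → V := fun i j k => σab • b j (superComm σac a c v i k)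
    let B : ℤ → ℤ → ℤ → V := fun i j k => (σab * σac) • superComm σbc b c (a i v) j k
    have e : G' = A + B := by
      funext i j k
      simp only [Pi.add_apply, G', A, B, superComm, map_sub, map_smul]
      module
    have hA : (diffShift₁₃ ^ N) A = 0 := by
      funext i j k
      rw [diffShift₁₃_pow_apply]
      simp only [A]
      refine (diffShift_pow_comp (LinearMap.lsmul ℂ V σab ∘ₗ b j) N (superComm σac a c v)
        i k).trans ?_
      rw [h₂]
      simp
    have hB : (diffShift₂₃ ^ N) B = 0 := by
      funext i j k
      rw [diffShift₂₃_pow_apply]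
      simp only [B]
      refine (diffShift_pow_comp (LinearMap.lsmul ℂ V (σab * σac)) N
        (superComm σbc b c (a i v)) j k).trans ?_
      rw [h₃]
      simp
    rw [e, map_add, map_add, hB, map_zero, add_zero, ← Module.End.mul_apply,
      ((commute_diffShift₁₃₂₃ (V := V)).pow_pow N N).eq, Module.End.mul_apply, hA, map_zero]
  have key := diffShift₂₃_pow_expandMul_sub hG hG' N n e₁₂ hQ hQ'
  -- Index `0` in the first variable extracts the coefficient of `z⁻¹`, that is, the residue which
  -- defines the `n`-th product.
  have e : superComm (σac * σbc) P c v = (expandMul n G - expandMul' n G') 0 := by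
    funext m k
    obtain ⟨J₁, h₁⟩ := hP.exists_sum ha hb m (c k v)
    obtain ⟨J₂, h₂⟩ := hP.exists_sum ha hb m v
    obtain ⟨J₃, h₃⟩ := hG.exists_expandMul m k
    obtain ⟨J₄, h₄⟩ := hG'.exists_expandMul 0 k
    let J := max (max J₁ J₂) (max J₃ J₄)
    have hJ₁ : J₁ ≤ J := by simp [J]
    have hJ₂ : J₂ ≤ J := by simp [J]
    have hJ₃ : J₃ ≤ J := by simp [J]
    have hJ₄ : J₄ ≤ J := by simp [J]
    simp only [superComm, Pi.sub_apply, expandMul', Pi.smul_apply, swapVars_apply (expandMul n _)]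
    rw [h₁ J hJ₁, h₂ J hJ₂, h₃ J hJ₃, h₄ J hJ₄]
    simp only [map_sub, map_sum, map_smul, Finset.smul_sum, ← Finset.sum_sub_distrib]
    refine Finset.sum_congr rfl fun j _ => ?_
    simp only [swapVars_apply, G, G', zero_add]
    rw [add_comm n m]
    module
  funext m k
  rw [e, ← diffShift₂₃_pow_apply, key]
  rfl

end Locality

/-! ### Truncation, covariance and action on the vacuum of residue products. -/

noncomputable section ResidueProducts

variable {V : Type*} [AddCommGroup V] [Module ℂ V]

/-- `[T, a(z)] = ∂ a(z)`. -/
def IsCovariant (T : Module.End ℂ V) (a : ℤ → Module.End ℂ V) : Prop :=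
  ∀ n v, T (a n v) - a n (T v) = -(n : ℂ) • a (n - 1) v

theorem IsResProd.isTruncated {n : ℤ} {σ : ℂ} {a b P : ℤ → Module.End ℂ V}
    (hP : IsResProd n σ a b P) (ha : IsTruncated a) (hb : IsTruncated b) : IsTruncated P := by
  intro v
  obtain ⟨J₁, h₁⟩ := hb v
  obtain ⟨J₂, h₂⟩ := ha v
  choose B hB using fun j : ℕ => hb (a j v)
  -- Only finitely many `a j v` are nonzero, so the bounds for `b` on these vectors have a common
  -- upper bound, after accounting for the index `n + m - j`.
  obtain ⟨N, hN⟩ := Finset.exists_le ((Finset.range J₂.toNat).image fun j : ℕ => B j + j - n)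
  refine ⟨max N J₁, fun m hm => ?_⟩
  rw [hP, finsum_eq_zero_of_forall_eq_zero, finsum_eq_zero_of_forall_eq_zero, smul_zero, sub_zero]
  · intro j
    by_cases hj : j < J₂.toNat
    · have := hN (B j + j - n) (Finset.mem_image_of_mem _ (Finset.mem_range.2 hj))
      rw [hB j _ (by omega), smul_zero]
    · rw [h₂ j (by omega), map_zero, smul_zero]
  · intro j
    rw [h₁ _ (by omega), map_zero, smul_zero]

theorem IsResProd.isCovariant {n : ℤ} {σ : ℂ} {a b P : ℤ → Module.End ℂ V} {T : Module.End ℂ V}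
    (hP : IsResProd n σ a b P) (ha : IsTruncated a) (hb : IsTruncated b)
    (hTa : IsCovariant T a) (hTb : IsCovariant T b) : IsCovariant T P := by
  intro m v
  obtain ⟨J₁, h₁⟩ := hP.exists_sum ha hb m v
  obtain ⟨J₂, h₂⟩ := hP.exists_sum ha hb m (T v)
  obtain ⟨J₃, h₃⟩ := hP.exists_sum ha hb (m - 1) v
  obtain ⟨J₄, h₄⟩ := hb v
  obtain ⟨J₅, h₅⟩ := ha v
  let J : ℕ := max (max J₁ J₂) (max J₃ (max (J₄ - m + 1).toNat (J₅ + 1).toNat))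
  have hJ₁ : J₁ ≤ J := by simp [J]
  have hJ₂ : J₂ ≤ J := by simp [J]
  have hJ₃ : J₃ ≤ J := by simp [J]
  have hJ₄ : (J₄ - m + 1).toNat ≤ J := by simp only [J, le_max_iff, le_refl, true_or, or_true]
  have hJ₅ : (J₅ + 1).toNat ≤ J := by simp only [J, le_max_iff, le_refl, or_true]
  -- The defect of covariance is a difference of two telescoping sums, of `s` and of `t`. Both
  -- sequences vanish at `0` because of the factor `j` and at `J` by truncation.
  let s (j : ℕ) : V := ((j : ℂ) * binomCoeff n j) • a (n - j) (b (m + j - 1) v)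
  let t (j : ℕ) : V := ((j : ℂ) * binomCoeff n j) • b (n + m - j) (a (j - 1) v)
  have hs := Finset.sum_range_sub s J
  have ht := Finset.sum_range_sub t J
  have hs0 : s 0 = 0 := by simp [s]
  have ht0 : t 0 = 0 := by simp [t]
  have hsJ : s J = 0 := by simp only [s]; rw [h₄ _ (by omega), map_zero, smul_zero]
  have htJ : t J = 0 := by simp only [t]; rw [h₅ _ (by omega), map_zero, smul_zero]
  rw [hs0, hsJ, sub_zero] at hs
  rw [ht0, htJ, sub_zero] at ht
  have e : T (P m v) - P m (T v) - (-(m : ℂ) • P (m - 1) v)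
      = (∑ j ∈ Finset.range J, (s (j + 1) - s j))
        - (σ * (-1) ^ n) • (∑ j ∈ Finset.range J, (t (j + 1) - t j)) := by
    rw [h₁ J hJ₁, h₂ J hJ₂, h₃ J hJ₃]
    simp only [map_sub, map_sum, map_smul, Finset.smul_sum, ← Finset.sum_sub_distrib]
    refine Finset.sum_congr rfl fun j _ => ?_
    have e₁ := hTa (n - j) (b (m + j) v)
    have e₂ := congrArg (a (n - j)) (hTb (m + j) v)
    have e₃ := hTb (n + m - j) (a j v)
    have e₄ := congrArg (b (n + m - j)) (hTa j v)
    rw [map_sub, map_smul] at e₂ e₄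
    rw [sub_eq_iff_eq_add] at e₁ e₂ e₃ e₄
    rw [e₁, e₂, e₃, e₄]
    have c : ((j + 1 : ℕ) : ℂ) * binomCoeff n (j + 1) = (j - n) * binomCoeff n j := by
      have := binomCoeff_succ_mul n j
      push_cast
      linear_combination this
    simp only [s, t, c]
    rw [show n - ((j + 1 : ℕ) : ℤ) = n - j - 1 by push_cast; ring,
      show m + ((j + 1 : ℕ) : ℤ) - 1 = m + j by push_cast; ring,
      show n + m - ((j + 1 : ℕ) : ℤ) = n + m - j - 1 by push_cast; ring,
      show ((j + 1 : ℕ) : ℤ) - 1 = j by push_cast; ring,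
      show m - 1 + (j : ℤ) = m + j - 1 by ring, show n + (m - 1) - (j : ℤ) = n + m - j - 1 by ring]
    push_cast
    module
  rw [hs, ht, smul_zero, sub_zero, sub_eq_zero] at e
  exact e

/-- The second sum applies nonnegative modes of `a` directly to the vacuum, hence vanishes; in the
first only `b (-1) vac` can survive. Iterated, this shows that a normally ordered product creates
its own label from the vacuum. -/
theorem IsResProd.apply_vacuum {n : ℤ} {σ : ℂ} {a b P : ℤ → Module.End ℂ V} {vac : V}
    (hP : IsResProd n σ a b P) (ha : ∀ m : ℤ, 0 ≤ m → a m vac = 0)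
    (hb : ∀ m : ℤ, 0 ≤ m → b m vac = 0) :
    (∀ m : ℤ, 0 ≤ m → P m vac = 0) ∧ P (-1) vac = a n (b (-1) vac) := by
  have h : ∀ m, ∑ᶠ j : ℕ, binomCoeff n j • b (n + m - j) (a j vac) = 0 := fun m =>
    finsum_eq_zero_of_forall_eq_zero fun j => by
      rw [ha j (by positivity), map_zero, smul_zero]
  constructor
  · intro m hm
    rw [hP, h, smul_zero, sub_zero]
    exact finsum_eq_zero_of_forall_eq_zero fun j => by
      rw [hb _ (by omega), map_zero, smul_zero]
  · rw [hP, h, smul_zero, sub_zero, finsum_nat_eq_sum_range (J := 1)]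
    · simp
    · intro j hj
      rw [hb _ (by omega), map_zero, smul_zero]

/-- A field that is local with respect to `b(z)` and kills the vacuum also kills `b`. -/
theorem MutLocal.apply_eq_zero {σ : ℂ} {c b : ℤ → Module.End ℂ V} {vac : V} (h : MutLocal σ c b)
    (hc : ∀ n, c n vac = 0) (hb : ∀ n : ℤ, 0 ≤ n → b n vac = 0) (n : ℤ) :
    c n (b (-1) vac) = 0 := by
  obtain ⟨N, hN⟩ := h
  -- At this pair of indices every binomial term with `j ≥ 1` contains `b (j - 1) vac = 0`, so only
  -- `c n (b (-1) vac)` is left.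
  have e := congrFun (congrFun (hN vac) (n - N)) (-1)
  rw [diffShift_pow_apply, Finset.sum_range_succ', Finset.sum_eq_zero] at e
  · simpa [superComm, hc] using e
  · intro j _
    simp only [superComm, hc]
    rw [hb _ (by push_cast; omega)]
    simp

end ResidueProducts

/-! ### Zero modes of odd states and their cohomology. -/

noncomputable section

namespace VertexData

variable {V : Type*} [AddCommGroup V] [Module ℂ V] {A : VertexData V}

theorem isInternal_iff_isCompl : DirectSum.IsInternal A.parity ↔
    IsCompl (A.parity 0) (A.parity 1) :=
  DirectSum.isInternal_submodule_iff_isCompl _ (by decide) (by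
    ext x; revert x; decide)

namespace IsVertexSuperalgebra

theorem exists_add (hA : A.IsVertexSuperalgebra) (v : V) :
    ∃ v₀ ∈ A.parity 0, ∃ v₁ ∈ A.parity 1, v₀ + v₁ = v :=
  Submodule.mem_sup.1 ((isInternal_iff_isCompl.1 hA.isInternal).sup_eq_top ▸ Submodule.mem_top)

theorem eq_zero_of_mem (hA : A.IsVertexSuperalgebra) {v : V} (p : ZMod 2) (h₀ : v ∈ A.parity p)
    (h₁ : v ∈ A.parity (p + 1)) : v = 0 := by
  have h := Submodule.disjoint_def.1 (isInternal_iff_isCompl.1 hA.isInternal).disjoint v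
  fin_cases p
  · exact h h₀ h₁
  · exact h h₁ h₀

theorem mutLocal (hA : A.IsVertexSuperalgebra) {p q : ZMod 2} {a b : V} (ha : a ∈ A.parity p)
    (hb : b ∈ A.parity q) :
    MutLocal ((-1) ^ (p.val * q.val)) (fun n => A.prod n a) (fun n => A.prod n b) := by
  obtain ⟨N, hN⟩ := hA.locality p q a b ha hb
  refine ⟨N, fun c => ?_⟩
  funext k l
  rw [diffShift_pow_apply]
  exact hN k l c

theorem isTruncated (hA : A.IsVertexSuperalgebra) (a : V) : IsTruncated (fun n => A.prod n a) :=
  hA.truncation a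

theorem neg_one_pow_val_add_mul (p q r : ZMod 2) :
    (-1 : ℂ) ^ (p.val * r.val) * (-1 : ℂ) ^ (q.val * r.val) = (-1) ^ ((p + q).val * r.val) := by
  have h : ∀ p q r : ZMod 2,
      (p.val * r.val + q.val * r.val) % 2 = ((p + q).val * r.val) % 2 := by decide
  rw [← pow_add, neg_one_pow_eq_pow_mod_two, h, ← neg_one_pow_eq_pow_mod_two]

/-- The operator `T`, in the axioms called translation operator, shifts the modes of states. -/
theorem prod_neg_succ_vacuum (hA : A.IsVertexSuperalgebra) (a : V) (k : ℕ) :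
    A.prod (-2) (A.prod (-(k : ℤ) - 1) a A.vacuum) A.vacuum
      = ((k : ℂ) + 1) • A.prod (-((k + 1 : ℕ) : ℤ) - 1) a A.vacuum := by
  have h := hA.translation (-(k : ℤ) - 1) a A.vacuum
  rw [hA.vacuum_prod (-2)] at h
  simp only [Int.reduceNeg, Int.reduceEq, if_false, map_zero, sub_zero] at h
  rw [h, show -((k + 1 : ℕ) : ℤ) - 1 = -(k : ℤ) - 1 - 1 by push_cast; ring]
  congr 1
  push_cast
  ring

/-- A zero mode commutes with `T` (the `translation` axiom at `n = 0`), and `b_(-k-1) vacuum` is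
`T^k b / k!`. The induction climbs in `k` by applying `T` and cancelling `k + 1`. -/
theorem prod_zero_prod_vacuum (hA : A.IsVertexSuperalgebra) (a b : V) (n : ℤ) :
    A.prod 0 a (A.prod n b A.vacuum) = A.prod n (A.prod 0 a b) A.vacuum := by
  rcases le_or_gt 0 n with hn | hn
  · rw [hA.prod_vacuum_nonneg _ _ hn, hA.prod_vacuum_nonneg _ _ hn, map_zero]
  · obtain ⟨k, rfl⟩ : ∃ k : ℕ, n = -(k : ℤ) - 1 := ⟨(-n - 1).toNat, by omega⟩
    clear hn
    induction k with
    | zero => simp [hA.prod_vacuum]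
    | succ k ih =>
      have hk : (k : ℂ) + 1 ≠ 0 := by exact_mod_cast k.succ_ne_zero
      have h₁ := hA.prod_neg_succ_vacuum b k
      have h₂ := hA.prod_neg_succ_vacuum (A.prod 0 a b) k
      have h₃ := hA.translation 0 a (A.prod (-(k : ℤ) - 1) b A.vacuum)
      rw [ih, h₁, map_smul, h₂] at h₃
      simp only [Int.cast_zero, neg_zero, zero_smul, ← smul_sub] at h₃
      rw [smul_eq_zero, or_iff_right hk, sub_eq_zero] at h₃
      exact h₃.symm

/-- The commutator formula for a zero mode. -/
theorem prod_prod_zero (hA : A.IsVertexSuperalgebra) {p q : ZMod 2} {a b : V}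
    (ha : a ∈ A.parity p) (hb : b ∈ A.parity q) (n : ℤ) (c : V) :
    A.prod n (A.prod 0 a b) c
      = A.prod 0 a (A.prod n b c) - (-1 : ℂ) ^ (p.val * q.val) • A.prod n b (A.prod 0 a c) := by
  let σ : ℂ := (-1 : ℂ) ^ (p.val * q.val)
  let P : ℤ → Module.End ℂ V := fun n => A.prod 0 a ∘ₗ A.prod n b - σ • A.prod n b ∘ₗ A.prod 0 a
  have hP : IsResProd 0 σ (fun n => A.prod n a) (fun n => A.prod n b) P := by
    intro m v
    -- Since `(z - w)^0 = 1`, the residue product of index `0` is just the supercommutator with the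
    -- zero mode of `a`.
    have h : ∀ j, 1 ≤ j → binomCoeff 0 j = 0 := fun j hj => by
      obtain ⟨j, rfl⟩ := Nat.exists_eq_add_of_le' hj
      exact binomCoeff_zero_left_succ j
    rw [finsum_nat_eq_sum_range (J := 1) (fun j hj => by rw [h j hj, zero_smul]),
      finsum_nat_eq_sum_range (J := 1) (fun j hj => by rw [h j hj, zero_smul])]
    simp [P]
  -- `C` is the defect of the formula. It kills the vacuum, and by Dong's lemma it is local with
  -- respect to every homogeneous field, so it kills every homogeneous state.
  let C : ℤ → Module.End ℂ V := P - fun n => A.prod n (A.prod 0 a b)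
  have hCvac : ∀ n, C n A.vacuum = 0 := fun n => by
    simp only [C, P, Pi.sub_apply, LinearMap.sub_apply, LinearMap.comp_apply, LinearMap.smul_apply,
      hA.prod_vacuum_nonneg a 0 le_rfl, map_zero, smul_zero, sub_zero,
      hA.prod_zero_prod_vacuum, sub_self]
  have hC : ∀ (r : ZMod 2) (d : V), d ∈ A.parity r → C n d = 0 := by
    intro r d hd
    have h₁ := hP.mutLocal (hA.isTruncated a) (hA.isTruncated b) (hA.mutLocal ha hb)
      (hA.mutLocal ha hd) (hA.mutLocal hb hd)
    rw [neg_one_pow_val_add_mul] at h₁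
    have h₂ := h₁.sub (hA.mutLocal (hA.prod_mem p q 0 a b ha hb) hd)
    have h₃ := h₂.apply_eq_zero hCvac (hA.prod_vacuum_nonneg d) n
    rwa [hA.prod_vacuum] at h₃
  obtain ⟨c₀, h₀, c₁, h₁, rfl⟩ := hA.exists_add c
  have h : C n (c₀ + c₁) = 0 := by rw [map_add, hC 0 c₀ h₀, hC 1 c₁ h₁, add_zero]
  exact (sub_eq_zero.1 h).symm

section OddZeroMode

variable {a : V}

/-- The Leibniz rule for an odd derivation; all the compatibility with cohomology below follows from
it. -/
theorem odd_prod_zero_prod (hA : A.IsVertexSuperalgebra) (ha : a ∈ A.parity 1) {q : ZMod 2} {b : V}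
    (hb : b ∈ A.parity q) (n : ℤ) (c : V) :
    A.prod 0 a (A.prod n b c)
      = A.prod n (A.prod 0 a b) c + (-1 : ℂ) ^ q.val • A.prod n b (A.prod 0 a c) := by
  rw [hA.prod_prod_zero ha hb, ZMod.val_one, one_mul, sub_add_cancel]

/-- The zero mode of an odd state `a` with `a_(0) a = 0` squares to zero. -/
theorem odd_prod_zero_comp_self (hA : A.IsVertexSuperalgebra) (ha : a ∈ A.parity 1)
    (haa : A.prod 0 a a = 0) : A.prod 0 a ∘ₗ A.prod 0 a = 0 := by
  ext c
  -- The Leibniz rule with `b = a` and `a_(0) a = 0` says that the square of the zero mode equals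
  -- its own negative.
  have h := hA.odd_prod_zero_prod ha ha 0 c
  rw [haa, map_zero, LinearMap.zero_apply, zero_add, ZMod.val_one, pow_one, neg_one_smul,
    eq_neg_iff_add_eq_zero, ← two_smul ℂ, smul_eq_zero, or_iff_right two_ne_zero] at h
  exact h

theorem odd_prod_zero_mem (hA : A.IsVertexSuperalgebra) (ha : a ∈ A.parity 1) {q : ZMod 2} {b : V}
    (hb : b ∈ A.parity q) : A.prod 0 a b ∈ A.parity (q + 1) :=
  add_comm q 1 ▸ hA.prod_mem 1 q 0 a b ha hb

/-- The operator flips parity, so the images of the two components lie in different parts and must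
vanish separately. This gives access to the Leibniz rule, whose sign needs a homogeneous left
factor. -/
theorem exists_add_of_mem_ker (hA : A.IsVertexSuperalgebra) (ha : a ∈ A.parity 1) {v : V}
    (hv : v ∈ LinearMap.ker (A.prod 0 a)) :
    ∃ v₀ ∈ A.parity 0, ∃ v₁ ∈ A.parity 1, v₀ ∈ LinearMap.ker (A.prod 0 a) ∧
      v₁ ∈ LinearMap.ker (A.prod 0 a) ∧ v₀ + v₁ = v := by
  obtain ⟨v₀, h₀, v₁, h₁, rfl⟩ := hA.exists_add v
  rw [LinearMap.mem_ker, map_add] at hv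
  have e₀ := hA.odd_prod_zero_mem ha h₀
  have e₁ := hA.odd_prod_zero_mem ha h₁
  have hv₀ : A.prod 0 a v₀ = 0 := by
    refine hA.eq_zero_of_mem _ e₀ ?_
    rw [eq_neg_of_add_eq_zero_left hv]
    exact neg_mem e₁
  refine ⟨v₀, h₀, v₁, h₁, hv₀, ?_, rfl⟩
  rwa [hv₀, zero_add] at hv

theorem prod_mem_ker (hA : A.IsVertexSuperalgebra) (ha : a ∈ A.parity 1) (n : ℤ) {b c : V}
    (hb : b ∈ LinearMap.ker (A.prod 0 a)) (hc : c ∈ LinearMap.ker (A.prod 0 a)) :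
    A.prod n b c ∈ LinearMap.ker (A.prod 0 a) := by
  obtain ⟨b₀, h₀, b₁, h₁, k₀, k₁, rfl⟩ := hA.exists_add_of_mem_ker ha hb
  rw [LinearMap.mem_ker] at *
  rw [map_add, LinearMap.add_apply, map_add, hA.odd_prod_zero_prod ha h₀,
    hA.odd_prod_zero_prod ha h₁, hc, k₀, k₁]
  simp

theorem prod_mem_range_left (hA : A.IsVertexSuperalgebra) (ha : a ∈ A.parity 1) (n : ℤ) {b c : V}
    (hb : b ∈ LinearMap.range (A.prod 0 a)) (hc : c ∈ LinearMap.ker (A.prod 0 a)) :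
    A.prod n b c ∈ LinearMap.range (A.prod 0 a) := by
  obtain ⟨b, rfl⟩ := hb
  obtain ⟨b₀, h₀, b₁, h₁, rfl⟩ := hA.exists_add b
  refine ⟨A.prod n b₀ c + A.prod n b₁ c, ?_⟩
  rw [LinearMap.mem_ker] at hc
  rw [map_add, hA.odd_prod_zero_prod ha h₀, hA.odd_prod_zero_prod ha h₁, hc]
  simp

theorem prod_mem_range_right (hA : A.IsVertexSuperalgebra) (ha : a ∈ A.parity 1) (n : ℤ) {b c : V}
    (hb : b ∈ LinearMap.ker (A.prod 0 a)) (hc : c ∈ LinearMap.range (A.prod 0 a)) :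
    A.prod n b c ∈ LinearMap.range (A.prod 0 a) := by
  obtain ⟨c, rfl⟩ := hc
  obtain ⟨b₀, h₀, b₁, h₁, k₀, k₁, rfl⟩ := hA.exists_add_of_mem_ker ha hb
  rw [LinearMap.mem_ker] at k₀ k₁
  -- The minus sign compensates the sign acquired in passing the odd component `b₁`.
  refine ⟨A.prod n b₀ c - A.prod n b₁ c, ?_⟩
  rw [map_sub, hA.odd_prod_zero_prod ha h₀, hA.odd_prod_zero_prod ha h₁, k₀, k₁, ZMod.val_one,
    ZMod.val_zero]
  simp

/-- The products of cocycles. -/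
def kerProd (hA : A.IsVertexSuperalgebra) (ha : a ∈ A.parity 1) (n : ℤ) :
    ↥(LinearMap.ker (A.prod 0 a)) →ₗ[ℂ] ↥(LinearMap.ker (A.prod 0 a)) →ₗ[ℂ]
      ↥(LinearMap.ker (A.prod 0 a)) :=
  LinearMap.mk₂ ℂ (fun b c => ⟨A.prod n b c, hA.prod_mem_ker ha n b.2 c.2⟩)
    (fun _ _ _ => by ext; simp) (fun _ _ _ => by ext; simp) (fun _ _ _ => by ext; simp)
    (fun _ _ _ => by ext; simp)

/-- The products of classes of cocycles with cocycles. -/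
def kerProdLeft (hA : A.IsVertexSuperalgebra) (ha : a ∈ A.parity 1) (n : ℤ) :
    Cohomology (A.prod 0 a) →ₗ[ℂ] ↥(LinearMap.ker (A.prod 0 a)) →ₗ[ℂ] Cohomology (A.prod 0 a) :=
  Submodule.liftQ _ ((hA.kerProd ha n).compr₂ (Cohomology.mk (A.prod 0 a))) (by
    intro b hb
    rw [LinearMap.mem_ker]
    ext c
    exact (Submodule.Quotient.mk_eq_zero _).2 (hA.prod_mem_range_left ha n hb c.2))

/-- The structure on the cohomology of the zero mode of an odd state. -/
def cohomology (hA : A.IsVertexSuperalgebra) (ha : a ∈ A.parity 1) :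
    VertexData (Cohomology (A.prod 0 a)) where
  parity p := ((A.parity p).submoduleOf (LinearMap.ker (A.prod 0 a))).map
    (Cohomology.mk (A.prod 0 a))
  vacuum := Cohomology.mk (A.prod 0 a) ⟨A.vacuum, hA.prod_vacuum_nonneg a 0 le_rfl⟩
  prod n := (Submodule.liftQ _ (hA.kerProdLeft ha n).flip (by
    intro c hc
    rw [LinearMap.mem_ker]
    apply LinearMap.ext
    intro b
    obtain ⟨b, rfl⟩ := Submodule.mkQ_surjective _ b
    exact (Submodule.Quotient.mk_eq_zero _).2 (hA.prod_mem_range_right ha n b.2 hc))).flip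

theorem cohomology_prod_mk (hA : A.IsVertexSuperalgebra) (ha : a ∈ A.parity 1) (n : ℤ)
    (b c : ↥(LinearMap.ker (A.prod 0 a))) :
    (hA.cohomology ha).prod n (Cohomology.mk _ b) (Cohomology.mk _ c)
      = Cohomology.mk _ (hA.kerProd ha n b c) := rfl

theorem inducedOnCohomology (hA : A.IsVertexSuperalgebra) (ha : a ∈ A.parity 1) :
    A.InducedOnCohomology (A.prod 0 a) (hA.cohomology ha) where
  vacuum_eq := ⟨hA.prod_vacuum_nonneg a 0 le_rfl, rfl⟩
  parity_eq _ := rfl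
  prod_eq n b c := ⟨hA.prod_mem_ker ha n b.2 c.2, rfl⟩

theorem cohomology_isInternal (hA : A.IsVertexSuperalgebra) (ha : a ∈ A.parity 1) :
    DirectSum.IsInternal (hA.cohomology ha).parity := by
  rw [isInternal_iff_isCompl]
  constructor
  · rw [Submodule.disjoint_def]
    rintro x ⟨u, hu, rfl⟩ ⟨v, hv, hx⟩
    have hx' := (Submodule.Quotient.eq _).1 hx
    obtain ⟨w, hw⟩ := hx'
    obtain ⟨w₀, h₀, w₁, h₁, rfl⟩ := hA.exists_add w
    -- If an even `u` and an odd `v` are cohomologous, splitting the primitive by parity equates an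
    -- even vector with an odd one. Both are zero, so `u` is exact.
    have e : (u : V) + A.prod 0 a w₁ = v - A.prod 0 a w₀ := by
      have hw' : A.prod 0 a (w₀ + w₁) = (v : V) - u := hw
      rw [map_add] at hw'
      rw [eq_sub_iff_add_eq, add_assoc, add_comm (A.prod 0 a w₁), hw']
      abel
    have m₀ := hA.odd_prod_zero_mem ha h₁
    have m₁ := hA.odd_prod_zero_mem ha h₀
    have z : (u : V) + A.prod 0 a w₁ = 0 :=
      hA.eq_zero_of_mem 0 (add_mem hu m₀) (e ▸ sub_mem hv m₁)
    refine (Submodule.Quotient.mk_eq_zero _).2 ⟨-w₁, ?_⟩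
    rw [map_neg, ← eq_neg_of_add_eq_zero_left z]
    rfl
  · rw [codisjoint_iff, eq_top_iff]
    rintro x -
    obtain ⟨v, rfl⟩ := Submodule.mkQ_surjective _ x
    obtain ⟨v₀, h₀, v₁, h₁, k₀, k₁, hv⟩ := hA.exists_add_of_mem_ker ha v.2
    refine Submodule.mem_sup.2 ⟨Cohomology.mk _ ⟨v₀, k₀⟩, ⟨_, h₀, rfl⟩,
      Cohomology.mk _ ⟨v₁, k₁⟩, ⟨_, h₁, rfl⟩, ?_⟩
    rw [← map_add]
    exact congrArg _ (Subtype.ext hv)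

theorem cohomology_isVertexSuperalgebra (hA : A.IsVertexSuperalgebra) (ha : a ∈ A.parity 1) :
    (hA.cohomology ha).IsVertexSuperalgebra where
  isInternal := hA.cohomology_isInternal ha
  vacuum_even := ⟨_, hA.vacuum_even, rfl⟩
  prod_mem := by
    rintro p q n _ _ ⟨b, hb, rfl⟩ ⟨c, hc, rfl⟩
    exact ⟨hA.kerProd ha n b c, hA.prod_mem p q n b c hb hc, rfl⟩
  truncation b c := by
    obtain ⟨b, rfl⟩ := Submodule.mkQ_surjective _ b
    obtain ⟨c, rfl⟩ := Submodule.mkQ_surjective _ c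
    obtain ⟨N, hN⟩ := hA.truncation (b : V) c
    refine ⟨N, fun n hn => ?_⟩
    have h : hA.kerProd ha n b c = 0 := Subtype.ext (hN n hn)
    rw [cohomology_prod_mk, h, map_zero]
  vacuum_prod n b := by
    obtain ⟨b, rfl⟩ := Submodule.mkQ_surjective _ b
    have h : hA.kerProd ha n ⟨A.vacuum, hA.prod_vacuum_nonneg a 0 le_rfl⟩ b
        = if n = -1 then b else 0 := by
      refine Subtype.ext ((hA.vacuum_prod n (b : V)).trans ?_)
      split_ifs <;> rfl
    refine (congrArg (Cohomology.mk _) h).trans ?_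
    split_ifs <;> simp
  prod_vacuum b := by
    obtain ⟨b, rfl⟩ := Submodule.mkQ_surjective _ b
    exact congrArg (Cohomology.mk _) (Subtype.ext (hA.prod_vacuum (b : V)))
  prod_vacuum_nonneg b n hn := by
    obtain ⟨b, rfl⟩ := Submodule.mkQ_surjective _ b
    exact (congrArg (Cohomology.mk _) (Subtype.ext (hA.prod_vacuum_nonneg (b : V) n hn))).trans
      (map_zero _)
  translation n b c := by
    obtain ⟨b, rfl⟩ := Submodule.mkQ_surjective _ b
    obtain ⟨c, rfl⟩ := Submodule.mkQ_surjective _ c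
    exact congrArg (Cohomology.mk _) (Subtype.ext (hA.translation n (b : V) c))
  locality := by
    rintro p q _ _ ⟨b, hb, rfl⟩ ⟨c, hc, rfl⟩
    obtain ⟨N, hN⟩ := hA.locality p q b c hb hc
    refine ⟨N, fun k l d => ?_⟩
    obtain ⟨d, rfl⟩ := Submodule.mkQ_surjective _ d
    simp only [cohomology_prod_mk, ← map_smul, ← map_sub, ← map_sum]
    rw [← map_zero (Cohomology.mk (A.prod 0 a))]
    refine congrArg (Cohomology.mk _) (Subtype.ext ?_)
    rw [ZeroMemClass.coe_zero, ← hN k l d, AddSubmonoidClass.coe_finsetSum]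
    simp only [map_smul]
    rfl

end OddZeroMode

end IsVertexSuperalgebra

end VertexData

end

noncomputable section

namespace QuinticFock

/-! ## Free bosons and fermions -/

@[simp] theorem Gen.dual_dual (g : Gen) : g.dual.dual = g := by
  simp [Gen.dual]

theorem Gen.eq_dual_comm {g h : Gen} : g = h.dual ↔ h = g.dual := by
  constructor <;> rintro rfl <;> simp

theorem mode_eq_mode {g h : Gen} {k l : ℕ} : mode g k = mode h l ↔ g = h ∧ k = l := by
  simp [mode]

theorem ofBasis_ket (φ : Label → Fock) (μ : Sector) (f : Mode →₀ ℕ) (S : Finset Mode) :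
    ofBasis φ (ket μ f S) = φ (μ, f, S) := by
  simp [ofBasis, ket]

theorem hom_ext {M : Type*} [AddCommGroup M] [Module ℂ M] {A B : Fock →ₗ[ℂ] M}
    (h : ∀ μ f S, A (ket μ f S) = B (ket μ f S)) : A = B := by
  refine Finsupp.lhom_ext fun u c => ?_
  have e : Finsupp.single u c = c • ket u.1 u.2.1 u.2.2 := by simp [ket]
  rw [e, map_smul, map_smul, h]

theorem end_ext {A B : Module.End ℂ Fock} (h : ∀ μ f S, A (ket μ f S) = B (ket μ f S)) :
    A = B := hom_ext h

theorem boson_neg_ket (g : Gen) (k : ℕ) (μ : Sector) (f : Mode →₀ ℕ) (S : Finset Mode) :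
    boson g (-(k : ℤ) - 1) (ket μ f S) = ket μ (f + Finsupp.single (mode g k) 1) S := by
  rw [show -(k : ℤ) - 1 = Int.negSucc k by omega]
  exact ofBasis_ket _ _ _ _

theorem boson_zero_ket (g : Gen) (μ : Sector) (f : Mode →₀ ℕ) (S : Finset Mode) :
    boson g 0 (ket μ f S) = Sector.coord μ g.dual • ket μ f S :=
  ofBasis_ket _ _ _ _

theorem boson_pos_ket (g : Gen) (k : ℕ) (μ : Sector) (f : Mode →₀ ℕ) (S : Finset Mode) :
    boson g ((k : ℤ) + 1) (ket μ f S) = (((k + 1 : ℕ) : ℂ) * (f (mode g.dual k) : ℂ)) •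
        ket μ (f - Finsupp.single (mode g.dual k) 1) S :=
  ofBasis_ket _ _ _ _

theorem fermion_neg_ket (g : Gen) (k : ℕ) (μ : Sector) (f : Mode →₀ ℕ) (S : Finset Mode) :
    fermion g (-(k : ℤ) - 1) (ket μ f S) = if mode g k ∈ S then 0
      else (-1 : ℂ) ^ (S.filter (· < mode g k)).card • ket μ f (insert (mode g k) S) := by
  rw [show -(k : ℤ) - 1 = Int.negSucc k by omega]
  exact ofBasis_ket _ _ _ _

theorem fermion_natCast_ket (g : Gen) (k : ℕ) (μ : Sector) (f : Mode →₀ ℕ) (S : Finset Mode) :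
    fermion g k (ket μ f S) = if mode g.dual k ∈ S then
      (-1 : ℂ) ^ (S.filter (· < mode g.dual k)).card • ket μ f (S.erase (mode g.dual k)) else 0 :=
  ofBasis_ket _ _ _ _

theorem int_cases (p : ℤ) : (∃ k : ℕ, p = -(k : ℤ) - 1) ∨ p = 0 ∨ ∃ k : ℕ, p = (k : ℤ) + 1 := by
  rcases lt_trichotomy p 0 with h | h | h
  · exact Or.inl ⟨(-p - 1).toNat, by omega⟩
  · exact Or.inr (Or.inl h)
  · exact Or.inr (Or.inr ⟨(p - 1).toNat, by omega⟩)

theorem boson_pos_mul_neg (g h : Gen) (k l : ℕ) :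
    boson g ((k : ℤ) + 1) * boson h (-(l : ℤ) - 1) = boson h (-(l : ℤ) - 1) * boson g ((k : ℤ) + 1)
        + (if k = l ∧ h = g.dual then (k : ℂ) + 1 else 0) • 1 := by
  refine end_ext fun μ f S => ?_
  simp only [Module.End.mul_apply, LinearMap.add_apply, LinearMap.smul_apply, Module.End.one_apply,
    boson_pos_ket, boson_neg_ket, map_smul]
  by_cases hab : k = l ∧ h = g.dual
  · obtain ⟨rfl, rfl⟩ := hab
    simp only [Finsupp.add_apply, Finsupp.single_eq_same, add_tsub_cancel_right, and_self, if_true]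
    -- Subtraction of exponents truncates at zero, but in that case the derivative carries the
    -- factor `f = 0`.
    by_cases hf : f (mode g.dual k) = 0
    · simp [hf]
    · have e : f - Finsupp.single (mode g.dual k) 1 + Finsupp.single (mode g.dual k) 1 = f :=
        tsub_add_cancel_of_le (by simpa [Nat.one_le_iff_ne_zero] using hf)
      rw [e, ← add_smul]
      congr 1
      push_cast
      ring
  · rw [if_neg hab]
    have hne : mode h l ≠ mode g.dual k := fun hc => hab ⟨(mode_eq_mode.1 hc).2.symm,
      (mode_eq_mode.1 hc).1⟩
    simp only [Finsupp.add_apply, Finsupp.single_eq_of_ne hne.symm, add_zero, zero_smul]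
    by_cases hf : f (mode g.dual k) = 0
    · simp [hf]
    · congr 2
      refine tsub_add_eq_add_tsub ?_ |>.symm
      simpa [Nat.one_le_iff_ne_zero] using hf

theorem boson_pos_mul_pos (g h : Gen) (k l : ℕ) :
    boson g ((k : ℤ) + 1) * boson h ((l : ℤ) + 1)
      = boson h ((l : ℤ) + 1) * boson g ((k : ℤ) + 1) := by
  refine end_ext fun μ f S => ?_
  simp only [Module.End.mul_apply, boson_pos_ket, map_smul, smul_smul]
  by_cases hab : mode g.dual k = mode h.dual l
  · obtain ⟨hg, rfl⟩ := mode_eq_mode.1 hab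
    rw [hg]
  · simp only [Finsupp.tsub_apply, Finsupp.single_eq_of_ne hab,
      Finsupp.single_eq_of_ne (Ne.symm hab),
      tsub_zero]
    rw [tsub_right_comm, mul_comm]

/-- The commutation relations of the free bosons. -/
theorem boson_mul_boson (g h : Gen) (p q : ℤ) :
    boson g p * boson h q
      = boson h q * boson g p + (if p + q = 0 ∧ h = g.dual then (p : ℂ) else 0) • 1 := by
  have zero_left : ∀ (g h : Gen) (q : ℤ), boson g 0 * boson h q = boson h q * boson g 0 := by
    intro g h q
    refine end_ext fun μ f S => ?_
    rcases int_cases q with ⟨k, rfl⟩ | rfl | ⟨k, rfl⟩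
    · simp only [Module.End.mul_apply, boson_neg_ket, boson_zero_ket, map_smul]
    · simp only [Module.End.mul_apply, boson_zero_ket, map_smul]
      rw [smul_comm]
    · simp only [Module.End.mul_apply, boson_pos_ket, boson_zero_ket, map_smul]
      rw [smul_comm]
  rcases int_cases p with ⟨k, rfl⟩ | rfl | ⟨k, rfl⟩
  · rcases int_cases q with ⟨l, rfl⟩ | rfl | ⟨l, rfl⟩
    · rw [if_neg (by omega), zero_smul, add_zero]
      refine end_ext fun μ f S => ?_
      simp only [Module.End.mul_apply, boson_neg_ket]
      rw [add_right_comm]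
    · rw [if_neg (by omega), zero_smul, add_zero, zero_left]
    · rw [boson_pos_mul_neg, add_assoc, ← add_smul]
      by_cases hc : l = k ∧ g = h.dual
      · obtain ⟨rfl, rfl⟩ := hc
        rw [if_pos ⟨rfl, rfl⟩, if_pos ⟨by ring, by simp⟩]
        push_cast
        rw [show (l : ℂ) + 1 + (-l - 1) = 0 by ring, zero_smul, add_zero]
      · rw [if_neg hc, if_neg, add_zero, zero_smul, add_zero]
        rintro ⟨h₁, rfl⟩
        exact hc ⟨by omega, by simp⟩
  · rw [zero_left]
    simp
  · rcases int_cases q with ⟨l, rfl⟩ | rfl | ⟨l, rfl⟩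
    · rw [boson_pos_mul_neg]
      congr 2
      by_cases hc : k = l ∧ h = g.dual
      · rw [if_pos hc, if_pos ⟨by omega, hc.2⟩]
        push_cast
        ring
      · rw [if_neg hc, if_neg]
        rintro ⟨h₁, h₂⟩
        exact hc ⟨by omega, h₂⟩
    · rw [if_neg (by omega), zero_smul, add_zero, zero_left]
    · rw [if_neg (by omega), zero_smul, add_zero, boson_pos_mul_pos]

/-- The exponent of the fermionic sign at `s` changes exactly when `t` precedes `s`. For distinct
`s` and `t` one of them precedes the other, which is where anticommutation comes from. -/
theorem card_filter_lt_insert {s t : Mode} {S : Finset Mode} (ht : t ∉ S) :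
    ((insert t S).filter (· < s)).card = (S.filter (· < s)).card + if t < s then 1 else 0 := by
  rw [Finset.filter_insert]
  split_ifs with h
  · rw [Finset.card_insert_of_notMem (by simp [ht])]
  · simp

theorem card_filter_lt_erase {s t : Mode} {S : Finset Mode} (ht : t ∈ S) :
    (S.filter (· < s)).card = ((S.erase t).filter (· < s)).card + if t < s then 1 else 0 := by
  conv_lhs => rw [← Finset.insert_erase ht]
  exact card_filter_lt_insert (Finset.notMem_erase t S)

theorem neg_one_pow_mul_self (n : ℕ) : (-1 : ℂ) ^ n * (-1 : ℂ) ^ n = 1 := by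
  rw [← mul_pow]; simp

/-- For a dual pair of modes exactly one of the two orders is nonzero on a basis state, with two
equal signs that cancel. Otherwise erasing and inserting commute as set operations and exactly one
sign count moves by one. -/
theorem fermion_natCast_mul_neg (g h : Gen) (k l : ℕ) :
    fermion g k * fermion h (-(l : ℤ) - 1) = -(fermion h (-(l : ℤ) - 1) * fermion g k)
      + (if k = l ∧ h = g.dual then (1 : ℂ) else 0) • 1 := by
  refine end_ext fun μ f S => ?_
  simp only [Module.End.mul_apply, LinearMap.add_apply, LinearMap.neg_apply,
    LinearMap.smul_apply, Module.End.one_apply]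
  rw [fermion_neg_ket, fermion_natCast_ket]
  by_cases hab : k = l ∧ h = g.dual
  · obtain ⟨rfl, rfl⟩ := hab
    rw [if_pos (show k = k ∧ g.dual = g.dual from ⟨rfl, rfl⟩), one_smul]
    by_cases hs : mode g.dual k ∈ S
    · have h₁ := card_filter_lt_erase (s := mode g.dual k) hs
      rw [if_neg (lt_irrefl _), add_zero] at h₁
      rw [if_pos hs, if_pos hs, map_zero, map_smul, fermion_neg_ket,
        if_neg (Finset.notMem_erase _ _), Finset.insert_erase hs, smul_smul, h₁,
        neg_one_pow_mul_self, one_smul, neg_add_cancel]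
    · have h₁ := card_filter_lt_insert (s := mode g.dual k) hs
      rw [if_neg (lt_irrefl _), add_zero] at h₁
      rw [if_neg hs, if_neg hs, map_zero, map_smul, fermion_natCast_ket,
        if_pos (Finset.mem_insert_self _ _), Finset.erase_insert hs, smul_smul, h₁,
        neg_one_pow_mul_self, one_smul, neg_zero, zero_add]
  · rw [if_neg hab, zero_smul, add_zero]
    have hne : mode h l ≠ mode g.dual k := fun hc => hab ⟨(mode_eq_mode.1 hc).2.symm,
      (mode_eq_mode.1 hc).1⟩
    generalize ht : mode h l = t at *
    generalize hs : mode g.dual k = s at *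
    by_cases htS : t ∈ S <;> by_cases hsS : s ∈ S
    · rw [if_pos htS, if_pos hsS, map_zero, map_smul, fermion_neg_ket, ht,
        if_pos (Finset.mem_erase.2 ⟨hne, htS⟩), smul_zero, neg_zero]
    · rw [if_pos htS, if_neg hsS, map_zero, map_zero, neg_zero]
    · have h₁ := card_filter_lt_insert (s := s) htS
      have h₂ := card_filter_lt_erase (s := t) hsS
      rw [if_neg htS, if_pos hsS, map_smul, map_smul, fermion_neg_ket, fermion_natCast_ket, ht, hs,
        if_pos (Finset.mem_insert_of_mem hsS), if_neg (fun hc => htS (Finset.mem_of_mem_erase hc)),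
        Finset.erase_insert_of_ne hne, smul_smul, smul_smul, ← neg_smul, h₁, h₂]
      congr 1
      rcases lt_or_gt_of_ne hne with h | h
      · rw [if_pos h, if_neg h.asymm]; ring
      · rw [if_pos h, if_neg h.asymm]; ring
    · rw [if_neg htS, if_neg hsS, map_smul, fermion_natCast_ket, hs,
        if_neg (by simp [hne.symm, hsS]), smul_zero, map_zero, neg_zero]

theorem fermion_neg_mul_neg (g h : Gen) (k l : ℕ) :
    fermion g (-(k : ℤ) - 1) * fermion h (-(l : ℤ) - 1)
      = -(fermion h (-(l : ℤ) - 1) * fermion g (-(k : ℤ) - 1)) := by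
  refine end_ext fun μ f S => ?_
  simp only [Module.End.mul_apply, LinearMap.neg_apply]
  rw [fermion_neg_ket, fermion_neg_ket]
  generalize hs : mode g k = s
  generalize ht : mode h l = t
  by_cases hst : s = t
  · subst hst
    by_cases hS : s ∈ S
    · rw [if_pos hS, map_zero, map_zero, neg_zero]
    · rw [if_neg hS, map_smul, map_smul, fermion_neg_ket, fermion_neg_ket, hs, ht,
        if_pos (Finset.mem_insert_self _ _), smul_zero, neg_zero]
  by_cases hsS : s ∈ S
  · rw [if_pos hsS, map_zero, neg_zero]
    split_ifs
    · rw [map_zero]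
    · rw [map_smul, fermion_neg_ket, hs, if_pos (Finset.mem_insert_of_mem hsS), smul_zero]
  by_cases htS : t ∈ S
  · rw [if_pos htS, map_zero, if_neg hsS, map_smul, fermion_neg_ket, ht,
      if_pos (Finset.mem_insert_of_mem htS), smul_zero, neg_zero]
  rw [if_neg hsS, if_neg htS, map_smul, map_smul, fermion_neg_ket, fermion_neg_ket, hs, ht,
    if_neg (by simp [hst, hsS]), if_neg (by simp [Ne.symm hst, htS]), smul_smul, smul_smul,
    Finset.insert_comm, ← neg_smul, card_filter_lt_insert htS, card_filter_lt_insert hsS]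
  congr 1
  rcases lt_or_gt_of_ne hst with h | h
  · rw [if_pos h, if_neg h.asymm]; ring
  · rw [if_pos h, if_neg h.asymm]; ring

theorem fermion_natCast_mul_natCast (g h : Gen) (k l : ℕ) :
    fermion g k * fermion h l = -(fermion h l * fermion g k) := by
  refine end_ext fun μ f S => ?_
  simp only [Module.End.mul_apply, LinearMap.neg_apply]
  rw [fermion_natCast_ket, fermion_natCast_ket]
  generalize hs : mode g.dual k = s
  generalize ht : mode h.dual l = t
  by_cases hst : s = t
  · subst hst
    by_cases hS : s ∈ S
    · rw [if_pos hS, map_smul, map_smul, fermion_natCast_ket, fermion_natCast_ket, hs, ht,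
        if_neg (Finset.notMem_erase _ _), smul_zero, neg_zero]
    · rw [if_neg hS, map_zero, map_zero, neg_zero]
  by_cases hsS : s ∈ S
  · by_cases htS : t ∈ S
    · rw [if_pos hsS, if_pos htS, map_smul, map_smul, fermion_natCast_ket, fermion_natCast_ket, hs,
        ht, if_pos (Finset.mem_erase.2 ⟨hst, hsS⟩), if_pos (Finset.mem_erase.2 ⟨Ne.symm hst, htS⟩),
        smul_smul, smul_smul, Finset.erase_right_comm, ← neg_smul,
        card_filter_lt_erase (s := t) hsS, card_filter_lt_erase (s := s) htS]
      congr 1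
      rcases lt_or_gt_of_ne hst with h | h
      · rw [if_pos h, if_neg h.asymm]; ring
      · rw [if_pos h, if_neg h.asymm]; ring
    · rw [if_neg htS, if_pos hsS, map_zero, map_smul, fermion_natCast_ket, ht,
        if_neg (fun hc => htS (Finset.mem_of_mem_erase hc)), smul_zero, neg_zero]
  · rw [if_neg hsS, map_zero, neg_zero]
    split_ifs
    · rw [map_smul, fermion_natCast_ket, hs,
        if_neg (fun hc => hsS (Finset.mem_of_mem_erase hc)), smul_zero]
    · rw [map_zero]

theorem int_cases' (p : ℤ) : (∃ k : ℕ, p = -(k : ℤ) - 1) ∨ ∃ k : ℕ, p = k := by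
  rcases lt_or_ge p 0 with h | h
  · exact Or.inl ⟨(-p - 1).toNat, by omega⟩
  · exact Or.inr ⟨p.toNat, by omega⟩

/-- The anticommutation relations of the free fermions. -/
theorem fermion_mul_fermion (g h : Gen) (p q : ℤ) :
    fermion g p * fermion h q
      = -(fermion h q * fermion g p) + (if p + q = -1 ∧ h = g.dual then (1 : ℂ) else 0) • 1 := by
  rcases int_cases' p with ⟨k, rfl⟩ | ⟨k, rfl⟩ <;> rcases int_cases' q with ⟨l, rfl⟩ | ⟨l, rfl⟩
  · rw [if_neg (by omega), zero_smul, add_zero, fermion_neg_mul_neg]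
  · rw [fermion_natCast_mul_neg]
    have e : (l = k ∧ g = h.dual) ↔ (-(k : ℤ) - 1 + l = -1 ∧ h = g.dual) := by
      rw [Gen.eq_dual_comm]
      constructor <;> rintro ⟨h₁, h₂⟩ <;> exact ⟨by omega, h₂⟩
    simp only [e]
    abel
  · rw [fermion_natCast_mul_neg]
    have e : (k = l ∧ h = g.dual) ↔ ((k : ℤ) + (-(l : ℤ) - 1) = -1 ∧ h = g.dual) := by
      constructor <;> rintro ⟨h₁, h₂⟩ <;> exact ⟨by omega, h₂⟩
    simp only [e]
  · rw [if_neg (by omega), zero_smul, add_zero, fermion_natCast_mul_natCast]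

/-- Bosons and fermions commute. -/
theorem boson_mul_fermion (g h : Gen) (p q : ℤ) :
    boson g p * fermion h q = fermion h q * boson g p := by
  refine end_ext fun μ f S => ?_
  simp only [Module.End.mul_apply]
  rcases int_cases p with ⟨k, rfl⟩ | rfl | ⟨k, rfl⟩ <;>
  rcases int_cases' q with ⟨l, rfl⟩ | ⟨l, rfl⟩ <;>
  simp only [boson_neg_ket, boson_zero_ket, boson_pos_ket, fermion_neg_ket, fermion_natCast_ket,
    map_smul] <;>
  split_ifs <;>
  simp only [map_zero, smul_zero, map_smul, boson_neg_ket, boson_zero_ket, boson_pos_ket,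
    smul_comm ((-1 : ℂ) ^ _)]

theorem eq_top_of_ket_mem (W : Submodule ℂ Fock) (h : ∀ μ f S, ket μ f S ∈ W) : W = ⊤ := by
  rw [eq_top_iff]
  rintro v -
  rw [← Finsupp.sum_single v]
  refine Submodule.sum_mem _ fun u _ => ?_
  simpa [ket] using W.smul_mem (v u) (h u.1 u.2.1 u.2.2)

/-- The Fock space is generated from the lattice states by the creation operators. -/
theorem eq_top_of_creation (W : Submodule ℂ Fock) (h₀ : ∀ μ, ket μ 0 ∅ ∈ W)
    (hb : ∀ g (k : ℕ) v, v ∈ W → boson g (-(k : ℤ) - 1) v ∈ W)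
    (hf : ∀ g (k : ℕ) v, v ∈ W → fermion g (-(k : ℤ) - 1) v ∈ W) : W = ⊤ := by
  have key : ∀ μ f S, ket μ f S ∈ W := by
    intro μ f S
    obtain ⟨m, rfl⟩ : ∃ m, f = Multiset.toFinsupp m := ⟨Finsupp.toMultiset f, by simp⟩
    induction m using Multiset.induction_on with
    | empty =>
      rw [map_zero]
      induction S using Finset.induction_on with
      | empty => exact h₀ μ
      | insert s S hs ih =>
        have h := hf s.gen s.num _ ih
        rw [fermion_neg_ket, if_neg (show mode s.gen s.num ∉ S from hs)] at h
        have h' := W.smul_mem ((-1 : ℂ) ^ (S.filter (· < s)).card) h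
        rw [smul_smul] at h'
        have e : mode s.gen s.num = s := rfl
        rw [e, neg_one_pow_mul_self, one_smul] at h'
        exact h'
    | cons s m ih =>
      have h := hb s.gen s.num _ ih
      rw [boson_neg_ket] at h
      rw [← Multiset.singleton_add, map_add, Multiset.toFinsupp_singleton, add_comm]
      exact h
  exact eq_top_of_ket_mem W key

/-! ## Operators are determined by their commutators with the free fields -/

open Classical in
theorem ket_apply (μ ρ : Sector) (f f' : Mode →₀ ℕ) (S S' : Finset Mode) :
    ket μ f S (ρ, f', S') = if μ = ρ ∧ f = f' ∧ S = S' then 1 else 0 := by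
  simp [ket, Finsupp.single_apply, Prod.ext_iff]

/-- Annihilation operators read off coefficients at labels with one more creator. With `boson_apply`
this reduces any matrix coefficient to one at a lattice state. -/
theorem fermion_apply (g : Gen) (k : ℕ) (v : Fock) (ρ : Sector) (f : Mode →₀ ℕ) (S : Finset Mode)
    (hS : mode g k ∉ S) : fermion g.dual k v (ρ, f, S)
      = (-1 : ℂ) ^ (S.filter (· < mode g k)).card * v (ρ, f, insert (mode g k) S) := by
  classical
  have key : Finsupp.lapply (ρ, f, S) ∘ₗ fermion g.dual k
      = (-1 : ℂ) ^ (S.filter (· < mode g k)).card •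
        (Finsupp.lapply (ρ, f, insert (mode g k) S) : Fock →ₗ[ℂ] ℂ) := by
    refine hom_ext fun μ f' S' => ?_
    simp only [LinearMap.comp_apply, LinearMap.smul_apply, Finsupp.lapply_apply]
    rw [fermion_natCast_ket, Gen.dual_dual]
    by_cases hS' : mode g k ∈ S'
    · rw [if_pos hS', Finsupp.smul_apply, ket_apply, ket_apply]
      have h₁ := card_filter_lt_erase (s := mode g k) hS'
      rw [if_neg (lt_irrefl _), add_zero] at h₁
      have e : S' = insert (mode g k) S ↔ S'.erase (mode g k) = S := by
        constructor
        · rintro rfl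
          exact Finset.erase_insert hS
        · rintro rfl
          exact (Finset.insert_erase hS').symm
      rw [h₁]
      simp only [e]
      by_cases hc : μ = ρ ∧ f' = f ∧ S'.erase (mode g k) = S
      · rw [if_pos hc, hc.2.2]
      · rw [if_neg hc, smul_zero, smul_zero]
    · rw [if_neg hS', ket_apply, if_neg, smul_zero]
      · rfl
      · rintro ⟨-, -, rfl⟩
        exact hS' (Finset.mem_insert_self _ _)
  exact LinearMap.congr_fun key v

theorem boson_apply (g : Gen) (k : ℕ) (v : Fock) (ρ : Sector) (f : Mode →₀ ℕ) (S : Finset Mode) :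
    boson g.dual ((k : ℤ) + 1) v (ρ, f, S)
      = (((k + 1 : ℕ) : ℂ) * ((f (mode g k) + 1 : ℕ) : ℂ)) *
        v (ρ, f + Finsupp.single (mode g k) 1, S) := by
  classical
  have key : Finsupp.lapply (ρ, f, S) ∘ₗ boson g.dual ((k : ℤ) + 1)
      = (((k + 1 : ℕ) : ℂ) * ((f (mode g k) + 1 : ℕ) : ℂ)) •
        (Finsupp.lapply (ρ, f + Finsupp.single (mode g k) 1, S) : Fock →ₗ[ℂ] ℂ) := by
    refine hom_ext fun μ f' S' => ?_
    simp only [LinearMap.comp_apply, LinearMap.smul_apply, Finsupp.lapply_apply]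
    rw [boson_pos_ket, Gen.dual_dual, Finsupp.smul_apply, ket_apply, ket_apply]
    by_cases hf : f' (mode g k) = 0
    · rw [if_neg (c := _ ∧ f' = _ ∧ _), hf]
      · simp
      · rintro ⟨-, rfl, -⟩
        simp at hf
    · have e : f' = f + Finsupp.single (mode g k) 1 ↔ f' - Finsupp.single (mode g k) 1 = f := by
        constructor
        · rintro rfl
          exact add_tsub_cancel_right _ _
        · rintro rfl
          exact (tsub_add_cancel_of_le (by simpa [Nat.one_le_iff_ne_zero] using hf)).symm
      simp only [← e]
      by_cases hc : μ = ρ ∧ f' = f + Finsupp.single (mode g k) 1 ∧ S' = S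
      · rw [if_pos hc, hc.2.1]
        simp
      · rw [if_neg hc, smul_zero, smul_zero]
  exact LinearMap.congr_fun key v

theorem boson_pos_vacuum (g : Gen) (p : ℤ) (hp : 0 < p) (ν : Sector) (S : Finset Mode) :
    boson g p (ket ν 0 S) = 0 := by
  obtain ⟨k, rfl⟩ : ∃ k : ℕ, p = (k : ℤ) + 1 := ⟨(p - 1).toNat, by omega⟩
  simp [boson_pos_ket]

theorem fermion_nonneg_vacuum (g : Gen) (p : ℤ) (hp : 0 ≤ p) (ν : Sector) (f : Mode →₀ ℕ) :
    fermion g p (ket ν f ∅) = 0 := by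
  obtain ⟨k, rfl⟩ : ∃ k : ℕ, p = (k : ℤ) := ⟨p.toNat, by omega⟩
  simp [fermion_natCast_ket]

/-- A space of operators that is closed under commutators with the bosons, commutes with the
fermions and has vanishing matrix coefficients between lattice states is zero. -/
theorem eq_zero_of_commutators (Y : Submodule ℂ (Module.End ℂ Fock))
    (hb : ∀ A ∈ Y, ∀ g (p : ℤ), p ≠ 0 → boson g p * A - A * boson g p ∈ Y)
    (hf : ∀ A ∈ Y, ∀ g (p : ℤ), fermion g p * A = A * fermion g p)
    (hv : ∀ A ∈ Y, ∀ ν ρ, A (ket ν 0 ∅) (ρ, 0, ∅) = 0) {A : Module.End ℂ Fock} (hA : A ∈ Y) :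
    A = 0 := by
  -- Each creator in the target label is removed by an annihilation operator, which moves through
  -- `A` at the price of a commutator in `Y` and then kills the lattice state.
  have coeff_eq : ∀ f S, ∀ A ∈ Y, ∀ ν ρ, A (ket ν 0 ∅) (ρ, f, S) = 0 := by
    intro f S
    obtain ⟨m, rfl⟩ : ∃ m, f = Multiset.toFinsupp m := ⟨Finsupp.toMultiset f, by simp⟩
    induction m using Multiset.induction_on with
    | empty =>
      rw [map_zero]
      induction S using Finset.induction_on with
      | empty => exact hv
      | insert s S hs ih =>
        intro A hA ν ρ
        have h := fermion_apply s.gen s.num (A (ket ν 0 ∅)) ρ 0 S hs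
        rw [← Module.End.mul_apply, hf A hA, Module.End.mul_apply,
          fermion_nonneg_vacuum _ _ (by positivity), map_zero, Finsupp.zero_apply, eq_comm,
          mul_eq_zero] at h
        exact h.resolve_left (pow_ne_zero _ (by norm_num))
    | cons s m ih =>
      intro A hA ν ρ
      have h := boson_apply s.gen s.num (A (ket ν 0 ∅)) ρ (Multiset.toFinsupp m) S
      have h₀ := ih _ (hb A hA s.gen.dual ((s.num : ℤ) + 1) (by omega)) ν ρ
      rw [LinearMap.sub_apply, Module.End.mul_apply, Module.End.mul_apply,
        boson_pos_vacuum _ _ (by omega), map_zero, sub_zero, h, mul_eq_zero] at h₀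
      rw [← Multiset.singleton_add, map_add, Multiset.toFinsupp_singleton, add_comm]
      exact h₀.resolve_left (mul_ne_zero (Nat.cast_ne_zero.2 (Nat.succ_ne_zero _))
        (Nat.cast_ne_zero.2 (Nat.succ_ne_zero _)))
  -- The common kernel contains the lattice states by the previous step and is stable under all
  -- creators, so it is everything.
  let W : Submodule ℂ Fock := ⨅ A : Y, LinearMap.ker (A : Module.End ℂ Fock)
  have hW : ∀ v, v ∈ W ↔ ∀ A ∈ Y, A v = 0 := fun v => by simp [W]
  have top : W = ⊤ := by
    refine eq_top_of_creation W ?_ ?_ ?_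
    · intro μ
      rw [hW]
      intro A hA
      ext ⟨ρ, f, S⟩
      exact coeff_eq f S A hA μ ρ
    · intro g k v hv
      rw [hW] at hv ⊢
      intro A hA
      have h := hv _ (hb A hA g (-(k : ℤ) - 1) (by omega))
      rw [LinearMap.sub_apply, Module.End.mul_apply, Module.End.mul_apply, hv A hA, map_zero,
        zero_sub, neg_eq_zero] at h
      exact h
    · intro g k v hv
      rw [hW] at hv ⊢
      intro A hA
      rw [← Module.End.mul_apply, ← hf A hA, Module.End.mul_apply, hv A hA, map_zero]
  refine LinearMap.ext fun v => ?_
  exact (hW v).1 (top ▸ Submodule.mem_top) A hA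

/-! ## Exponentials -/

section PowerSeries

variable {R : Type*} [Semiring R]

/-- The Euler derivation `x d/dx` of power series. -/
def eulerDeriv (P : PowerSeries R) : PowerSeries R :=
  PowerSeries.mk fun k => k • PowerSeries.coeff k P

theorem coeff_eulerDeriv (P : PowerSeries R) (k : ℕ) :
    PowerSeries.coeff k (eulerDeriv P) = k • PowerSeries.coeff k P := PowerSeries.coeff_mk _ _

theorem eulerDeriv_mul (P Q : PowerSeries R) :
    eulerDeriv (P * Q) = eulerDeriv P * Q + P * eulerDeriv Q := by
  ext n
  rw [map_add, coeff_eulerDeriv, PowerSeries.coeff_mul, PowerSeries.coeff_mul,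
    PowerSeries.coeff_mul, Finset.smul_sum, ← Finset.sum_add_distrib]
  refine Finset.sum_congr rfl fun ij hij => ?_
  rw [coeff_eulerDeriv, coeff_eulerDeriv, ← Finset.HasAntidiagonal.mem_antidiagonal.1 hij, add_smul,
    smul_mul_assoc, mul_smul_comm]

theorem eulerDeriv_pow_succ (P : PowerSeries R) (h : Commute P (eulerDeriv P)) (r : ℕ) :
    eulerDeriv (P ^ (r + 1)) = (r + 1) • (eulerDeriv P * P ^ r) := by
  induction r with
  | zero => simp
  | succ r ih =>
    rw [pow_succ', eulerDeriv_mul, ih, mul_smul_comm, ← mul_assoc, h.eq, mul_assoc, ← pow_succ',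
      add_smul (r + 1) 1, one_smul, add_comm]

theorem coeff_pow_eq_zero (P : PowerSeries R) (h : PowerSeries.coeff 0 P = 0) (r j : ℕ)
    (hj : j < r) : PowerSeries.coeff j (P ^ r) = 0 := by
  induction r generalizing j with
  | zero => omega
  | succ r ih =>
    rw [pow_succ', PowerSeries.coeff_mul]
    refine Finset.sum_eq_zero fun ij hij => ?_
    rw [Finset.HasAntidiagonal.mem_antidiagonal] at hij
    by_cases h0 : ij.1 = 0
    · rw [h0, h, zero_mul]
    · rw [ih _ (by omega), mul_zero]

end PowerSeries

theorem expCoeff_zero (c : ℕ → Module.End ℂ Fock) : expCoeff c 0 = 1 := by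
  simp [expCoeff]

/-- The coefficients of `x d/dx exp P = (x dP/dx) exp P`, valid because the coefficients of `P`
commute. Below, exponentials are handled through this recursion alone. -/
theorem nsmul_expCoeff (c : ℕ → Module.End ℂ Fock) (hc : ∀ i j, Commute (c i) (c j)) (n : ℕ) :
    n • expCoeff c n
      = ∑ ij ∈ Finset.HasAntidiagonal.antidiagonal n, ij.1 • (c ij.1 * expCoeff c ij.2) := by
  set P : PowerSeries (Module.End ℂ Fock) := PowerSeries.mk fun k => if k = 0 then 0 else c k
    with hP
  have hP0 : PowerSeries.coeff 0 P = 0 := by simp [hP]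
  have hcoeff : ∀ k, k • PowerSeries.coeff k P = k • c k := fun k => by
    by_cases hk : k = 0
    · simp [hk]
    · simp [hP, hk]
  have hcomm : Commute P (eulerDeriv P) := by
    ext1 n
    rw [PowerSeries.coeff_mul, PowerSeries.coeff_mul, ← Finset.Nat.sum_antidiagonal_swap]
    refine Finset.sum_congr rfl fun ij _ => ?_
    simp only [coeff_eulerDeriv, Prod.fst_swap, Prod.snd_swap, hP, PowerSeries.coeff_mk]
    split_ifs
    · simp
    · simp
    · simp
    · rw [mul_smul_comm, smul_mul_assoc, (hc _ _).eq]
  have hE : ∀ r, ∀ m, m • PowerSeries.coeff m (P ^ (r + 1)) = (r + 1) •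
      ∑ ij ∈ Finset.HasAntidiagonal.antidiagonal m,
        ij.1 • (c ij.1 * PowerSeries.coeff ij.2 (P ^ r)) := fun r m => by
    rw [← coeff_eulerDeriv, eulerDeriv_pow_succ P hcomm, map_nsmul, PowerSeries.coeff_mul]
    congr 1
    refine Finset.sum_congr rfl fun ij _ => ?_
    rw [coeff_eulerDeriv, hcoeff, smul_mul_assoc]
  have hfac : ∀ r : ℕ, (((r + 1).factorial : ℂ)⁻¹) * ((r + 1 : ℕ) : ℂ) = (r.factorial : ℂ)⁻¹ := by
    intro r
    have h₁ : ((r + 1 : ℕ) : ℂ) ≠ 0 := Nat.cast_ne_zero.2 r.succ_ne_zero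
    rw [Nat.factorial_succ, Nat.cast_mul, mul_inv, mul_right_comm, inv_mul_cancel₀ h₁, one_mul]
  -- `P` has no constant term, so `P^r` starts in degree `r` and the exponential series may be cut
  -- off at any `N > j`.
  have hle : ∀ j N, j < N → expCoeff c j
      = ∑ r ∈ Finset.range N, ((r.factorial : ℂ)⁻¹) • PowerSeries.coeff j (P ^ r) := by
    intro j N hj
    refine Finset.sum_subset (Finset.range_subset_range.2 hj) fun r _ hr => ?_
    rw [coeff_pow_eq_zero P hP0 r j (by simpa using hr), smul_zero]
  rw [hle n (n + 1) n.lt_succ_self, Finset.smul_sum, Finset.sum_range_succ']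
  have h0 : n • (((Nat.factorial 0 : ℕ) : ℂ)⁻¹ • PowerSeries.coeff n (P ^ 0)) = 0 := by
    cases n <;> simp [PowerSeries.coeff_one]
  rw [h0, add_zero]
  have hterm : ∀ r ∈ Finset.range n, n • ((((r + 1).factorial : ℂ)⁻¹) •
      PowerSeries.coeff n (P ^ (r + 1))) = ∑ ij ∈ Finset.HasAntidiagonal.antidiagonal n,
        ij.1 • (c ij.1 * ((r.factorial : ℂ)⁻¹) • PowerSeries.coeff ij.2 (P ^ r)) := by
    intro r _
    rw [smul_comm, hE, ← Nat.cast_smul_eq_nsmul ℂ (r + 1), smul_smul, hfac, Finset.smul_sum]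
    refine Finset.sum_congr rfl fun ij _ => ?_
    rw [smul_comm, mul_smul_comm]
  rw [Finset.sum_congr rfl hterm, Finset.sum_comm]
  refine Finset.sum_congr rfl fun ij hij => ?_
  rw [Finset.HasAntidiagonal.mem_antidiagonal] at hij
  by_cases hi : ij.1 = 0
  · simp [hi]
  · rw [hle ij.2 n (by omega), Finset.mul_sum, Finset.smul_sum]

/-- Coefficients of the exponential, indexed by all integers. -/
def expZ (c : ℕ → Module.End ℂ Fock) (a : ℤ) : Module.End ℂ Fock :=
  if 0 ≤ a then expCoeff c a.toNat else 0

theorem expZ_natCast (c : ℕ → Module.End ℂ Fock) (n : ℕ) : expZ c n = expCoeff c n := by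
  simp [expZ]

theorem expZ_zero (c : ℕ → Module.End ℂ Fock) : expZ c 0 = 1 := by
  simp [expZ, expCoeff_zero]

theorem expZ_neg (c : ℕ → Module.End ℂ Fock) {a : ℤ} (ha : a < 0) : expZ c a = 0 :=
  if_neg (by omega)

/-- The recursion for the coefficients of the exponential. -/
theorem smul_expZ {c : ℕ → Module.End ℂ Fock} (hc : ∀ i j, Commute (c i) (c j)) (a : ℤ) (K : ℕ)
    (hK : a < K) : (a : ℂ) • expZ c a = ∑ i ∈ Finset.range K, (i : ℂ) • (c i * expZ c (a - i)) := by
  rcases lt_or_ge a 0 with ha | ha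
  · rw [expZ_neg c ha, smul_zero, Finset.sum_eq_zero]
    intro i _
    rw [expZ_neg c (by omega), mul_zero, smul_zero]
  · lift a to ℕ using ha
    have h := nsmul_expCoeff c hc a
    rw [Finset.Nat.sum_antidiagonal_eq_sum_range_succ_mk] at h
    rw [expZ_natCast, Int.cast_natCast, Nat.cast_smul_eq_nsmul, h,
      ← Finset.sum_subset (Finset.range_subset_range.2 (show a + 1 ≤ K by omega))]
    · refine Finset.sum_congr rfl fun i hi => ?_
      rw [Finset.mem_range] at hi
      rw [← Nat.cast_smul_eq_nsmul ℂ, ← expZ_natCast, Nat.cast_sub (by omega)]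
    · intro i _ hi
      rw [expZ_neg c (by simp at hi; omega), mul_zero, smul_zero]

/-- The commutator of an exponential with an operator that has scalar commutators with the
exponent. -/
theorem mul_expZ {c : ℕ → Module.End ℂ Fock} (hc : ∀ i j, Commute (c i) (c j))
    (X : Module.End ℂ Fock) (k : ℕ) (hk : k ≠ 0) (γ : ℂ)
    (hX : ∀ i, X * c i = c i * X + (if i = k then γ else 0) • 1) (a : ℤ) :
    X * expZ c a = expZ c a * X + γ • expZ c (a - k) := by
  -- Induction on a bound for `a`: the recursion expresses `a • expZ c a` through smaller indices,
  -- and `a` is cancelled at the end.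
  have key : ∀ (n : ℕ) (a : ℤ), a < n →
      X * expZ c a = expZ c a * X + γ • expZ c (a - k) := by
    intro n
    induction n with
    | zero =>
      intro a ha
      rw [expZ_neg c (by omega), expZ_neg c (by omega)]
      simp
    | succ n ih =>
      intro a ha
      by_cases ha0 : a ≤ 0
      · rw [expZ_neg c (show a - k < 0 by omega), smul_zero, add_zero]
        rcases ha0.lt_or_eq with h | rfl
        · rw [expZ_neg c h]; simp
        · rw [expZ_zero]; simp
      have haC : (a : ℂ) ≠ 0 := by
        have : a ≠ 0 := by omega
        exact_mod_cast this
      let K := a.toNat + k + 1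
      have h₁ := smul_expZ hc a K (by omega)
      have h₂ := smul_expZ hc (a - k) K (by omega)
      have hterm : ∀ i ∈ Finset.range K, X * ((i : ℂ) • (c i * expZ c (a - i)))
          = (i : ℂ) • (c i * expZ c (a - i)) * X + γ • ((i : ℂ) • (c i * expZ c (a - k - i)))
            + if i = k then ((k : ℂ) * γ) • expZ c (a - k) else 0 := by
        intro i _
        rcases Nat.eq_zero_or_pos i with rfl | hi
        · rw [if_neg (Ne.symm hk)]
          simp
        rw [mul_smul_comm, ← mul_assoc, hX, add_mul, mul_assoc, ih (a - i) (by omega), mul_add,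
          mul_smul_comm, smul_mul_assoc, smul_mul_assoc, one_mul, ← mul_assoc, sub_right_comm]
        split_ifs with h
        · rw [h, mul_smul, smul_add, smul_add, smul_comm γ]
        · rw [zero_smul, smul_add, smul_add, smul_comm γ, smul_zero]
      have h₃ : (a : ℂ) • (X * expZ c a) = (a : ℂ) • (expZ c a * X + γ • expZ c (a - k)) := by
        rw [← mul_smul_comm, h₁, Finset.mul_sum, Finset.sum_congr rfl hterm,
          Finset.sum_add_distrib, Finset.sum_add_distrib, ← Finset.sum_mul, ← Finset.smul_sum,
          ← h₁, ← h₂, Finset.sum_ite_eq', if_pos (Finset.mem_range.2 (by omega)), smul_mul_assoc,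
          smul_add, add_assoc, smul_smul, smul_smul, ← add_smul]
        congr 2
        push_cast
        ring
      exact smul_right_injective _ haC h₃
  exact key (a.toNat + 1) a (by omega)

theorem commute_expZ {c : ℕ → Module.End ℂ Fock} (hc : ∀ i j, Commute (c i) (c j))
    {X : Module.End ℂ Fock} (hX : ∀ i, X * c i = c i * X) (a : ℤ) :
    X * expZ c a = expZ c a * X := by
  simpa using mul_expZ hc X 1 one_ne_zero 0 (fun i => by simp [hX i]) a

/-- By the recursion, each coefficient of positive degree can be written with some `c i` on the
right, which kills `v`. The lemma after it is the dual form for a functional that kills the images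
of all `c i`. -/
theorem expZ_apply_of_forall_eq_zero {c : ℕ → Module.End ℂ Fock}
    (hc : ∀ i j, Commute (c i) (c j)) {v : Fock} (hv : ∀ i, c i v = 0) (a : ℤ) :
    expZ c a v = if a = 0 then v else 0 := by
  split_ifs with h
  · rw [h, expZ_zero, Module.End.one_apply]
  · have h₁ := LinearMap.congr_fun (smul_expZ hc a (a.toNat + 1) (by omega)) v
    rw [LinearMap.smul_apply, LinearMap.sum_apply, Finset.sum_eq_zero, smul_eq_zero] at h₁
    · exact h₁.resolve_left (by exact_mod_cast h)
    · intro i _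
      rw [LinearMap.smul_apply, commute_expZ hc (fun j => (hc i j).eq), Module.End.mul_apply, hv,
        map_zero, smul_zero]

theorem map_expZ_of_forall_eq_zero {c : ℕ → Module.End ℂ Fock}
    (hc : ∀ i j, Commute (c i) (c j)) {φ : Fock →ₗ[ℂ] ℂ} (hφ : ∀ i v, φ (c i v) = 0) (a : ℤ)
    (v : Fock) : φ (expZ c a v) = if a = 0 then φ v else 0 := by
  split_ifs with h
  · rw [h, expZ_zero, Module.End.one_apply]
  · have h₁ := congrArg φ (LinearMap.congr_fun (smul_expZ hc a (a.toNat + 1) (by omega)) v)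
    rw [LinearMap.smul_apply, LinearMap.sum_apply, map_sum, Finset.sum_eq_zero, map_smul,
      smul_eq_zero] at h₁
    · exact h₁.resolve_left (by exact_mod_cast h)
    · intro i _
      rw [LinearMap.smul_apply, Module.End.mul_apply, map_smul, hφ, smul_zero]

/-! ## Modes of the free fields and of vertex operators -/

theorem isTruncated_of_creation {A : ℤ → Module.End ℂ Fock}
    (h₀ : ∀ μ, ∃ N : ℤ, ∀ n, N ≤ n → A n (ket μ 0 ∅) = 0)
    (hb : ∀ g (k : ℕ) v, (∃ N : ℤ, ∀ n, N ≤ n → A n v = 0) →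
      ∃ N : ℤ, ∀ n, N ≤ n → A n (boson g (-(k : ℤ) - 1) v) = 0)
    (hf : ∀ g (k : ℕ) v, (∃ N : ℤ, ∀ n, N ≤ n → A n v = 0) →
      ∃ N : ℤ, ∀ n, N ≤ n → A n (fermion g (-(k : ℤ) - 1) v) = 0) : IsTruncated A := by
  let W : Submodule ℂ Fock :=
    { carrier := {v | ∃ N : ℤ, ∀ n, N ≤ n → A n v = 0}
      zero_mem' := ⟨0, fun n _ => map_zero _⟩
      add_mem' := by
        rintro v w ⟨N, hN⟩ ⟨M, hM⟩
        exact ⟨max N M, fun n hn => by rw [map_add, hN n (by omega), hM n (by omega), add_zero]⟩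
      smul_mem' := by
        rintro r v ⟨N, hN⟩
        exact ⟨N, fun n hn => by rw [map_smul, hN n hn, smul_zero]⟩ }
  have h : W = ⊤ := eq_top_of_creation W h₀ hb hf
  exact fun v => show v ∈ W from h ▸ Submodule.mem_top

theorem isTruncated_boson (g : Gen) : IsTruncated (boson g) := by
  refine isTruncated_of_creation ?_ ?_ ?_
  · exact fun μ => ⟨1, fun n hn => boson_pos_vacuum _ _ (by omega) _ _⟩
  · rintro h k v ⟨N, hN⟩
    refine ⟨max N (k + 2), fun n hn => ?_⟩
    rw [← Module.End.mul_apply, boson_mul_boson, if_neg (by omega), zero_smul, add_zero,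
      Module.End.mul_apply, hN n (by omega), map_zero]
  · rintro h k v ⟨N, hN⟩
    refine ⟨N, fun n hn => ?_⟩
    rw [← Module.End.mul_apply, boson_mul_fermion, Module.End.mul_apply, hN n hn, map_zero]

theorem isTruncated_fermion (g : Gen) : IsTruncated (fermion g) := by
  refine isTruncated_of_creation ?_ ?_ ?_
  · exact fun μ => ⟨0, fun n hn => fermion_nonneg_vacuum _ _ hn _ _⟩
  · rintro h k v ⟨N, hN⟩
    refine ⟨N, fun n hn => ?_⟩
    rw [← Module.End.mul_apply, ← boson_mul_fermion, Module.End.mul_apply, hN n hn, map_zero]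
  · rintro h k v ⟨N, hN⟩
    refine ⟨max N (k + 1), fun n hn => ?_⟩
    rw [← Module.End.mul_apply, fermion_mul_fermion, if_neg (by omega), zero_smul, add_zero,
      LinearMap.neg_apply, Module.End.mul_apply, hN n (by omega), map_zero, neg_zero]

theorem boson_mul_latticeBoson (g : Gen) (l : Sector) (p n : ℤ) :
    boson g p * latticeBoson l n = latticeBoson l n * boson g p
      + (if p + n = 0 then (p : ℂ) * l.coord g.dual else 0) • 1 := by
  rw [latticeBoson, Finset.mul_sum, Finset.sum_mul]
  have h : ∀ h ∈ (Finset.univ : Finset Gen), boson g p * (l.coord h • boson h n)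
      = (l.coord h • boson h n) * boson g p
        + if h = g.dual then (if p + n = 0 then (p : ℂ) * l.coord g.dual else 0) •
          (1 : Module.End ℂ Fock) else 0 := by
    intro h _
    rw [mul_smul_comm, boson_mul_boson, smul_add, smul_mul_assoc, smul_smul]
    by_cases hg : h = g.dual
    · subst hg
      by_cases hp : p + n = 0
      · simp [hp, mul_comm]
      · simp [hp]
    · simp [hg]
  rw [Finset.sum_congr rfl h, Finset.sum_add_distrib]
  congr 1
  rw [Finset.sum_ite_eq', if_pos (Finset.mem_univ _)]

theorem fermion_mul_latticeBoson (g : Gen) (l : Sector) (p n : ℤ) :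
    fermion g p * latticeBoson l n = latticeBoson l n * fermion g p := by
  rw [latticeBoson, Finset.mul_sum, Finset.sum_mul]
  refine Finset.sum_congr rfl fun h _ => ?_
  rw [mul_smul_comm, ← boson_mul_fermion, smul_mul_assoc]

theorem commute_latticeBoson (l μ : Sector) {m n : ℤ} (h : m + n ≠ 0 ∨ m = 0) :
    Commute (latticeBoson l m) (latticeBoson μ n) := by
  have e : ∀ g : Gen, Commute (boson g m) (latticeBoson μ n) := fun g => by
    have := boson_mul_latticeBoson g μ m n
    rcases h with h | h
    · rwa [if_neg h, zero_smul, add_zero] at this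
    · rwa [h, Int.cast_zero, zero_mul, ite_self, zero_smul, add_zero, ← h] at this
  rw [latticeBoson]
  exact Commute.sum_left _ _ _ fun g _ => (e g).smul_left _

/-- The coefficients of the creation factor of a vertex operator. -/
def creationExp (l : Sector) : ℤ → Module.End ℂ Fock :=
  expZ fun k => ((k : ℂ)⁻¹) • latticeBoson l (-(k : ℤ))

/-- The coefficients of the annihilation factor of a vertex operator. -/
def annihilationExp (l : Sector) : ℤ → Module.End ℂ Fock :=
  expZ fun k => (-(k : ℂ)⁻¹) • latticeBoson l (k : ℤ)

theorem commute_creation (l μ : Sector) (i j : ℕ) :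
    Commute (((i : ℂ)⁻¹) • latticeBoson l (-(i : ℤ))) (((j : ℂ)⁻¹) • latticeBoson μ (-(j : ℤ))) :=
  ((commute_latticeBoson l μ (by omega)).smul_left _).smul_right _

theorem commute_annihilation (l μ : Sector) (i j : ℕ) :
    Commute ((-(i : ℂ)⁻¹) • latticeBoson l (i : ℤ)) ((-(j : ℂ)⁻¹) • latticeBoson μ (j : ℤ)) :=
  ((commute_latticeBoson l μ (by omega)).smul_left _).smul_right _

/-- The factor `1/k` in the exponent cancels the `k` of the commutator, leaving the pairing of `g`
with `l`, and `mul_expZ` applies. -/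
theorem boson_pos_mul_creationExp (g : Gen) (l : Sector) (k : ℕ) (hk : k ≠ 0) (a : ℤ) :
    boson g k * creationExp l a
      = creationExp l a * boson g k + l.coord g.dual • creationExp l (a - k) := by
  refine mul_expZ (commute_creation l l) _ k hk _ (fun i => ?_) a
  rw [mul_smul_comm, boson_mul_latticeBoson, smul_add, smul_mul_assoc, smul_smul]
  congr 2
  by_cases h : i = k
  · subst h
    have : (i : ℂ) ≠ 0 := by exact_mod_cast hk
    rw [if_pos (by ring), if_pos rfl]
    push_cast
    field_simp
  · rw [if_neg (by omega), if_neg h, mul_zero]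

theorem boson_nonpos_mul_creationExp (g : Gen) (l : Sector) {p : ℤ} (hp : p ≤ 0) (a : ℤ) :
    boson g p * creationExp l a = creationExp l a * boson g p := by
  refine commute_expZ (commute_creation l l) (fun i => ?_) a
  rw [mul_smul_comm, boson_mul_latticeBoson, smul_mul_assoc]
  by_cases h : p + -(i : ℤ) = 0
  · have : p = 0 := by omega
    simp [this]
  · rw [if_neg h, zero_smul, add_zero]

theorem boson_neg_mul_annihilationExp (g : Gen) (l : Sector) (k : ℕ) (hk : k ≠ 0) (a : ℤ) :
    boson g (-(k : ℤ)) * annihilationExp l a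
      = annihilationExp l a * boson g (-(k : ℤ)) + l.coord g.dual • annihilationExp l (a - k) := by
  refine mul_expZ (commute_annihilation l l) _ k hk _ (fun i => ?_) a
  rw [mul_smul_comm, boson_mul_latticeBoson, smul_add, smul_mul_assoc, smul_smul]
  congr 2
  by_cases h : i = k
  · subst h
    have : (i : ℂ) ≠ 0 := by exact_mod_cast hk
    rw [if_pos (by ring), if_pos rfl]
    push_cast
    field_simp
  · rw [if_neg (by omega), if_neg h, mul_zero]

theorem boson_nonneg_mul_annihilationExp (g : Gen) (l : Sector) {p : ℤ} (hp : 0 ≤ p) (a : ℤ) :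
    boson g p * annihilationExp l a = annihilationExp l a * boson g p := by
  refine commute_expZ (commute_annihilation l l) (fun i => ?_) a
  rw [mul_smul_comm, boson_mul_latticeBoson, smul_mul_assoc]
  by_cases h : p + (i : ℤ) = 0
  · have : p = 0 := by omega
    simp [this]
  · rw [if_neg h, zero_smul, add_zero]

theorem fermion_mul_creationExp (g : Gen) (l : Sector) (p a : ℤ) :
    fermion g p * creationExp l a = creationExp l a * fermion g p :=
  commute_expZ (commute_creation l l) (fun i => by
    rw [mul_smul_comm, fermion_mul_latticeBoson, smul_mul_assoc]) a

theorem fermion_mul_annihilationExp (g : Gen) (l : Sector) (p a : ℤ) :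
    fermion g p * annihilationExp l a = annihilationExp l a * fermion g p :=
  commute_expZ (commute_annihilation l l) (fun i => by
    rw [mul_smul_comm, fermion_mul_latticeBoson, smul_mul_assoc]) a

theorem latticeBoson_pos_vacuum (l : Sector) {n : ℤ} (hn : 0 < n) (ν : Sector) (S : Finset Mode) :
    latticeBoson l n (ket ν 0 S) = 0 := by
  simp [latticeBoson, LinearMap.sum_apply, boson_pos_vacuum _ _ hn]

theorem annihilationExp_vacuum (l : Sector) (b : ℤ) (ν : Sector) (S : Finset Mode) :
    annihilationExp l b (ket ν 0 S) = if b = 0 then ket ν 0 S else 0 := by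
  refine expZ_apply_of_forall_eq_zero (commute_annihilation l l) (fun i => ?_) b
  rcases Nat.eq_zero_or_pos i with rfl | hi
  · simp
  · rw [LinearMap.smul_apply, latticeBoson_pos_vacuum l (by omega), smul_zero]

theorem isTruncated_annihilationExp (l : Sector) : IsTruncated (annihilationExp l) := by
  refine isTruncated_of_creation ?_ ?_ ?_
  · exact fun μ => ⟨1, fun n hn => by rw [annihilationExp_vacuum, if_neg (by omega)]⟩
  · rintro h k v ⟨N, hN⟩
    refine ⟨N + k + 1, fun n hn => ?_⟩
    have e := LinearMap.congr_fun (boson_neg_mul_annihilationExp h l (k + 1) k.succ_ne_zero n) v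
    rw [show -((k + 1 : ℕ) : ℤ) = -(k : ℤ) - 1 by push_cast; ring, Module.End.mul_apply,
      hN n (by omega), map_zero, LinearMap.add_apply, LinearMap.smul_apply,
      hN (n - (k + 1 : ℕ)) (by push_cast; omega), smul_zero, add_zero] at e
    exact e.symm
  · rintro h k v ⟨N, hN⟩
    refine ⟨N, fun n hn => ?_⟩
    rw [← Module.End.mul_apply, ← fermion_mul_annihilationExp, Module.End.mul_apply, hN n hn,
      map_zero]

/-- Translation of the lattice part. -/
def shift (l : Sector) : Module.End ℂ Fock := ofBasis fun u => ket (l + u.1) u.2.1 u.2.2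

theorem shift_ket (l μ : Sector) (f : Mode →₀ ℕ) (S : Finset Mode) :
    shift l (ket μ f S) = ket (l + μ) f S := ofBasis_ket _ _ _ _

theorem coord_add (l μ : Sector) (g : Gen) : (l + μ).coord g = l.coord g + μ.coord g := by
  simp only [Sector.coord]
  rcases ofLex g with i | i <;> simp

theorem boson_mul_shift (g : Gen) (l : Sector) {p : ℤ} (hp : p ≠ 0) :
    boson g p * shift l = shift l * boson g p := by
  refine end_ext fun μ f S => ?_
  rcases int_cases p with ⟨k, rfl⟩ | rfl | ⟨k, rfl⟩
  · simp only [Module.End.mul_apply, shift_ket, boson_neg_ket]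
  · exact absurd rfl hp
  · simp only [Module.End.mul_apply, shift_ket, boson_pos_ket, map_smul]

theorem boson_zero_mul_shift (g : Gen) (l : Sector) :
    boson g 0 * shift l = shift l * boson g 0 + l.coord g.dual • shift l := by
  refine end_ext fun μ f S => ?_
  simp only [Module.End.mul_apply, LinearMap.add_apply, LinearMap.smul_apply, shift_ket,
    boson_zero_ket, map_smul, coord_add]
  rw [← add_smul, add_comm]

theorem fermion_mul_shift (g : Gen) (l : Sector) (p : ℤ) :
    fermion g p * shift l = shift l * fermion g p := by
  refine end_ext fun μ f S => ?_
  rcases int_cases' p with ⟨k, rfl⟩ | ⟨k, rfl⟩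
  · simp only [Module.End.mul_apply, shift_ket, fermion_neg_ket]
    split_ifs <;> simp [shift_ket]
  · simp only [Module.End.mul_apply, shift_ket, fermion_natCast_ket]
    split_ifs <;> simp [shift_ket]

/-- The subspace of the Fock space that belongs to a lattice element. -/
def sector (ν : Sector) : Submodule ℂ Fock :=
  Submodule.span ℂ (Set.range fun x : (Mode →₀ ℕ) × Finset Mode => ket ν x.1 x.2)

theorem ket_mem_sector (ν : Sector) (f : Mode →₀ ℕ) (S : Finset Mode) : ket ν f S ∈ sector ν :=
  Submodule.subset_span ⟨(f, S), rfl⟩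

theorem boson_ket_mem_sector (g : Gen) (p : ℤ) (ν : Sector) (f : Mode →₀ ℕ) (S : Finset Mode) :
    boson g p (ket ν f S) ∈ sector ν := by
  rcases int_cases p with ⟨k, rfl⟩ | rfl | ⟨k, rfl⟩
  · rw [boson_neg_ket]; exact ket_mem_sector _ _ _
  · rw [boson_zero_ket]; exact Submodule.smul_mem _ _ (ket_mem_sector _ _ _)
  · rw [boson_pos_ket]; exact Submodule.smul_mem _ _ (ket_mem_sector _ _ _)

theorem fermion_ket_mem_sector (g : Gen) (p : ℤ) (ν : Sector) (f : Mode →₀ ℕ) (S : Finset Mode) :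
    fermion g p (ket ν f S) ∈ sector ν := by
  rcases int_cases' p with ⟨k, rfl⟩ | ⟨k, rfl⟩
  · rw [fermion_neg_ket]
    split_ifs
    · exact zero_mem _
    · exact Submodule.smul_mem _ _ (ket_mem_sector _ _ _)
  · rw [fermion_natCast_ket]
    split_ifs
    · exact Submodule.smul_mem _ _ (ket_mem_sector _ _ _)
    · exact zero_mem _

/-- The modes of a vertex operator on a given sector. -/
theorem vertexOp_apply (l ν : Sector) {v : Fock} (hv : v ∈ sector ν) : ∃ B₀ : ℕ, ∀ B, B₀ ≤ B →
    ∀ n, vertexOp l n v = l.cocycle ν • ∑ b ∈ Finset.range B,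
      creationExp l (b - n - 1 - l.form ν) (annihilationExp l b (shift l v)) := by
  induction hv using Submodule.span_induction with
  | mem v hv =>
    obtain ⟨⟨f, S⟩, rfl⟩ := hv
    obtain ⟨B₀, hB₀⟩ := isTruncated_annihilationExp l (shift l (ket ν f S))
    refine ⟨B₀.toNat, fun B hB n => ?_⟩
    have e : ∀ b : ℕ, (if 0 ≤ (b : ℤ) - n - 1 - l.form ν then
        expCoeff (fun k => ((k : ℂ)⁻¹) • latticeBoson l (-(k : ℤ)))
          ((b : ℤ) - n - 1 - l.form ν).toNat
        (expCoeff (fun k => (-(k : ℂ)⁻¹) • latticeBoson l (k : ℤ)) b (ket (l + ν) f S)) else 0)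
        = creationExp l (b - n - 1 - l.form ν) (annihilationExp l b (shift l (ket ν f S))) := by
      intro b
      rw [shift_ket, creationExp, annihilationExp, expZ_natCast, expZ]
      split_ifs <;> rfl
    rw [vertexOp, ofBasis_ket]
    simp only [e]
    rw [finsum_nat_eq_sum_range (J := B)]
    intro b hb
    rw [hB₀ b (by omega), map_zero]
  | zero => exact ⟨0, fun B _ n => by simp⟩
  | add v w _ _ ihv ihw =>
    obtain ⟨B₁, h₁⟩ := ihv
    obtain ⟨B₂, h₂⟩ := ihw
    refine ⟨max B₁ B₂, fun B hB n => ?_⟩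
    rw [map_add, h₁ B (by omega), h₂ B (by omega), ← smul_add, ← Finset.sum_add_distrib]
    simp only [map_add]
  | smul r v _ ih =>
    obtain ⟨B₁, h₁⟩ := ih
    refine ⟨B₁, fun B hB n => ?_⟩
    rw [map_smul, h₁ B hB, smul_comm, Finset.smul_sum]
    simp only [map_smul]

/-- In generating form `[g_(p), Γ_l(z)] = (g·l) z^p Γ_l(z)`. The scalar comes from the annihilation
factor for `p < 0`, from the lattice translation for `p = 0`, and from the creation factor for `p >
0`. -/
theorem boson_mul_vertexOp (g : Gen) (l : Sector) (p n : ℤ) :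
    boson g p * vertexOp l n = vertexOp l n * boson g p + l.coord g.dual • vertexOp l (n + p) := by
  refine end_ext fun ν f S => ?_
  obtain ⟨B₁, h₁⟩ := vertexOp_apply l ν (ket_mem_sector ν f S)
  obtain ⟨B₂, h₂⟩ := vertexOp_apply l ν (boson_ket_mem_sector g p ν f S)
  simp only [Module.End.mul_apply, LinearMap.add_apply, LinearMap.smul_apply]
  generalize ket ν f S = v at *
  rcases lt_trichotomy p 0 with hp | rfl | hp
  · obtain ⟨k, rfl⟩ : ∃ k : ℕ, p = -(k : ℤ) := ⟨(-p).toNat, by omega⟩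
    have hk : k ≠ 0 := by omega
    let B := max B₁ B₂
    -- The commutator lowers the annihilation index by `k`: of `k + B` terms the first `k` vanish
    -- and the remaining `B` give the shifted mode.
    rw [h₁ (k + B) (by omega), h₂ (k + B) (by omega), h₁ B (by omega), smul_comm, ← smul_add,
      map_smul, map_sum]
    congr 1
    have e : ∀ b : ℕ, boson g (-(k : ℤ)) (creationExp l (b - n - 1 - l.form ν)
          (annihilationExp l b (shift l v)))
        = creationExp l (b - n - 1 - l.form ν) (annihilationExp l b
            (shift l (boson g (-(k : ℤ)) v)))
          + l.coord g.dual • creationExp l (b - n - 1 - l.form ν)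
            (annihilationExp l (b - k) (shift l v)) := by
      intro b
      rw [← Module.End.mul_apply, boson_nonpos_mul_creationExp _ _ hp.le, Module.End.mul_apply,
        ← Module.End.mul_apply (boson g _), boson_neg_mul_annihilationExp _ _ _ hk,
        LinearMap.add_apply, Module.End.mul_apply, ← Module.End.mul_apply (boson g _),
        boson_mul_shift _ _ hp.ne, map_add, LinearMap.smul_apply, map_smul]
      rfl
    simp only [e, Finset.sum_add_distrib, ← Finset.smul_sum]
    congr 2
    rw [Finset.sum_range_add, Finset.sum_eq_zero, zero_add]
    · refine Finset.sum_congr rfl fun b _ => ?_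
      congr 2 <;> congr 1 <;> push_cast <;> ring
    · intro b hb
      rw [Finset.mem_range] at hb
      rw [annihilationExp, expZ_neg _ (show (b : ℤ) - k < 0 by omega)]
      simp
  · let B := max B₁ B₂
    rw [h₁ B (by omega), h₂ B (by omega), h₁ B (by omega), smul_comm, ← smul_add,
      map_smul, map_sum]
    congr 1
    rw [Finset.smul_sum, ← Finset.sum_add_distrib]
    refine Finset.sum_congr rfl fun b _ => ?_
    rw [← Module.End.mul_apply, boson_nonpos_mul_creationExp _ _ le_rfl, Module.End.mul_apply,
        ← Module.End.mul_apply (boson g _), boson_nonneg_mul_annihilationExp _ _ le_rfl,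
        Module.End.mul_apply, ← Module.End.mul_apply (boson g _), boson_zero_mul_shift]
    simp [add_zero]
  · obtain ⟨k, rfl⟩ : ∃ k : ℕ, p = (k : ℤ) := ⟨p.toNat, by omega⟩
    have hk : k ≠ 0 := by omega
    let B := max B₁ B₂
    rw [h₁ B (by omega), h₂ B (by omega), h₁ B (by omega), smul_comm, ← smul_add,
      map_smul, map_sum]
    congr 1
    rw [Finset.smul_sum, ← Finset.sum_add_distrib]
    refine Finset.sum_congr rfl fun b _ => ?_
    rw [← Module.End.mul_apply, boson_pos_mul_creationExp _ _ _ hk, LinearMap.add_apply,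
      Module.End.mul_apply, ← Module.End.mul_apply (boson g _),
      boson_nonneg_mul_annihilationExp _ _ hp.le, Module.End.mul_apply,
      ← Module.End.mul_apply (boson g _), boson_mul_shift _ _ hp.ne', LinearMap.smul_apply]
    rw [show (b : ℤ) - n - 1 - l.form ν - k = b - (n + k) - 1 - l.form ν by ring]
    rfl

theorem fermion_mul_vertexOp (g : Gen) (l : Sector) (p n : ℤ) :
    fermion g p * vertexOp l n = vertexOp l n * fermion g p := by
  refine end_ext fun ν f S => ?_
  obtain ⟨B₁, h₁⟩ := vertexOp_apply l ν (ket_mem_sector ν f S)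
  obtain ⟨B₂, h₂⟩ := vertexOp_apply l ν (fermion_ket_mem_sector g p ν f S)
  simp only [Module.End.mul_apply]
  let B := max B₁ B₂
  rw [h₁ B (by omega), h₂ B (by omega), map_smul, map_sum]
  congr 1
  refine Finset.sum_congr rfl fun b _ => ?_
  rw [← Module.End.mul_apply, fermion_mul_creationExp, Module.End.mul_apply,
    ← Module.End.mul_apply (fermion g p), fermion_mul_annihilationExp, Module.End.mul_apply,
    ← Module.End.mul_apply (fermion g p), fermion_mul_shift]
  rfl

theorem vertexOp_vacuum (l ν : Sector) (n : ℤ) (S : Finset Mode) :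
    vertexOp l n (ket ν 0 S)
      = l.cocycle ν • creationExp l (-n - 1 - l.form ν) (ket (l + ν) 0 S) := by
  obtain ⟨B, h⟩ := vertexOp_apply l ν (ket_mem_sector ν 0 S)
  rw [h (B + 1) (by omega), Finset.sum_range_succ', Finset.sum_eq_zero]
  · rw [shift_ket, annihilationExp_vacuum]
    simp
  · intro b _
    rw [shift_ket, annihilationExp_vacuum, if_neg (by push_cast; omega), map_zero]

theorem isTruncated_vertexOp (l : Sector) : IsTruncated (vertexOp l) := by
  refine isTruncated_of_creation ?_ ?_ ?_
  · refine fun μ => ⟨-l.form μ, fun n hn => ?_⟩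
    rw [vertexOp_vacuum, creationExp, expZ_neg _ (by omega), LinearMap.zero_apply, smul_zero]
  · rintro h k v ⟨N, hN⟩
    refine ⟨N + k + 1, fun n hn => ?_⟩
    have e := LinearMap.congr_fun (boson_mul_vertexOp h l (-(k : ℤ) - 1) n) v
    rw [Module.End.mul_apply, hN n (by omega), map_zero, LinearMap.add_apply, LinearMap.smul_apply,
      hN _ (by omega), smul_zero, add_zero] at e
    exact e.symm
  · rintro h k v ⟨N, hN⟩
    refine ⟨N, fun n hn => ?_⟩
    rw [← Module.End.mul_apply, ← fermion_mul_vertexOp, Module.End.mul_apply, hN n hn,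
      map_zero]

/-! ## Mutual locality of the generating fields -/

/-- The commutator is supported on `i + j = 0` and linear in `i`, so its second difference vanishes;
this is the double pole. -/
theorem mutLocal_boson_boson (g h : Gen) : MutLocal 1 (boson g) (boson h) := by
  refine ⟨2, fun v => ?_⟩
  funext i j
  have e : ∀ i j, superComm 1 (boson g) (boson h) v i j
      = (if i + j = 0 ∧ h = g.dual then (i : ℂ) else 0) • v := fun i j => by
    rw [superComm, ← Module.End.mul_apply, boson_mul_boson, LinearMap.add_apply,
      LinearMap.smul_apply, Module.End.one_apply,
      one_smul, Module.End.mul_apply, add_sub_cancel_left]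
  simp only [diffShift_pow_succ_apply, pow_zero, Module.End.one_apply, e, ← sub_smul, Pi.zero_apply]
  rw [smul_eq_zero]
  left
  have e₁ : i + 1 + 1 + j = i + j + 2 := by ring
  have e₂ : i + 1 + (j + 1) = i + j + 2 := by ring
  have e₃ : i + (j + 1 + 1) = i + j + 2 := by ring
  rw [e₁, e₂, e₃]
  split_ifs <;> push_cast <;> ring

theorem mutLocal_fermion_fermion (g h : Gen) : MutLocal (-1) (fermion g) (fermion h) := by
  refine ⟨1, fun v => ?_⟩
  funext i j
  have e : ∀ i j, superComm (-1) (fermion g) (fermion h) v i j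
      = (if i + j = -1 ∧ h = g.dual then (1 : ℂ) else 0) • v := fun i j => by
    rw [superComm, ← Module.End.mul_apply, fermion_mul_fermion, LinearMap.add_apply,
      LinearMap.smul_apply,
      Module.End.one_apply, LinearMap.neg_apply, Module.End.mul_apply, neg_one_smul]
    abel
  simp only [diffShift_pow_succ_apply, pow_zero, Module.End.one_apply, e, ← sub_smul, Pi.zero_apply]
  rw [show i + 1 + j = i + (j + 1) by ring, sub_self, zero_smul]

theorem mutLocal_of_commute {a b : ℤ → Module.End ℂ Fock} (h : ∀ i j, a i * b j = b j * a i) :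
    MutLocal 1 a b := by
  refine ⟨0, fun v => ?_⟩
  funext i j
  rw [pow_zero, Module.End.one_apply, superComm, ← Module.End.mul_apply, h]
  simp

theorem mutLocal_boson_fermion (g h : Gen) : MutLocal 1 (boson g) (fermion h) :=
  mutLocal_of_commute (boson_mul_fermion g h)

theorem mutLocal_fermion_vertexOp (g : Gen) (l : Sector) : MutLocal 1 (fermion g) (vertexOp l) :=
  mutLocal_of_commute (fermion_mul_vertexOp g l)

/-- The commutator depends on the modes only through their sum, so one factor `z - w` kills it. -/
theorem mutLocal_boson_vertexOp (g : Gen) (l : Sector) : MutLocal 1 (boson g) (vertexOp l) := by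
  refine ⟨1, fun v => ?_⟩
  funext i j
  have e : ∀ i j, superComm 1 (boson g) (vertexOp l) v i j
      = l.coord g.dual • vertexOp l (j + i) v := fun i j => by
    rw [superComm, ← Module.End.mul_apply, boson_mul_vertexOp]
    simp
  simp only [diffShift_pow_succ_apply, pow_zero, Module.End.one_apply, e, Pi.zero_apply]
  rw [show j + (i + 1) = j + 1 + i by ring, sub_self]

theorem pairing_add_left (m m' : latM) (n : latN) :
    pairing (m + m') n = pairing m n + pairing m' n := by
  have h : (pairing (m + m') n : ℚ) = pairing m n + pairing m' n := by
    simp only [pairing_cast, ← Finset.sum_add_distrib]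
    refine Finset.sum_congr rfl fun i _ => ?_
    simp [add_mul]
  exact_mod_cast h

theorem pairing_add_right (m : latM) (n n' : latN) :
    pairing m (n + n') = pairing m n + pairing m n' := by
  have h : (pairing m (n + n') : ℚ) = pairing m n + pairing m n' := by
    simp only [pairing_cast, ← Finset.sum_add_distrib]
    refine Finset.sum_congr rfl fun i _ => ?_
    simp [mul_add]
  exact_mod_cast h

theorem form_add (l μ ν : Sector) : l.form (μ + ν) = l.form μ + l.form ν := by
  simp only [Sector.form, Prod.fst_add, Prod.snd_add, AddSubmonoid.coe_add, pairing_add_left,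
    pairing_add_right]
  ring

theorem form_zero (l : Sector) : l.form 0 = 0 := by
  have := form_add l 0 0
  rw [add_zero] at this
  omega

theorem form_comm (l μ : Sector) : l.form μ = μ.form l := add_comm _ _

theorem cocycle_add (l μ ν : Sector) : l.cocycle (μ + ν) = l.cocycle μ * l.cocycle ν := by
  simp only [Sector.cocycle, Prod.snd_add, AddSubmonoid.coe_add, pairing_add_right]
  exact zpow_add₀ (by norm_num) _ _

/-- This sign compensates the one between the expansions of `(z - w)^(l,μ)` and `(w - z)^(l,μ)` and
makes the vertex operators local as even fields. -/
theorem cocycle_mul_cocycle (l μ : Sector) :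
    l.cocycle μ * μ.cocycle l = (-1 : ℂ) ^ l.form μ := (zpow_add₀ (by norm_num) _ _).symm

theorem cocycle_mul_self (l μ : Sector) : l.cocycle μ * l.cocycle μ = 1 := by
  rw [Sector.cocycle, ← mul_zpow]
  simp

theorem pairing_cast_complex (m : latM) (n : latN) :
    (pairing m n : ℂ) = ∑ i, ((m : Fin 5 → ℤ) i : ℂ) * (((n : Fin 5 → ℚ) i : ℚ) : ℂ) := by
  have h := congrArg (fun x : ℚ => (x : ℂ)) (pairing_cast m n)
  push_cast at h
  exact h

theorem sum_coord_mul_coord (l μ : Sector) :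
    ∑ g : Gen, l.coord g * μ.coord g.dual = (l.form μ : ℂ) := by
  have e : ∑ g : Gen, l.coord g * μ.coord g.dual
      = ∑ x : Fin 5 ⊕ Fin 5, l.coord (toLex x) * μ.coord (toLex x.swap) :=
    Fintype.sum_equiv ofLex _ _ fun _ => rfl
  rw [e, Fintype.sum_sum_type, Sector.form, Int.cast_add, pairing_cast_complex,
    pairing_cast_complex]
  congr 1
  refine Finset.sum_congr rfl fun i _ => mul_comm _ _

/-- The coefficient of the lattice state `|ρ⟩`. -/
def vacuumCoeff (ρ : Sector) : Fock →ₗ[ℂ] ℂ := Finsupp.lapply (ρ, 0, ∅)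

theorem vacuumCoeff_boson_neg (ρ : Sector) (g : Gen) {p : ℤ} (hp : p < 0) (v : Fock) :
    vacuumCoeff ρ (boson g p v) = 0 := by
  obtain ⟨k, rfl⟩ : ∃ k : ℕ, p = -(k : ℤ) - 1 := ⟨(-p - 1).toNat, by omega⟩
  have h : vacuumCoeff ρ ∘ₗ boson g (-(k : ℤ) - 1) = 0 := by
    refine hom_ext fun μ f S => ?_
    rw [LinearMap.comp_apply, boson_neg_ket, vacuumCoeff, Finsupp.lapply_apply, ket_apply, if_neg]
    · rfl
    · rintro ⟨-, hf, -⟩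
      simpa using DFunLike.congr_fun hf (mode g k)
  exact LinearMap.congr_fun h v

theorem vacuumCoeff_fermion_neg (ρ : Sector) (g : Gen) {p : ℤ} (hp : p < 0) (v : Fock) :
    vacuumCoeff ρ (fermion g p v) = 0 := by
  obtain ⟨k, rfl⟩ : ∃ k : ℕ, p = -(k : ℤ) - 1 := ⟨(-p - 1).toNat, by omega⟩
  have h : vacuumCoeff ρ ∘ₗ fermion g (-(k : ℤ) - 1) = 0 := by
    refine hom_ext fun μ f S => ?_
    rw [LinearMap.comp_apply, fermion_neg_ket]
    split_ifs
    · simp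
    · rw [map_smul, vacuumCoeff, Finsupp.lapply_apply, ket_apply, if_neg, smul_zero]
      · rfl
      · rintro ⟨-, -, hS⟩
        exact Finset.insert_ne_empty _ _ hS
  exact LinearMap.congr_fun h v

theorem vacuumCoeff_latticeBoson_neg (ρ l : Sector) {p : ℤ} (hp : p < 0) (v : Fock) :
    vacuumCoeff ρ (latticeBoson l p v) = 0 := by
  simp [latticeBoson, LinearMap.sum_apply, vacuumCoeff_boson_neg ρ _ hp]

theorem vacuumCoeff_creationExp (ρ l : Sector) (a : ℤ) (v : Fock) :
    vacuumCoeff ρ (creationExp l a v) = if a = 0 then vacuumCoeff ρ v else 0 := by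
  refine map_expZ_of_forall_eq_zero (commute_creation l l) (fun i w => ?_) a v
  rcases Nat.eq_zero_or_pos i with rfl | hi
  · simp
  · rw [LinearMap.smul_apply, map_smul, vacuumCoeff_latticeBoson_neg ρ l (by omega), smul_zero]

theorem latticeBoson_mul_creationExp (l μ : Sector) (k : ℕ) (hk : k ≠ 0) (a : ℤ) :
    latticeBoson l k * creationExp μ a
      = creationExp μ a * latticeBoson l k + (l.form μ : ℂ) • creationExp μ (a - k) := by
  rw [latticeBoson, Finset.sum_mul, Finset.mul_sum, ← sum_coord_mul_coord, Finset.sum_smul,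
    ← Finset.sum_add_distrib]
  refine Finset.sum_congr rfl fun g _ => ?_
  rw [smul_mul_assoc, boson_pos_mul_creationExp g μ k hk, smul_add, mul_smul_comm, smul_smul]

/-- The coefficient of `x^q` in `(1 - x)^r`, for all integers `q`. -/
def binomCoeffInt (r q : ℤ) : ℂ := if 0 ≤ q then binomCoeff r q.toNat else 0

theorem binomCoeffInt_neg (r : ℤ) {q : ℤ} (hq : q < 0) : binomCoeffInt r q = 0 :=
  if_neg (by omega)

theorem binomCoeffInt_natCast (r : ℤ) (q : ℕ) : binomCoeffInt r q = binomCoeff r q := by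
  simp [binomCoeffInt]

theorem binomCoeffInt_succ (r q : ℤ) :
    binomCoeffInt (r + 1) q = binomCoeffInt r q - binomCoeffInt r (q - 1) := by
  rcases lt_trichotomy q 0 with hq | rfl | hq
  · rw [binomCoeffInt_neg _ hq, binomCoeffInt_neg _ hq, binomCoeffInt_neg _ (by omega), sub_zero]
  · rw [binomCoeffInt_neg _ (by omega : (0 : ℤ) - 1 < 0)]
    simp [binomCoeffInt]
  · obtain ⟨k, rfl⟩ : ∃ k : ℕ, q = ((k + 1 : ℕ) : ℤ) := ⟨(q - 1).toNat, by omega⟩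
    rw [binomCoeffInt_natCast, binomCoeffInt_natCast,
      show ((k + 1 : ℕ) : ℤ) - 1 = k by push_cast; ring, binomCoeffInt_natCast,
      binomCoeff_succ_succ]

/-- The coefficients of `(1 - x)^R` are palindromic up to `(-1)^R`, in the range and, trivially,
outside it. This is the symmetry behind locality of vertex operators. -/
theorem binomCoeffInt_symm (R : ℕ) (q : ℤ) :
    binomCoeffInt R (R - q) = (-1) ^ R * binomCoeffInt R q := by
  rcases lt_or_ge q 0 with hq | hq
  · obtain ⟨k, hk⟩ : ∃ k : ℕ, (R : ℤ) - q = k := ⟨(R - q).toNat, by omega⟩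
    rw [binomCoeffInt_neg _ hq, hk, binomCoeffInt_natCast, binomCoeff_natCast,
      Nat.choose_eq_zero_of_lt (by omega)]
    simp
  lift q to ℕ using hq
  rw [binomCoeffInt_natCast, binomCoeff_natCast]
  rcases lt_or_ge R q with h | h
  · rw [binomCoeffInt_neg _ (by omega), Nat.choose_eq_zero_of_lt h]
    simp
  · rw [← Nat.cast_sub h, binomCoeffInt_natCast, binomCoeff_natCast, Nat.choose_symm h]
    have e : (-1 : ℂ) ^ R = (-1) ^ (R - q) * (-1) ^ q := by rw [← pow_add, Nat.sub_add_cancel h]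
    rw [e, mul_assoc, ← mul_assoc ((-1 : ℂ) ^ q), neg_one_pow_mul_self, one_mul]

/-- The coefficient form of `x d/dx (1 - x)^r = -r x (1 - x)^r / (1 - x)`, matching the recursion
for exponentials. -/
theorem mul_sum_binomCoeff (r : ℤ) (b : ℕ) :
    -(r : ℂ) * ∑ j ∈ Finset.range b, binomCoeff r j = b * binomCoeff r b := by
  induction b with
  | zero => simp
  | succ b ih =>
    rw [Finset.sum_range_succ, mul_add, ih]
    have h := binomCoeff_succ_mul r b
    push_cast
    linear_combination -h

/-- The expectation of an annihilation factor at `z` times a creation factor at `w` is `(1 -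
w/z)^(l,μ)`; the induction on `b` compares the recursions of both sides. -/
theorem vacuumCoeff_annihilationExp_creationExp (ρ l μ ν : Sector) (b q : ℤ) :
    vacuumCoeff ρ (annihilationExp l b (creationExp μ q (ket ν 0 ∅)))
      = (if b = q then binomCoeffInt (l.form μ) b else 0) * vacuumCoeff ρ (ket ν 0 ∅) := by
  rcases lt_or_ge b 0 with hb | hb
  · rw [annihilationExp, expZ_neg _ hb, binomCoeffInt_neg _ hb]
    simp
  lift b to ℕ using hb
  induction b using Nat.strong_induction_on generalizing q with
  | _ b ih =>
    rcases Nat.eq_zero_or_pos b with rfl | hb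
    · rw [annihilationExp, Nat.cast_zero, expZ_zero, Module.End.one_apply, vacuumCoeff_creationExp]
      by_cases hq : q = 0
      · simp [hq, binomCoeffInt]
      · rw [if_neg hq, if_neg (Ne.symm hq), zero_mul]
    · have hbC : (b : ℂ) ≠ 0 := by exact_mod_cast hb.ne'
      have h := smul_expZ (commute_annihilation l l) b (b + 1) (by omega)
      have h' := congrArg (vacuumCoeff ρ) (LinearMap.congr_fun h (creationExp μ q (ket ν 0 ∅)))
      rw [LinearMap.smul_apply, map_smul, LinearMap.sum_apply, map_sum,
        Finset.sum_range_succ'] at h'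
      have hterm : ∀ i ∈ Finset.range b, vacuumCoeff ρ ((((i + 1 : ℕ) : ℂ) •
          ((-((i + 1 : ℕ) : ℂ)⁻¹) • latticeBoson l ((i + 1 : ℕ) : ℤ) *
            expZ (fun k => (-(k : ℂ)⁻¹) • latticeBoson l (k : ℤ)) ((b : ℤ) - (i + 1 : ℕ))))
              (creationExp μ q (ket ν 0 ∅)))
          = -(l.form μ : ℂ) * ((if (b : ℤ) = q then binomCoeff (l.form μ) (b - 1 - i) else 0) *
            vacuumCoeff ρ (ket ν 0 ∅)) := by
        intro i hi
        rw [Finset.mem_range] at hi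
        have hiC : ((i + 1 : ℕ) : ℂ) ≠ 0 := Nat.cast_ne_zero.2 i.succ_ne_zero
        -- The boson mode is moved to the right of the annihilation factor and then through the
        -- creation factor, where it lowers `q` by `i + 1` and yields the scalar `(l,μ)`.
        have hc := commute_expZ (commute_annihilation l l)
          (fun j => (commute_annihilation l l (i + 1) j).eq) ((b : ℤ) - (i + 1 : ℕ))
        rw [hc, mul_smul_comm, smul_smul, mul_neg, mul_inv_cancel₀ hiC,
          LinearMap.smul_apply, Module.End.mul_apply, ← Module.End.mul_apply (latticeBoson l _),
          latticeBoson_mul_creationExp l μ (i + 1) i.succ_ne_zero, LinearMap.add_apply,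
          Module.End.mul_apply, latticeBoson_pos_vacuum l (by omega), map_zero, zero_add,
          LinearMap.smul_apply, map_smul, map_smul, map_smul,
          show (b : ℤ) - (i + 1 : ℕ) = ((b - 1 - i : ℕ) : ℤ) by omega]
        have := ih (b - 1 - i) (by omega) (q - (i + 1 : ℕ))
        rw [annihilationExp, binomCoeffInt_natCast] at this
        rw [this, smul_eq_mul, smul_eq_mul, neg_one_mul, neg_mul]
        have e : ((b - 1 - i : ℕ) : ℤ) = q - (i + 1 : ℕ) ↔ (b : ℤ) = q := by omega
        simp only [e]
      rw [Finset.sum_congr rfl hterm, ← Finset.mul_sum, ← Finset.sum_mul] at h'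
      rw [binomCoeffInt_natCast]
      apply mul_left_cancel₀ hbC
      rw [Nat.cast_zero, zero_smul, LinearMap.zero_apply, map_zero, add_zero, Int.cast_natCast,
        smul_eq_mul] at h'
      rw [annihilationExp, h']
      by_cases hbq : (b : ℤ) = q
      · simp only [if_pos hbq]
        rw [Finset.sum_range_reflect, ← mul_assoc, mul_sum_binomCoeff, mul_assoc]
      · simp [if_neg hbq]

theorem shift_mul_creationExp (l μ : Sector) (a : ℤ) :
    shift l * creationExp μ a = creationExp μ a * shift l := by
  refine commute_expZ (commute_creation μ μ) (fun i => ?_) a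
  rcases Nat.eq_zero_or_pos i with rfl | hi
  · simp
  · rw [mul_smul_comm, smul_mul_assoc, latticeBoson, Finset.mul_sum, Finset.sum_mul]
    congr 1
    refine Finset.sum_congr rfl fun g _ => ?_
    rw [mul_smul_comm, smul_mul_assoc, boson_mul_shift g l (by omega)]

theorem expZ_mem {c : ℕ → Module.End ℂ Fock} (hc : ∀ i j, Commute (c i) (c j))
    {W : Submodule ℂ Fock} (hW : ∀ i, ∀ v ∈ W, c i v ∈ W) (a : ℤ) {v : Fock} (hv : v ∈ W) :
    expZ c a v ∈ W := by
  rcases lt_or_ge a 0 with ha | ha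
  · rw [expZ_neg c ha]
    exact zero_mem _
  lift a to ℕ using ha
  induction a using Nat.strong_induction_on with
  | _ a ih =>
    rcases Nat.eq_zero_or_pos a with rfl | ha
    · rwa [Nat.cast_zero, expZ_zero, Module.End.one_apply]
    have haC : (a : ℂ) ≠ 0 := by exact_mod_cast ha.ne'
    have h := LinearMap.congr_fun (smul_expZ hc a (a + 1) (by omega)) v
    rw [LinearMap.smul_apply, Int.cast_natCast] at h
    rw [← inv_smul_smul₀ haC (expZ c a v), h, LinearMap.sum_apply]
    refine W.smul_mem _ (W.sum_mem fun i hi => ?_)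
    rw [Finset.mem_range] at hi
    rcases Nat.eq_zero_or_pos i with rfl | hi0
    · simp
    · rw [LinearMap.smul_apply, Module.End.mul_apply, ← Nat.cast_sub (by omega)]
      exact W.smul_mem _ (hW i _ (ih _ (by omega)))

theorem boson_mem_sector (g : Gen) (p : ℤ) {ν : Sector} {v : Fock} (hv : v ∈ sector ν) :
    boson g p v ∈ sector ν := by
  induction hv using Submodule.span_induction with
  | mem v hv =>
    obtain ⟨⟨f, S⟩, rfl⟩ := hv
    exact boson_ket_mem_sector g p ν f S
  | zero => simp
  | add v w _ _ hv hw => rw [map_add]; exact add_mem hv hw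
  | smul r v _ hv => rw [map_smul]; exact Submodule.smul_mem _ r hv

theorem latticeBoson_mem {W : Submodule ℂ Fock} (hW : ∀ g p, ∀ v ∈ W, boson g p v ∈ W)
    (l : Sector) (n : ℤ) {v : Fock} (hv : v ∈ W) : latticeBoson l n v ∈ W := by
  rw [latticeBoson, LinearMap.sum_apply]
  exact W.sum_mem fun g _ => W.smul_mem _ (hW g n v hv)

theorem creationExp_mem {W : Submodule ℂ Fock} (hW : ∀ g p, ∀ v ∈ W, boson g p v ∈ W)
    (l : Sector) (a : ℤ) {v : Fock} (hv : v ∈ W) : creationExp l a v ∈ W :=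
  expZ_mem (commute_creation l l) (fun _ _ hv => W.smul_mem _ (latticeBoson_mem hW l _ hv)) a hv

theorem annihilationExp_mem {W : Submodule ℂ Fock} (hW : ∀ g p, ∀ v ∈ W, boson g p v ∈ W)
    (l : Sector) (a : ℤ) {v : Fock} (hv : v ∈ W) : annihilationExp l a v ∈ W :=
  expZ_mem (commute_annihilation l l) (fun _ _ hv => W.smul_mem _ (latticeBoson_mem hW l _ hv)) a hv

/-- Up to cocycles, these are the coefficients of `z^(l,ν) w^(μ,ν) (z - w)^(l,μ)` expanded in `|z| >
|w|`. -/
theorem vacuumCoeff_vertexOp_vertexOp (ρ l μ ν : Sector) (k m : ℤ) :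
    vacuumCoeff ρ (vertexOp l k (vertexOp μ m (ket ν 0 ∅)))
      = l.cocycle μ * l.cocycle ν * μ.cocycle ν * vacuumCoeff ρ (ket (l + μ + ν) 0 ∅) *
        if k + m = -2 - l.form μ - l.form ν - μ.form ν
          then binomCoeffInt (l.form μ) (-m - (1 + μ.form ν)) else 0 := by
  rw [vertexOp_vacuum, map_smul, map_smul]
  obtain ⟨B₀, hB₀⟩ := vertexOp_apply l (μ + ν)
    (creationExp_mem (fun g p _ hv => boson_mem_sector g p hv) μ (-m - 1 - μ.form ν)
      (ket_mem_sector (μ + ν) 0 ∅))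
  -- The functional sees only degree zero of the outer creation factor, which leaves a single value
  -- of `b`.
  have e : ∀ b : ℤ, vacuumCoeff ρ (creationExp l (b - k - 1 - l.form (μ + ν)) (annihilationExp l b
      (shift l (creationExp μ (-m - 1 - μ.form ν) (ket (μ + ν) 0 ∅)))))
      = if b = k + 1 + l.form (μ + ν) then
        (if k + m = -2 - l.form μ - l.form ν - μ.form ν
          then binomCoeffInt (l.form μ) (-m - (1 + μ.form ν)) else 0) *
          vacuumCoeff ρ (ket (l + μ + ν) 0 ∅) else 0 := by
    intro b
    rw [← Module.End.mul_apply (shift l), shift_mul_creationExp, Module.End.mul_apply, shift_ket,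
      vacuumCoeff_creationExp, vacuumCoeff_annihilationExp_creationExp, ← add_assoc l μ ν, form_add]
    by_cases hb : b = k + 1 + (l.form μ + l.form ν)
    · rw [if_pos (by omega), if_pos hb]
      congr 1
      by_cases hk : k + m = -2 - l.form μ - l.form ν - μ.form ν
      · rw [if_pos (by omega), if_pos hk]
        congr 1
        omega
      · rw [if_neg (by omega), if_neg hk]
    · rw [if_neg (by omega), if_neg hb]
  rw [hB₀ (max B₀ (k + 2 + l.form (μ + ν)).toNat) (le_max_left _ _), map_smul, map_sum,
    Finset.sum_congr rfl fun (b : ℕ) _ => e b, cocycle_add]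
  by_cases hq : 0 ≤ k + 1 + l.form (μ + ν)
  · rw [Finset.sum_eq_single (k + 1 + l.form (μ + ν)).toNat, if_pos (by omega)]
    · simp only [smul_eq_mul]
      ring
    · intro b _ hb
      rw [if_neg (by omega)]
    · intro hc
      simp only [Finset.mem_range, not_lt] at hc
      omega
  · rw [Finset.sum_eq_zero]
    · rw [form_add] at hq
      by_cases hk : k + m = -2 - l.form μ - l.form ν - μ.form ν
      · rw [if_pos hk, binomCoeffInt_neg _ (by omega)]
        simp
      · rw [if_neg hk]
        simp
    · intro b _
      rw [if_neg (by omega)]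

theorem end_mul_sub (A B C : Module.End ℂ Fock) : A * (B - C) = A * B - A * C :=
  LinearMap.ext fun v => by
    simp only [Module.End.mul_apply, LinearMap.sub_apply, map_sub]

theorem end_sub_mul (A B C : Module.End ℂ Fock) : (A - B) * C = A * C - B * C :=
  LinearMap.ext fun v => by
    simp only [Module.End.mul_apply, LinearMap.sub_apply]

theorem end_smul_sub (r : ℂ) (A B : Module.End ℂ Fock) : r • (A - B) = r • A - r • B :=
  LinearMap.ext fun v => by
    simp only [LinearMap.smul_apply, LinearMap.sub_apply, smul_sub]

theorem eq_zero_of_commutators_range {ι : Type*} (A : ι → Module.End ℂ Fock)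
    (hb : ∀ i g (p : ℤ), p ≠ 0 →
      boson g p * A i - A i * boson g p ∈ Submodule.span ℂ (Set.range A))
    (hf : ∀ i g (p : ℤ), fermion g p * A i = A i * fermion g p)
    (hv : ∀ i ν ρ, vacuumCoeff ρ (A i (ket ν 0 ∅)) = 0) (i : ι) : A i = 0 := by
  refine eq_zero_of_commutators (Submodule.span ℂ (Set.range A)) ?_ ?_ ?_
    (Submodule.subset_span ⟨i, rfl⟩)
  · intro B hB g p hp
    induction hB using Submodule.span_induction with
    | mem B hB =>
      obtain ⟨i, rfl⟩ := hB
      exact hb i g p hp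
    | zero =>
      rw [mul_zero, zero_mul]
      rw [show (0 - 0 : Module.End ℂ Fock) = 0 from LinearMap.ext fun v => sub_self _]
      exact zero_mem _
    | add B C _ _ ihB ihC =>
      have e : boson g p * (B + C) - (B + C) * boson g p
          = (boson g p * B - B * boson g p) + (boson g p * C - C * boson g p) := by
        rw [mul_add, add_mul]
        abel
      rw [e]
      exact add_mem ihB ihC
    | smul r B _ ih =>
      rw [mul_smul_comm, smul_mul_assoc, ← end_smul_sub]
      exact Submodule.smul_mem _ r ih
  · intro B hB g p
    induction hB using Submodule.span_induction with
    | mem B hB =>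
      obtain ⟨i, rfl⟩ := hB
      exact hf i g p
    | zero => simp
    | add B C _ _ ihB ihC => rw [mul_add, add_mul, ihB, ihC]
    | smul r B _ ih => rw [mul_smul_comm, smul_mul_assoc, ih]
  · intro B hB ν ρ
    change vacuumCoeff ρ (B (ket ν 0 ∅)) = 0
    induction hB using Submodule.span_induction with
    | mem B hB =>
      obtain ⟨i, rfl⟩ := hB
      exact hv i ν ρ
    | zero => simp
    | add B C _ _ ihB ihC => rw [LinearMap.add_apply, map_add, ihB, ihC, add_zero]
    | smul r B _ ih => rw [LinearMap.smul_apply, map_smul, ih, smul_zero]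

/-- In coefficients, `(z - w)^N (z - w)^r = (z - w)^(r+N)` for the expansion in `|z| > |w|`. -/
theorem diffShift_pow_binomCoeffInt (N : ℕ) (r C s k m : ℤ) :
    (diffShift ^ N) (fun k m : ℤ => if k + m = C then binomCoeffInt r (-m - s) else 0) k m
      = if k + m = C - N then binomCoeffInt (r + N) (-m - s) else 0 := by
  induction N generalizing k m with
  | zero => simp
  | succ N ih =>
    rw [diffShift_pow_succ_apply, ih, ih]
    by_cases h : k + m = C - (N + 1 : ℕ)
    · push_cast at h
      rw [if_pos (by omega), if_pos (by omega), if_pos (by push_cast; omega),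
        show r + ((N + 1 : ℕ) : ℤ) = r + N + 1 by push_cast; ring, binomCoeffInt_succ]
      congr 2
      ring
    · push_cast at h
      rw [if_neg (by omega), if_neg (by omega), if_neg (by push_cast; omega), sub_zero]

/-- Multiplying by `(z - w)^N` with `N = |(l,μ)|` makes the exponent `(l,μ) + N` nonnegative, so
both orderings have the same polynomial as vacuum coefficient. The passage from coefficients to
operators is `eq_zero_of_commutators_range`. -/
theorem mutLocal_vertexOp_vertexOp (l μ : Sector) : MutLocal 1 (vertexOp l) (vertexOp μ) := by
  let comm : ℤ → ℤ → Module.End ℂ Fock := fun k m =>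
    vertexOp l k * vertexOp μ m - vertexOp μ m * vertexOp l k
  let N := (l.form μ).natAbs
  -- All pairs of modes are treated at once, because commutators with bosons shift the modes within
  -- this family.
  suffices h : ∀ km : ℤ × ℤ, (diffShift ^ N) comm km.1 km.2 = 0 by
    refine ⟨N, fun v => ?_⟩
    funext k m
    have e : superComm 1 (vertexOp l) (vertexOp μ) v
        = fun k m => (LinearMap.applyₗ v : Module.End ℂ Fock →ₗ[ℂ] Fock) (comm k m) := by
      funext k m
      simp [superComm, comm]
    have e₂ := diffShift_pow_comp (LinearMap.applyₗ v : Module.End ℂ Fock →ₗ[ℂ] Fock) N comm k m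
    rw [h (k, m), map_zero] at e₂
    rw [e]
    exact e₂
  have hbos : ∀ n g p k m, boson g p * (diffShift ^ n) comm k m
      - (diffShift ^ n) comm k m * boson g p
      = l.coord g.dual • (diffShift ^ n) comm (k + p) m
        + μ.coord g.dual • (diffShift ^ n) comm k (m + p) := by
    intro n g p
    induction n with
    | zero =>
      intro k m
      have e₁ := boson_mul_vertexOp g l p k
      have e₂ := boson_mul_vertexOp g μ p m
      simp only [pow_zero, Module.End.one_apply, comm]
      rw [end_mul_sub, ← mul_assoc, ← mul_assoc, e₁, e₂, add_mul, add_mul, mul_assoc,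
        mul_assoc _ (boson g p), e₁,
        e₂, mul_add, mul_add, end_sub_mul, smul_mul_assoc, smul_mul_assoc, mul_smul_comm,
        mul_smul_comm, end_smul_sub, end_smul_sub, mul_assoc, mul_assoc]
      abel
    | succ n ih =>
      intro k m
      have e₁ := ih (k + 1) m
      have e₂ := ih k (m + 1)
      simp only [diffShift_pow_succ_apply]
      rw [add_right_comm k 1 p] at e₁
      rw [add_right_comm m 1 p] at e₂
      have e₃ := congrArg₂ (· - ·) e₁ e₂
      rw [end_mul_sub, end_sub_mul, end_smul_sub, end_smul_sub]
      refine Eq.trans ?_ (e₃.trans ?_) <;> abel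
  have hferm : ∀ n g p k m, fermion g p * (diffShift ^ n) comm k m
      = (diffShift ^ n) comm k m * fermion g p := by
    intro n g p
    induction n with
    | zero =>
      intro k m
      simp only [pow_zero, Module.End.one_apply, comm]
      rw [end_mul_sub, end_sub_mul, ← mul_assoc, ← mul_assoc, fermion_mul_vertexOp,
        fermion_mul_vertexOp,
        mul_assoc, mul_assoc, fermion_mul_vertexOp, fermion_mul_vertexOp, mul_assoc, mul_assoc]
    | succ n ih =>
      intro k m
      simp only [diffShift_pow_succ_apply]
      rw [end_mul_sub, end_sub_mul, ih, ih]
  refine eq_zero_of_commutators_range (fun km : ℤ × ℤ => (diffShift ^ N) comm km.1 km.2) ?_ ?_ ?_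
  · intro km g p _
    rw [hbos]
    exact add_mem (Submodule.smul_mem _ _ (Submodule.subset_span ⟨(km.1 + p, km.2), rfl⟩))
      (Submodule.smul_mem _ _ (Submodule.subset_span ⟨(km.1, km.2 + p), rfl⟩))
  · exact fun km g p => hferm N g p km.1 km.2
  · rintro ⟨k, m⟩ ν ρ
    set r := l.form μ with hr
    have hr' : μ.form l = r := form_comm _ _
    obtain ⟨R, hR⟩ : ∃ R : ℕ, r + N = R := ⟨(r + N).toNat, by omega⟩
    have e := diffShift_pow_comp
      (vacuumCoeff ρ ∘ₗ (LinearMap.applyₗ (ket ν 0 ∅) : Module.End ℂ Fock →ₗ[ℂ] Fock)) N comm k m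
    let C := -2 - r - l.form ν - μ.form ν
    let x := vacuumCoeff ρ (ket (l + μ + ν) 0 ∅)
    let z₁ := l.cocycle μ * l.cocycle ν * μ.cocycle ν * x
    let z₂ := μ.cocycle l * μ.cocycle ν * l.cocycle ν * x
    let h₁ : ℤ → ℤ → ℂ := fun k m =>
      if k + m = C then binomCoeffInt r (-m - (1 + μ.form ν)) else 0
    let h₂ : ℤ → ℤ → ℂ := fun k m =>
      if k + m = C then binomCoeffInt r (-m - (1 + l.form ν)) else 0
    have e' : (fun k m : ℤ => (vacuumCoeff ρ ∘ₗ
        (LinearMap.applyₗ (ket ν 0 ∅) : Module.End ℂ Fock →ₗ[ℂ] Fock)) (comm k m))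
        = z₁ • h₁ - z₂ • (fun k m => h₂ m k) := by
      funext k m
      simp only [comm, LinearMap.comp_apply, LinearMap.applyₗ_apply_apply, LinearMap.sub_apply,
        Module.End.mul_apply, map_sub, vacuumCoeff_vertexOp_vertexOp, Pi.sub_apply, Pi.smul_apply,
        smul_eq_mul, h₁, h₂, z₁, z₂, x, hr', ← hr, C, add_comm μ l]
      congr 3
      rw [sub_right_comm (-2 - r)]
    rw [LinearMap.comp_apply, LinearMap.applyₗ_apply_apply] at e
    change vacuumCoeff ρ ((diffShift ^ N) comm k m (ket ν 0 ∅)) = 0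
    rw [← e, e', map_sub, map_smul, map_smul]
    simp only [Pi.sub_apply, Pi.smul_apply]
    rw [diffShift_pow_swap N h₂]
    simp only [h₁, h₂]
    rw [diffShift_pow_binomCoeffInt, diffShift_pow_binomCoeffInt, hR]
    by_cases hk : k + m = C - N
    · rw [if_pos hk, if_pos (by omega)]
      have eq : -k - (1 + l.form ν) = R - (-m - (1 + μ.form ν)) := by
        simp only [C] at hk
        omega
      rw [eq, binomCoeffInt_symm]
      -- `(-1)^N` comes from swapping the variables and `(-1)^R` from the palindromic symmetry;
      -- their product `(-1)^(l,μ)` is the ratio of the cocycles.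
      have hz : z₁ = z₂ * ((-1) ^ N * (-1) ^ R) := by
        have e₁ : (-1 : ℂ) ^ N * (-1) ^ R = (-1) ^ r := by
          rw [← zpow_natCast (-1 : ℂ) R, ← hR, zpow_add₀ (by norm_num), zpow_natCast, mul_left_comm,
            neg_one_pow_mul_self, mul_one]
        have e₂ := cocycle_mul_cocycle l μ
        have e₃ := cocycle_mul_self μ l
        simp only [z₁, z₂]
        rw [e₁, hr, ← e₂]
        linear_combination (-l.cocycle μ * l.cocycle ν * μ.cocycle ν * x) * e₃
      rw [hz]
      simp only [smul_eq_mul]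
      ring
    · rw [if_neg hk, if_neg (by omega)]
      simp

/-! ## The translation operator -/

/-- The `k`-th term of the translation operator. -/
def translationTerm (k : ℕ) : Module.End ℂ Fock :=
  ∑ g : Gen, (boson g (-(k : ℤ) - 1) * boson g.dual k
    + ((k : ℂ) + 1) • (fermion g (-(k : ℤ) - 2) * fermion g.dual k))

/-- The translation operator. -/
def translationOp : Module.End ℂ Fock := ofBasis fun u =>
  ∑ᶠ k : ℕ, translationTerm k (ket u.1 u.2.1 u.2.2)

theorem translationTerm_eventually_zero (v : Fock) :
    ∃ K : ℕ, ∀ k, K ≤ k → translationTerm k v = 0 := by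
  choose B hB using fun g => isTruncated_boson g v
  choose C hC using fun g => isTruncated_fermion g v
  obtain ⟨N, hN⟩ := Finset.exists_le (Finset.univ.image fun g => max (B g) (C g))
  refine ⟨N.toNat, fun k hk => ?_⟩
  rw [translationTerm, LinearMap.sum_apply]
  refine Finset.sum_eq_zero fun g _ => ?_
  have h := hN _ (Finset.mem_image_of_mem _ (Finset.mem_univ g.dual))
  rw [LinearMap.add_apply, LinearMap.smul_apply, Module.End.mul_apply, Module.End.mul_apply,
    hB _ _ (by omega), hC _ _ (by omega), map_zero, map_zero, smul_zero, add_zero]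

theorem translationOp_apply (v : Fock) : ∃ K₀ : ℕ, ∀ K, K₀ ≤ K →
    translationOp v = ∑ k ∈ Finset.range K, translationTerm k v := by
  let W : Submodule ℂ Fock :=
    { carrier := {v | ∃ K₀ : ℕ, ∀ K, K₀ ≤ K →
        translationOp v = ∑ k ∈ Finset.range K, translationTerm k v}
      zero_mem' := ⟨0, fun K _ => by simp⟩
      add_mem' := by
        rintro v w ⟨K₁, h₁⟩ ⟨K₂, h₂⟩
        refine ⟨max K₁ K₂, fun K hK => ?_⟩
        rw [map_add, h₁ K (by omega), h₂ K (by omega), ← Finset.sum_add_distrib]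
        simp only [map_add]
      smul_mem' := by
        rintro r v ⟨K₁, h₁⟩
        refine ⟨K₁, fun K hK => ?_⟩
        rw [map_smul, h₁ K hK, Finset.smul_sum]
        simp only [map_smul] }
  have h : W = ⊤ := eq_top_of_ket_mem W fun μ f S => by
    obtain ⟨K₀, hK₀⟩ := translationTerm_eventually_zero (ket μ f S)
    refine ⟨K₀, fun K hK => ?_⟩
    rw [translationOp, ofBasis_ket]
    exact finsum_nat_eq_sum_range fun k hk => hK₀ k (hK.trans hk)
  exact show v ∈ W from h ▸ Submodule.mem_top

/-- The term of index `k` has a commutator only with the modes `n = k + 1`, contracted with its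
annihilator side index on the creation operator, and `n = -k`, contracted with its annihilation
operator. Summed over `k` this is `-n h_(n-1)`. -/
theorem translationTerm_mul_boson (h : Gen) (n : ℤ) (k : ℕ) :
    translationTerm k * boson h n + (if n = k + 1 then (n : ℂ) else 0) • boson h (n - 1)
      = boson h n * translationTerm k + (if n = -k then -(n : ℂ) else 0) • boson h (n - 1) := by
  have hterm : ∀ g ∈ (Finset.univ : Finset Gen),
      (boson g (-(k : ℤ) - 1) * boson g.dual k
        + ((k : ℂ) + 1) • (fermion g (-(k : ℤ) - 2) * fermion g.dual k)) * boson h n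
        + (if g = h.dual then (if n = k + 1 then (n : ℂ) else 0) • boson h (n - 1) else 0)
      = boson h n * (boson g (-(k : ℤ) - 1) * boson g.dual k
        + ((k : ℂ) + 1) • (fermion g (-(k : ℤ) - 2) * fermion g.dual k))
        + (if g = h then (if n = -k then -(n : ℂ) else 0) • boson h (n - 1) else 0) := by
    intro g _
    have e₁ := boson_mul_boson g.dual h k n
    have e₂ := boson_mul_boson h g n (-(k : ℤ) - 1)
    rw [Gen.dual_dual] at e₁
    have a₁ : (if g = h then (if n = -k then -(n : ℂ) else 0) • boson h (n - 1) else 0)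
        = (if (k : ℤ) + n = 0 ∧ h = g then ((k : ℤ) : ℂ) else 0) • boson g (-(k : ℤ) - 1) := by
      by_cases hc : (k : ℤ) + n = 0 ∧ h = g
      · obtain ⟨hn, rfl⟩ := hc
        obtain rfl : n = -k := by omega
        simp
      · rw [if_neg hc, zero_smul]
        by_cases hg : g = h
        · rw [if_pos hg, if_neg (fun hn => hc ⟨by omega, hg.symm⟩), zero_smul]
        · rw [if_neg hg]
    have a₂ : (if g = h.dual then (if n = k + 1 then (n : ℂ) else 0) • boson h (n - 1) else 0)
        = (if n + (-(k : ℤ) - 1) = 0 ∧ g = h.dual then (n : ℂ) else 0) • boson g.dual k := by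
      by_cases hc : n + (-(k : ℤ) - 1) = 0 ∧ g = h.dual
      · obtain ⟨hn, rfl⟩ := hc
        obtain rfl : n = k + 1 := by omega
        simp
      · rw [if_neg hc, zero_smul]
        by_cases hg : g = h.dual
        · rw [if_pos hg, if_neg (fun hn => hc ⟨by omega, hg⟩), zero_smul]
        · rw [if_neg hg]
    rw [a₁, a₂, add_mul, mul_add, smul_mul_assoc, mul_smul_comm, mul_assoc, mul_assoc,
      ← boson_mul_fermion, ← mul_assoc (fermion g _), ← boson_mul_fermion, e₁,
      ← mul_assoc (boson h n), e₂, add_mul,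
      mul_add, ← mul_assoc, mul_smul_comm, mul_one, smul_mul_assoc, one_mul, mul_assoc,
      mul_assoc (boson h n)]
    abel
  have hs := Finset.sum_congr rfl hterm
  rw [Finset.sum_add_distrib, Finset.sum_add_distrib, ← Finset.sum_mul, ← Finset.mul_sum,
    Finset.sum_ite_eq', Finset.sum_ite_eq', if_pos (Finset.mem_univ _),
    if_pos (Finset.mem_univ _)] at hs
  exact hs

theorem translationTerm_mul_fermion (h : Gen) (n : ℤ) (k : ℕ) :
    translationTerm k * fermion h n + (if n = k + 1 then (n : ℂ) else 0) • fermion h (n - 1)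
      = fermion h n * translationTerm k
        + (if n = -k - 1 then -(n : ℂ) else 0) • fermion h (n - 1) := by
  have hterm : ∀ g ∈ (Finset.univ : Finset Gen),
      (boson g (-(k : ℤ) - 1) * boson g.dual k
        + ((k : ℂ) + 1) • (fermion g (-(k : ℤ) - 2) * fermion g.dual k)) * fermion h n
        + (if g = h.dual then (if n = k + 1 then (n : ℂ) else 0) • fermion h (n - 1) else 0)
      = fermion h n * (boson g (-(k : ℤ) - 1) * boson g.dual k
        + ((k : ℂ) + 1) • (fermion g (-(k : ℤ) - 2) * fermion g.dual k))
        + (if g = h then (if n = -k - 1 then -(n : ℂ) else 0) • fermion h (n - 1) else 0) := by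
    intro g _
    have e₁ := fermion_mul_fermion g.dual h k n
    have e₂ := fermion_mul_fermion g h (-(k : ℤ) - 2) n
    rw [Gen.dual_dual] at e₁
    have a₁ : (if g = h then (if n = -k - 1 then -(n : ℂ) else 0) • fermion h (n - 1) else 0)
        = ((k : ℂ) + 1) • (if (k : ℤ) + n = -1 ∧ h = g then (1 : ℂ) else 0) •
          fermion g (-(k : ℤ) - 2) := by
      by_cases hc : (k : ℤ) + n = -1 ∧ h = g
      · obtain ⟨hn, rfl⟩ := hc
        obtain rfl : n = -k - 1 := by omega
        simp only [and_true, if_true]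
        rw [if_pos (by ring), one_smul, show -(k : ℤ) - 1 - 1 = -k - 2 by ring]
        congr 1
        push_cast
        ring
      · rw [if_neg hc, zero_smul, smul_zero]
        by_cases hg : g = h
        · rw [if_pos hg, if_neg (fun hn => hc ⟨by omega, hg.symm⟩), zero_smul]
        · rw [if_neg hg]
    have a₂ : (if g = h.dual then (if n = k + 1 then (n : ℂ) else 0) • fermion h (n - 1) else 0)
        = ((k : ℂ) + 1) • (if -(k : ℤ) - 2 + n = -1 ∧ h = g.dual then (1 : ℂ) else 0) •
          fermion g.dual k := by
      have hiff : h = g.dual ↔ g = h.dual := Gen.eq_dual_comm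
      simp only [hiff]
      by_cases hc : -(k : ℤ) - 2 + n = -1 ∧ g = h.dual
      · obtain ⟨hn, rfl⟩ := hc
        obtain rfl : n = k + 1 := by omega
        rw [if_pos rfl, if_pos rfl, if_pos ⟨by ring, rfl⟩, one_smul, Gen.dual_dual,
          add_sub_cancel_right]
        push_cast
        rfl
      · rw [if_neg hc, zero_smul, smul_zero]
        by_cases hg : g = h.dual
        · rw [if_pos hg, if_neg (fun hn => hc ⟨by omega, hg⟩), zero_smul]
        · rw [if_neg hg]
    have e₃ : fermion g (-(k : ℤ) - 2) * fermion g.dual k * fermion h n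
        + (if -(k : ℤ) - 2 + n = -1 ∧ h = g.dual then (1 : ℂ) else 0) • fermion g.dual k
        = fermion h n * (fermion g (-(k : ℤ) - 2) * fermion g.dual k)
        + (if (k : ℤ) + n = -1 ∧ h = g then (1 : ℂ) else 0) • fermion g (-(k : ℤ) - 2) := by
      refine LinearMap.ext fun v => ?_
      have f₁ := congrArg (fermion g (-(k : ℤ) - 2)) (LinearMap.congr_fun e₁ v)
      have f₂ := LinearMap.congr_fun e₂ (fermion g.dual k v)
      simp only [Module.End.mul_apply, LinearMap.add_apply, LinearMap.neg_apply,
        LinearMap.smul_apply, Module.End.one_apply, map_add, map_neg, map_smul] at f₁ f₂ ⊢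
      rw [f₁, f₂]
      abel
    rw [a₁, a₂, add_mul, mul_add, smul_mul_assoc, mul_smul_comm, mul_assoc, boson_mul_fermion,
      ← mul_assoc (boson g _), boson_mul_fermion, mul_assoc, add_assoc, add_assoc, ← smul_add,
      ← smul_add, e₃]
  have hs := Finset.sum_congr rfl hterm
  rw [Finset.sum_add_distrib, Finset.sum_add_distrib, ← Finset.sum_mul, ← Finset.mul_sum,
    Finset.sum_ite_eq', Finset.sum_ite_eq', if_pos (Finset.mem_univ _),
    if_pos (Finset.mem_univ _)] at hs
  exact hs

/-- For `n ≠ 0` exactly one `k` contributes, namely `n - 1` or `-n - d`; for `n = 0` the coefficient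
is zero. The offset `d` is `0` for bosons and `1` for fermions. -/
theorem isCovariant_of_translationTerm {A : ℤ → Module.End ℂ Fock} (d : ℤ) (hd : 0 ≤ d ∧ d ≤ 1)
    (h : ∀ (n : ℤ) (k : ℕ),
      translationTerm k * A n + (if n = k + 1 then (n : ℂ) else 0) • A (n - 1)
        = A n * translationTerm k + (if n = -k - d then -(n : ℂ) else 0) • A (n - 1)) :
    IsCovariant translationOp A := by
  intro n v
  obtain ⟨K₁, h₁⟩ := translationOp_apply v
  obtain ⟨K₂, h₂⟩ := translationOp_apply (A n v)
  let K := max (max K₁ K₂) (n.natAbs + 1)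
  have hs := Finset.sum_congr rfl fun (k : ℕ) (_ : k ∈ Finset.range K) =>
    LinearMap.congr_fun (h n k) v
  simp only [LinearMap.add_apply, LinearMap.smul_apply, Module.End.mul_apply] at hs
  rw [Finset.sum_add_distrib, Finset.sum_add_distrib, ← map_sum, ← h₁ K (by omega),
    ← h₂ K (by omega), ← Finset.sum_smul, ← Finset.sum_smul] at hs
  have s₁ : ∑ k ∈ Finset.range K, (if n = (k : ℤ) + 1 then (n : ℂ) else 0)
      = if 1 ≤ n then (n : ℂ) else 0 := by
    split_ifs with hn
    · rw [Finset.sum_eq_single (n - 1).toNat, if_pos (by omega)]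
      · intro k _ hk
        rw [if_neg (by omega)]
      · intro hk
        simp only [Finset.mem_range, K] at hk
        omega
    · exact Finset.sum_eq_zero fun k _ => if_neg (by omega)
  have s₂ : ∑ k ∈ Finset.range K, (if n = -(k : ℤ) - d then -(n : ℂ) else 0)
      = if 1 ≤ n then 0 else -(n : ℂ) := by
    split_ifs with hn
    · exact Finset.sum_eq_zero fun k _ => if_neg (by omega)
    · rcases eq_or_ne n 0 with rfl | h0
      · simp
      rw [Finset.sum_eq_single (-n - d).toNat, if_pos (by omega)]
      · intro k _ hk
        rw [if_neg (by omega)]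
      · intro hk
        simp only [Finset.mem_range, K] at hk
        omega
  rw [s₁, s₂] at hs
  split_ifs at hs with hn
  · rw [zero_smul, add_zero] at hs
    rw [← hs, neg_smul]
    abel
  · rw [zero_smul, add_zero] at hs
    rw [hs]
    abel

theorem isCovariant_boson (h : Gen) : IsCovariant translationOp (boson h) :=
  isCovariant_of_translationTerm 0 (by norm_num) fun n k => by
    simpa using translationTerm_mul_boson h n k

theorem isCovariant_fermion (h : Gen) : IsCovariant translationOp (fermion h) :=
  isCovariant_of_translationTerm 1 (by norm_num) (translationTerm_mul_fermion h)

/-- Only the bosonic summands with `k = 0` survive: their zero modes give the coordinates of `ν`. -/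
theorem translationOp_vacuum (ν : Sector) :
    translationOp (ket ν 0 ∅) = latticeBoson ν (-1) (ket ν 0 ∅) := by
  obtain ⟨K, hK⟩ := translationOp_apply (ket ν 0 ∅)
  rw [hK (K + 1) (by omega), Finset.sum_range_succ', Finset.sum_eq_zero, zero_add, translationTerm,
    latticeBoson, LinearMap.sum_apply, LinearMap.sum_apply]
  · refine Finset.sum_congr rfl fun g _ => ?_
    rw [LinearMap.add_apply, LinearMap.smul_apply, LinearMap.smul_apply, Module.End.mul_apply,
      Module.End.mul_apply, fermion_nonneg_vacuum _ _ (by simp), Nat.cast_zero, boson_zero_ket,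
      Gen.dual_dual, map_smul, map_zero, smul_zero, add_zero]
    rfl
  · intro k _
    rw [translationTerm, LinearMap.sum_apply]
    refine Finset.sum_eq_zero fun g _ => ?_
    rw [LinearMap.add_apply, LinearMap.smul_apply, Module.End.mul_apply, Module.End.mul_apply,
      fermion_nonneg_vacuum _ _ (by positivity), boson_pos_vacuum _ _ (by positivity), map_zero,
      map_zero, smul_zero, add_zero]

theorem coord_zero (g : Gen) : Sector.coord 0 g = 0 := by
  simp only [Sector.coord]
  rcases ofLex g with i | i <;> simp

theorem translationOp_vacuum_zero : translationOp (ket 0 0 ∅) = 0 := by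
  rw [translationOp_vacuum, latticeBoson, LinearMap.sum_apply]
  exact Finset.sum_eq_zero fun g _ => by rw [coord_zero, zero_smul, LinearMap.zero_apply]

theorem vacuumCoeff_translationOp (ρ : Sector) (v : Fock) :
    vacuumCoeff ρ (translationOp v) = 0 := by
  obtain ⟨K, hK⟩ := translationOp_apply v
  rw [hK K le_rfl, map_sum]
  refine Finset.sum_eq_zero fun k _ => ?_
  rw [translationTerm, LinearMap.sum_apply, map_sum]
  refine Finset.sum_eq_zero fun g _ => ?_
  rw [LinearMap.add_apply, LinearMap.smul_apply, Module.End.mul_apply, Module.End.mul_apply,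
    map_add, map_smul, vacuumCoeff_boson_neg _ _ (by omega),
    vacuumCoeff_fermion_neg _ _ (by omega), smul_zero, add_zero]

theorem latticeBoson_mul_vertexOp (l μ : Sector) (p n : ℤ) :
    latticeBoson l p * vertexOp μ n
      = vertexOp μ n * latticeBoson l p + (l.form μ : ℂ) • vertexOp μ (n + p) := by
  rw [latticeBoson, Finset.sum_mul, Finset.mul_sum, ← sum_coord_mul_coord, Finset.sum_smul,
    ← Finset.sum_add_distrib]
  refine Finset.sum_congr rfl fun g _ => ?_
  rw [smul_mul_assoc, boson_mul_vertexOp, smul_add, mul_smul_comm, smul_smul]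

theorem vacuumCoeff_vertexOp (ρ l ν : Sector) (n : ℤ) :
    vacuumCoeff ρ (vertexOp l n (ket ν 0 ∅))
      = if n = -1 - l.form ν then l.cocycle ν * vacuumCoeff ρ (ket (l + ν) 0 ∅) else 0 := by
  rw [vertexOp_vacuum, map_smul, vacuumCoeff_creationExp]
  by_cases h : n = -1 - l.form ν
  · rw [if_pos h, if_pos (by omega), smul_eq_mul]
  · rw [if_neg h, if_neg (by omega), smul_zero]

/-- The defect of covariance has the same commutators with the free fields as the vertex operator
itself, so its vanishing reduces to vacuum coefficients. -/
theorem isCovariant_vertexOp (l : Sector) : IsCovariant translationOp (vertexOp l) := by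
  let A : ℤ → Module.End ℂ Fock := fun n =>
    translationOp * vertexOp l n - vertexOp l n * translationOp + (n : ℂ) • vertexOp l (n - 1)
  have key : ∀ n, A n = 0 := by
    refine eq_zero_of_commutators_range A ?_ ?_ ?_
    · intro n g p _
      have e : boson g p * A n - A n * boson g p = l.coord g.dual • A (n + p) := by
        refine LinearMap.ext fun v => ?_
        have c₁ := fun v => isCovariant_boson g p v
        have c₂ := fun m v => LinearMap.congr_fun (boson_mul_vertexOp g l p m) v
        simp only [Module.End.mul_apply, LinearMap.add_apply, LinearMap.smul_apply] at c₂
        simp only [A, Module.End.mul_apply, LinearMap.add_apply, LinearMap.smul_apply,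
          LinearMap.sub_apply, map_add, map_sub, map_smul]
        have d₁ := c₁ (vertexOp l n v)
        have d₂ := congrArg (vertexOp l n) (c₁ v)
        have d₃ := congrArg translationOp (c₂ n v)
        have d₄ := c₂ n (translationOp v)
        have d₅ := c₂ (n - 1) v
        have d₆ := LinearMap.congr_fun (boson_mul_vertexOp g l (p - 1) n) v
        simp only [Module.End.mul_apply, LinearMap.add_apply, LinearMap.smul_apply] at d₆
        rw [map_sub, map_smul] at d₂
        rw [map_add, map_smul] at d₃
        rw [sub_eq_iff_eq_add] at d₁ d₂
        rw [d₁, d₆] at d₃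
        rw [d₄, d₅, d₂]
        rw [show n - 1 + p = n + p - 1 by ring]
        rw [show n + (p - 1) = n + p - 1 by ring] at d₃
        push_cast
        rw [← sub_eq_zero] at d₃ ⊢
        rw [← d₃]
        module
      rw [e]
      exact Submodule.smul_mem _ _ (Submodule.subset_span ⟨n + p, rfl⟩)
    · intro n g p
      refine LinearMap.ext fun v => ?_
      have c₁ := fun v => isCovariant_fermion g p v
      have c₂ := fun q m v => LinearMap.congr_fun (fermion_mul_vertexOp g l q m) v
      simp only [Module.End.mul_apply] at c₂
      simp only [A, Module.End.mul_apply, LinearMap.add_apply, LinearMap.smul_apply,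
        LinearMap.sub_apply, map_add, map_sub, map_smul]
      have d₁ := c₁ (vertexOp l n v)
      have d₂ := congrArg (vertexOp l n) (c₁ v)
      have d₃ := congrArg translationOp (c₂ p n v)
      rw [map_sub, map_smul] at d₂
      rw [c₂ p n (translationOp v), c₂ p (n - 1) v]
      rw [sub_eq_iff_eq_add] at d₁ d₂
      rw [d₁, c₂ (p - 1) n v] at d₃
      rw [d₂, ← d₃]
      module
    · intro n ν ρ
      simp only [A, Module.End.mul_apply, LinearMap.add_apply, LinearMap.smul_apply,
        LinearMap.sub_apply, map_add, map_sub, map_smul, vacuumCoeff_translationOp]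
      -- The functional kills the image of `T`, and `T |ν⟩ = ν_(-1) |ν⟩`. Moving `ν_(-1)` to the
      -- left through the vertex operator leaves `(ν,l)`, which cancels `n` at the only mode with a
      -- nonzero coefficient.
      have e := congrArg (vacuumCoeff ρ)
        (LinearMap.congr_fun (latticeBoson_mul_vertexOp ν l (-1) n) (ket ν 0 ∅))
      rw [Module.End.mul_apply, vacuumCoeff_latticeBoson_neg _ _ (by norm_num),
        LinearMap.add_apply, Module.End.mul_apply, map_add, LinearMap.smul_apply, map_smul] at e
      rw [translationOp_vacuum, zero_sub, eq_neg_iff_add_eq_zero.2 e.symm, neg_neg,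
        ← sub_eq_add_neg, vacuumCoeff_vertexOp, ← add_smul]
      split_ifs with hn
      · have h0 : ((ν.form l : ℤ) : ℂ) + (n : ℂ) = 0 := by
          rw [form_comm ν l]
          exact_mod_cast (by omega : l.form ν + n = 0)
        rw [h0, zero_smul]
      · rw [smul_zero]
  intro n v
  have h := LinearMap.congr_fun (key n) v
  simp only [A, Module.End.mul_apply, LinearMap.add_apply, LinearMap.smul_apply,
    LinearMap.sub_apply, LinearMap.zero_apply] at h
  rw [neg_smul]
  exact eq_neg_of_add_eq_zero_left h

/-! ## Normally ordered products -/

theorem normalOrdered_apply_eq_sum {k : ℕ} {x A : ℤ → Module.End ℂ Fock} (σ : ℂ)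
    (hx : IsTruncated x) (hA : IsTruncated A) (n : ℤ) (v : Fock) : ∃ J₀ : ℕ, ∀ J, J₀ ≤ J →
    normalOrdered k x σ A n v =
      (∑ j ∈ Finset.range J, ((k + j).choose k : ℂ) • x (-(k : ℤ) - 1 - j) (A (n + j) v))
        + (σ * (-1 : ℂ) ^ k) • ∑ j ∈ Finset.range J, ((k + j).choose k : ℂ) •
          A (n - k - 1 - j) (x j v) := by
  let W : Submodule ℂ Fock :=
    { carrier := {v | ∃ J₀ : ℕ, ∀ J, J₀ ≤ J → normalOrdered k x σ A n v =
        (∑ j ∈ Finset.range J, ((k + j).choose k : ℂ) • x (-(k : ℤ) - 1 - j) (A (n + j) v))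
          + (σ * (-1 : ℂ) ^ k) • ∑ j ∈ Finset.range J, ((k + j).choose k : ℂ) •
            A (n - k - 1 - j) (x j v)}
      zero_mem' := ⟨0, fun J _ => by simp⟩
      add_mem' := by
        rintro v w ⟨J₁, h₁⟩ ⟨J₂, h₂⟩
        refine ⟨max J₁ J₂, fun J hJ => ?_⟩
        rw [map_add, h₁ J (by omega), h₂ J (by omega)]
        simp only [map_add, smul_add, Finset.sum_add_distrib]
        abel
      smul_mem' := by
        rintro r v ⟨J₁, h₁⟩
        refine ⟨J₁, fun J hJ => ?_⟩
        rw [map_smul, h₁ J hJ, smul_add, smul_comm r (σ * _), Finset.smul_sum, Finset.smul_sum]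
        simp only [map_smul, smul_comm r] }
  have h : W = ⊤ := eq_top_of_ket_mem W fun μ f S => by
    obtain ⟨N₁, h₁⟩ := hA (ket μ f S)
    obtain ⟨N₂, h₂⟩ := hx (ket μ f S)
    refine ⟨max (N₁ - n).toNat N₂.toNat, fun J hJ => ?_⟩
    rw [normalOrdered, ofBasis_ket, finsum_nat_eq_sum_range (J := J),
      finsum_nat_eq_sum_range (J := J)]
    · intro j hj
      rw [h₂ j (by omega), map_zero, smul_zero]
    · intro j hj
      rw [h₁ (n + j) (by omega), map_zero, smul_zero]
  exact show v ∈ W from h ▸ Submodule.mem_top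

/-- The normally ordered product `:(1/k!) ∂^k x(z) A(z):` is the `(-k-1)`-st product of fields. -/
theorem isResProd_normalOrdered (k : ℕ) {x A : ℤ → Module.End ℂ Fock} (σ : ℂ)
    (hx : IsTruncated x) (hA : IsTruncated A) :
    IsResProd (-(k : ℤ) - 1) σ x A (normalOrdered k x σ A) := by
  intro n v
  obtain ⟨J₀, h₀⟩ := normalOrdered_apply_eq_sum (k := k) σ hx hA n v
  obtain ⟨N₁, h₁⟩ := hA v
  obtain ⟨N₂, h₂⟩ := hx v
  let J := max J₀ (max (N₁ - n).toNat N₂.toNat)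
  -- The plus sign of `normalOrdered` and the minus sign of `IsResProd` agree because `(-1)^(-k-1) =
  -- -(-1)^k`.
  have hs : σ * (-1 : ℂ) ^ k = -(σ * (-1 : ℂ) ^ (-(k : ℤ) - 1)) := by
    rw [zpow_sub₀ (by norm_num), zpow_neg, zpow_natCast, zpow_one, ← inv_pow, inv_neg_one]
    ring
  rw [h₀ J (by omega), finsum_nat_eq_sum_range (J := J), finsum_nat_eq_sum_range (J := J), hs,
    neg_smul, ← sub_eq_add_neg]
  · have e (j : ℕ) : -(k : ℤ) - 1 + n - j = n - k - 1 - j := by ring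
    simp only [binomCoeff_neg, e]
  · intro j hj
    rw [h₂ j (by omega), map_zero, smul_zero]
  · intro j hj
    rw [h₁ (n + j) (by omega), map_zero, smul_zero]

theorem ket_mem_parity (μ : Sector) (f : Mode →₀ ℕ) (S : Finset Mode) :
    ket μ f S ∈ fock.parity S.card :=
  Finsupp.single_mem_supported ℂ _ rfl

theorem mem_parity_induction {p : ZMod 2} {P : Fock → Prop} (h0 : P 0)
    (hadd : ∀ a b, P a → P b → P (a + b)) (hsmul : ∀ (r : ℂ) a, P a → P (r • a))
    (hket : ∀ μ f (S : Finset Mode), (S.card : ZMod 2) = p → P (ket μ f S)) {a : Fock}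
    (ha : a ∈ fock.parity p) : P a := by
  have ha' : a ∈ Submodule.span ℂ
      ((fun u => Finsupp.single u (1 : ℂ)) '' {u : Label | (u.2.2.card : ZMod 2) = p}) := by
    rwa [← Finsupp.supported_eq_span_single]
  clear ha
  induction ha' using Submodule.span_induction with
  | mem v hv =>
    obtain ⟨⟨μ, f, S⟩, hS, rfl⟩ := hv
    exact hket μ f S hS
  | zero => exact h0
  | add v w _ _ hv hw => exact hadd v w hv hw
  | smul r v _ hv => exact hsmul r v hv

theorem map_mem_parity {A : Module.End ℂ Fock} {d : ZMod 2}
    (h : ∀ μ f S, A (ket μ f S) ∈ fock.parity (S.card + d)) {p : ZMod 2} {v : Fock}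
    (hv : v ∈ fock.parity p) : A v ∈ fock.parity (p + d) := by
  refine mem_parity_induction (P := fun v => A v ∈ fock.parity (p + d)) ?_ ?_ ?_ ?_ hv
  · rw [map_zero]
    exact zero_mem _
  · intro v w hv hw
    rw [map_add]
    exact add_mem hv hw
  · intro r v hv
    rw [map_smul]
    exact Submodule.smul_mem _ r hv
  · rintro μ f S rfl
    exact h μ f S

theorem boson_mem_parity (g : Gen) (n : ℤ) {p : ZMod 2} {v : Fock} (hv : v ∈ fock.parity p) :
    boson g n v ∈ fock.parity p := by
  rw [← add_zero p]
  refine map_mem_parity (fun μ f S => ?_) hv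
  rw [add_zero]
  rcases int_cases n with ⟨k, rfl⟩ | rfl | ⟨k, rfl⟩
  · rw [boson_neg_ket]; exact ket_mem_parity _ _ _
  · rw [boson_zero_ket]; exact Submodule.smul_mem _ _ (ket_mem_parity _ _ _)
  · rw [boson_pos_ket]; exact Submodule.smul_mem _ _ (ket_mem_parity _ _ _)

theorem fermion_mem_parity (g : Gen) (n : ℤ) {p : ZMod 2} {v : Fock} (hv : v ∈ fock.parity p) :
    fermion g n v ∈ fock.parity (p + 1) := by
  refine map_mem_parity (fun μ f S => ?_) hv
  rcases int_cases' n with ⟨k, rfl⟩ | ⟨k, rfl⟩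
  · rw [fermion_neg_ket]
    split_ifs with h
    · exact zero_mem _
    · refine Submodule.smul_mem _ _ ?_
      have e := ket_mem_parity μ f (insert (mode g k) S)
      rwa [Finset.card_insert_of_notMem h, Nat.cast_add, Nat.cast_one] at e
  · rw [fermion_natCast_ket]
    split_ifs with h
    · refine Submodule.smul_mem _ _ ?_
      have e := ket_mem_parity μ f (S.erase (mode g.dual k))
      rw [← Finset.card_erase_add_one h, Nat.cast_add, Nat.cast_one, add_assoc,
        show (1 : ZMod 2) + 1 = 0 from rfl, add_zero]
      exact e
    · exact zero_mem _

theorem vertexOp_mem_parity (l : Sector) (n : ℤ) {p : ZMod 2} {v : Fock}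
    (hv : v ∈ fock.parity p) : vertexOp l n v ∈ fock.parity p := by
  rw [← add_zero p]
  refine map_mem_parity (fun μ f S => ?_) hv
  rw [add_zero]
  obtain ⟨B, h⟩ := vertexOp_apply l μ (ket_mem_sector μ f S)
  rw [h B le_rfl, shift_ket]
  have hW := fun g p v (hv : v ∈ fock.parity (S.card : ZMod 2)) => boson_mem_parity g p hv
  exact Submodule.smul_mem _ _ (Submodule.sum_mem _ fun b _ =>
    creationExp_mem hW l _ (annihilationExp_mem hW l _ (ket_mem_parity _ _ _)))

/-! ## Products of free fields and vertex operators -/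

/-- Normally ordered products of free fields, `d` of which are fermions, and a vertex operator. -/
inductive IsProductField : ℕ → (ℤ → Module.End ℂ Fock) → Prop
  | vertexOp (l : Sector) : IsProductField 0 (vertexOp l)
  | boson (g : Gen) (k : ℕ) {d : ℕ} {A : ℤ → Module.End ℂ Fock} (hA : IsProductField d A) :
      IsProductField d (normalOrdered k (boson g) 1 A)
  | fermion (g : Gen) (k : ℕ) {d : ℕ} {A : ℤ → Module.End ℂ Fock} (hA : IsProductField d A) :
      IsProductField (d + 1) (normalOrdered k (fermion g) ((-1) ^ d) A)

namespace IsProductField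

variable {d e : ℕ} {A B : ℤ → Module.End ℂ Fock}

theorem isTruncated (hA : IsProductField d A) : IsTruncated A := by
  induction hA with
  | vertexOp l => exact isTruncated_vertexOp l
  | boson g k _ ih =>
    exact (isResProd_normalOrdered k 1 (isTruncated_boson g) ih).isTruncated
      (isTruncated_boson g) ih
  | fermion g k _ ih =>
    exact (isResProd_normalOrdered k _ (isTruncated_fermion g) ih).isTruncated
      (isTruncated_fermion g) ih

theorem isResProd_boson (hA : IsProductField d A) (g : Gen) (k : ℕ) :
    IsResProd (-(k : ℤ) - 1) 1 (QuinticFock.boson g) A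
      (normalOrdered k (QuinticFock.boson g) 1 A) :=
  isResProd_normalOrdered k 1 (isTruncated_boson g) hA.isTruncated

theorem isResProd_fermion (hA : IsProductField d A) (g : Gen) (k : ℕ) :
    IsResProd (-(k : ℤ) - 1) ((-1) ^ d) (QuinticFock.fermion g) A
      (normalOrdered k (QuinticFock.fermion g) ((-1) ^ d) A) :=
  isResProd_normalOrdered k _ (isTruncated_fermion g) hA.isTruncated

theorem isCovariant (hA : IsProductField d A) : IsCovariant translationOp A := by
  induction hA with
  | vertexOp l => exact isCovariant_vertexOp l
  | boson g k hA ih =>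
    exact (hA.isResProd_boson g k).isCovariant (isTruncated_boson g) hA.isTruncated
      (isCovariant_boson g) ih
  | fermion g k hA ih =>
    exact (hA.isResProd_fermion g k).isCovariant (isTruncated_fermion g) hA.isTruncated
      (isCovariant_fermion g) ih

theorem boson_nonneg_vacuum (g : Gen) {n : ℤ} (hn : 0 ≤ n) :
    QuinticFock.boson g n (ket 0 0 ∅) = 0 := by
  rcases hn.lt_or_eq with h | rfl
  · exact boson_pos_vacuum _ _ h _ _
  · rw [boson_zero_ket, coord_zero, zero_smul]

theorem apply_vacuum_of_nonneg (hA : IsProductField d A) :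
    ∀ n : ℤ, 0 ≤ n → A n (ket 0 0 ∅) = 0 := by
  induction hA with
  | vertexOp l =>
    intro n hn
    rw [vertexOp_vacuum, form_zero, creationExp, expZ_neg _ (by omega), LinearMap.zero_apply,
      smul_zero]
  | boson g k hA ih =>
    exact ((hA.isResProd_boson g k).apply_vacuum (fun m => boson_nonneg_vacuum g) ih).1
  | fermion g k hA ih =>
    exact ((hA.isResProd_fermion g k).apply_vacuum
      (fun m hm => fermion_nonneg_vacuum g m hm _ _) ih).1

theorem mem_parity (hA : IsProductField d A) :
    ∀ (n : ℤ) {p : ZMod 2} {v : Fock}, v ∈ fock.parity p → A n v ∈ fock.parity (p + d) := by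
  induction hA with
  | vertexOp l =>
    intro n p v hv
    rw [Nat.cast_zero, add_zero]
    exact vertexOp_mem_parity l n hv
  | boson g k hA ih =>
    intro n p v hv
    obtain ⟨J, hJ⟩ := (hA.isResProd_boson g k).exists_sum (isTruncated_boson g) hA.isTruncated n v
    rw [hJ J le_rfl]
    exact sub_mem (Submodule.sum_mem _ fun j _ => Submodule.smul_mem _ _
        (boson_mem_parity _ _ (ih _ hv)))
      (Submodule.smul_mem _ _ (Submodule.sum_mem _ fun j _ => Submodule.smul_mem _ _
        (ih _ (boson_mem_parity _ _ hv))))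
  | @fermion g k d A hA ih =>
    intro n p v hv
    obtain ⟨J, hJ⟩ := (hA.isResProd_fermion g k).exists_sum (isTruncated_fermion g)
      hA.isTruncated n v
    rw [hJ J le_rfl]
    have e₁ : p + ((d + 1 : ℕ) : ZMod 2) = p + d + 1 := by push_cast; ring
    have e₂ : p + ((d + 1 : ℕ) : ZMod 2) = p + 1 + d := by push_cast; ring
    refine sub_mem (Submodule.sum_mem _ fun j _ => Submodule.smul_mem _ _ ?_)
      (Submodule.smul_mem _ _ (Submodule.sum_mem _ fun j _ => Submodule.smul_mem _ _ ?_))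
    · rw [e₁]
      exact fermion_mem_parity _ _ (ih _ hv)
    · rw [e₂]
      exact ih _ (fermion_mem_parity _ _ hv)

/-- This precedes general locality: to apply Dong's lemma to a normally ordered product, its free
factor and the rest must already be mutually local. -/
theorem mutLocal_free (hA : IsProductField d A) (h : Gen) :
    MutLocal 1 A (QuinticFock.boson h) ∧ MutLocal ((-1) ^ d) A (QuinticFock.fermion h) := by
  induction hA generalizing h with
  | vertexOp l =>
    rw [pow_zero]
    exact ⟨(mutLocal_boson_vertexOp h l).symm (by norm_num),
      (mutLocal_fermion_vertexOp h l).symm (by norm_num)⟩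
  | @boson g k d A hA ih =>
    have hg := (ih g).1.symm (by norm_num)
    refine ⟨?_, ?_⟩
    · simpa using (hA.isResProd_boson g k).mutLocal (isTruncated_boson g) hA.isTruncated hg
        (mutLocal_boson_boson g h) (ih h).1
    · simpa using (hA.isResProd_boson g k).mutLocal (isTruncated_boson g) hA.isTruncated hg
        (mutLocal_boson_fermion g h) (ih h).2
  | @fermion g k d A hA ih =>
    have hg := (ih g).2.symm (neg_one_pow_mul_self d)
    refine ⟨?_, ?_⟩
    · simpa using (hA.isResProd_fermion g k).mutLocal (isTruncated_fermion g) hA.isTruncated hg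
        ((mutLocal_boson_fermion h g).symm (by norm_num)) (ih h).1
    · rw [pow_succ']
      exact (hA.isResProd_fermion g k).mutLocal (isTruncated_fermion g) hA.isTruncated hg
        (mutLocal_fermion_fermion g h) (ih h).2

/-- Dong's lemma by induction on the construction of `A`; each fermion factor contributes a sign
`(-1)^e`. `mutLocal` uses it twice, first with a vertex operator as `c`, then with a general
product. -/
theorem mutLocal_of_generators {c : ℤ → Module.End ℂ Fock} {e : ℕ}
    (hb : ∀ g, MutLocal 1 (QuinticFock.boson g) c)
    (hf : ∀ g, MutLocal ((-1) ^ e) (QuinticFock.fermion g) c)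
    (hv : ∀ l, MutLocal 1 (QuinticFock.vertexOp l) c)
    (hA : IsProductField d A) : MutLocal ((-1) ^ (d * e)) A c := by
  induction hA with
  | vertexOp l =>
    rw [zero_mul, pow_zero]
    exact hv l
  | @boson g k d A hA ih =>
    simpa using (hA.isResProd_boson g k).mutLocal (isTruncated_boson g) hA.isTruncated
      ((hA.mutLocal_free g).1.symm (by norm_num)) (hb g) ih
  | @fermion g k d A hA ih =>
    rw [add_mul, one_mul, add_comm, pow_add]
    exact (hA.isResProd_fermion g k).mutLocal (isTruncated_fermion g) hA.isTruncated
      ((hA.mutLocal_free g).2.symm (neg_one_pow_mul_self d)) (hf g) ih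

theorem mutLocal (hA : IsProductField d A) (hB : IsProductField e B) :
    MutLocal ((-1) ^ (d * e)) A B := by
  refine mutLocal_of_generators (fun g => (hB.mutLocal_free g).1.symm (by norm_num))
    (fun g => (hB.mutLocal_free g).2.symm (neg_one_pow_mul_self e)) (fun l => ?_) hA
  have h := mutLocal_of_generators (e := 0) (fun g => mutLocal_boson_vertexOp g l)
    (fun g => by rw [pow_zero]; exact mutLocal_fermion_vertexOp g l)
    (fun l' => mutLocal_vertexOp_vertexOp l' l) hB
  rw [mul_zero, pow_zero] at h
  exact h.symm (by norm_num)

end IsProductField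

/-! ## The fields of basis states -/

theorem isProductField_fermionicProduct (l : Sector) (L : List Mode) :
    IsProductField L.length (fermionicProduct (vertexOp l) L) := by
  induction L with
  | nil => exact .vertexOp l
  | cons s L ih => exact .fermion s.gen s.num ih

theorem IsProductField.bosonicProduct {d : ℕ} {A : ℤ → Module.End ℂ Fock}
    (hA : IsProductField d A) (L : List Mode) : IsProductField d (bosonicProduct A L) := by
  induction L with
  | nil => exact hA
  | cons s L ih => exact .boson s.gen s.num ih

theorem isProductField_labelField (u : Label) : IsProductField u.2.2.card (labelField u) := by
  have h := (isProductField_fermionicProduct u.1 (u.2.2.sort (· ≤ ·))).bosonicProduct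
    (Finsupp.toMultiset u.2.1).toList
  rwa [Finset.length_sort] at h

theorem cocycle_zero (l : Sector) : l.cocycle 0 = 1 := by
  have h := cocycle_add l 0 0
  rw [add_zero] at h
  rw [h, cocycle_mul_self]

theorem vertexOp_neg_one_vacuum (l : Sector) : vertexOp l (-1) (ket 0 0 ∅) = ket l 0 ∅ := by
  rw [vertexOp_vacuum, cocycle_zero, form_zero, one_smul, add_zero, creationExp]
  norm_num [expZ_zero]

/-- The list is increasing, so each creator is applied to a set of strictly larger modes and no sign
arises. -/
theorem fermionicProduct_vacuum (l : Sector) {L : List Mode} (hL : L.Pairwise (· < ·)) :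
    fermionicProduct (vertexOp l) L (-1) (ket 0 0 ∅) = ket l 0 L.toFinset := by
  induction L with
  | nil => exact vertexOp_neg_one_vacuum l
  | cons s L ih =>
    rw [List.pairwise_cons] at hL
    have hA := isProductField_fermionicProduct l L
    have h := ((hA.isResProd_fermion s.gen s.num).apply_vacuum
      (fun m hm => fermion_nonneg_vacuum _ m hm _ _) hA.apply_vacuum_of_nonneg).2
    rw [ih hL.2, fermion_neg_ket] at h
    have hs : mode s.gen s.num = s := rfl
    rw [hs, if_neg (fun hm => lt_irrefl s (hL.1 s (List.mem_toFinset.1 hm))),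
      Finset.filter_false_of_mem, Finset.card_empty, pow_zero, one_smul] at h
    · rw [List.toFinset_cons]
      exact h
    · exact fun t ht => (hL.1 t (List.mem_toFinset.1 ht)).not_gt

theorem bosonicProduct_vacuum {d : ℕ} {A : ℤ → Module.End ℂ Fock} (hA : IsProductField d A)
    {l : Sector} {S : Finset Mode} (h0 : A (-1) (ket 0 0 ∅) = ket l 0 S) (L : List Mode) :
    bosonicProduct A L (-1) (ket 0 0 ∅) = ket l (Multiset.toFinsupp (L : Multiset Mode)) S := by
  induction L with
  | nil => rw [Multiset.coe_nil, map_zero]; exact h0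
  | cons s L ih =>
    have hB := hA.bosonicProduct L
    have h := ((hB.isResProd_boson s.gen s.num).apply_vacuum
      (fun m => IsProductField.boson_nonneg_vacuum s.gen) hB.apply_vacuum_of_nonneg).2
    rw [ih, boson_neg_ket] at h
    rw [← Multiset.cons_coe, ← Multiset.singleton_add, map_add, Multiset.toFinsupp_singleton,
      add_comm]
    exact h

theorem labelField_vacuum (u : Label) :
    labelField u (-1) (ket 0 0 ∅) = ket u.1 u.2.1 u.2.2 := by
  have h := bosonicProduct_vacuum (isProductField_fermionicProduct u.1 (u.2.2.sort (· ≤ ·)))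
    (fermionicProduct_vacuum u.1 (Finset.sortedLT_sort u.2.2).pairwise)
    (Finsupp.toMultiset u.2.1).toList
  rw [Multiset.coe_toList, Finsupp.toMultiset_toFinsupp, Finset.sort_toFinset] at h
  exact h

end QuinticFock

end

noncomputable section

theorem MutLocal.add {V : Type*} [AddCommGroup V] [Module ℂ V] {σ : ℂ}
    {a b c : ℤ → Module.End ℂ V} (ha : MutLocal σ a c) (hb : MutLocal σ b c) :
    MutLocal σ (a + b) c := by
  obtain ⟨N, hN⟩ := ha
  obtain ⟨M, hM⟩ := hb
  refine ⟨max N M, fun v => ?_⟩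
  have e : superComm σ (a + b) c v = superComm σ a c v + superComm σ b c v := by
    funext i j
    simp only [superComm, Pi.add_apply, LinearMap.add_apply, map_add, smul_add]
    abel
  rw [e, map_add, diffShift_pow_eq_zero_of_le (le_max_left _ _) (hN v),
    diffShift_pow_eq_zero_of_le (le_max_right _ _) (hM v), add_zero]

theorem MutLocal.smul {V : Type*} [AddCommGroup V] [Module ℂ V] {σ : ℂ}
    {a c : ℤ → Module.End ℂ V} (r : ℂ) (ha : MutLocal σ a c) : MutLocal σ (r • a) c := by
  obtain ⟨N, hN⟩ := ha
  refine ⟨N, fun v => ?_⟩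
  have e : superComm σ (r • a) c v = r • superComm σ a c v := by
    funext i j
    simp only [superComm, Pi.smul_apply, LinearMap.smul_apply, map_smul, smul_sub, smul_comm r σ]
  rw [e, map_smul, hN, smul_zero]

namespace QuinticFock

/-! ## The vertex superalgebra structure -/

theorem fock_prod_single (n : ℤ) (u : Label) (r : ℂ) :
    fock.prod n (Finsupp.single u r) = r • labelField u n :=
  Finsupp.linearCombination_single ℂ r u

theorem fock_prod_ket (n : ℤ) (μ : Sector) (f : Mode →₀ ℕ) (S : Finset Mode) :
    fock.prod n (ket μ f S) = labelField (μ, f, S) n := by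
  rw [ket, fock_prod_single, one_smul]

theorem isTruncated_fock_prod (a : Fock) : IsTruncated fun n => fock.prod n a := by
  induction a using Finsupp.induction_linear with
  | zero => exact fun v => ⟨0, fun n _ => by simp only [map_zero, LinearMap.zero_apply]⟩
  | add a b ha hb =>
    intro v
    obtain ⟨N, hN⟩ := ha v
    obtain ⟨M, hM⟩ := hb v
    refine ⟨max N M, fun n hn => ?_⟩
    have h₁ : fock.prod n a v = 0 := hN n (by omega)
    have h₂ : fock.prod n b v = 0 := hM n (by omega)
    simp only [map_add, LinearMap.add_apply, h₁, h₂, add_zero]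
  | single u r =>
    intro v
    obtain ⟨N, hN⟩ := (isProductField_labelField u).isTruncated v
    exact ⟨N, fun n hn => by
      simp only [fock_prod_single, LinearMap.smul_apply, hN n hn, smul_zero]⟩

theorem isCovariant_fock_prod (a : Fock) :
    IsCovariant translationOp fun n => fock.prod n a := by
  intro n v
  induction a using Finsupp.induction_linear with
  | zero => simp only [map_zero, LinearMap.zero_apply, smul_zero, sub_zero]
  | add a b ha hb =>
    simp only [map_add, LinearMap.add_apply, smul_add] at ha hb ⊢
    rw [← ha, ← hb]
    abel
  | single u r =>
    have h := (isProductField_labelField u).isCovariant n v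
    simp only [fock_prod_single, LinearMap.smul_apply, map_smul]
    rw [← smul_sub, h, smul_comm]

theorem fock_prod_vacuum_nonneg (a : Fock) (n : ℤ) (hn : 0 ≤ n) :
    fock.prod n a fock.vacuum = 0 := by
  induction a using Finsupp.induction_linear with
  | zero => rw [map_zero, LinearMap.zero_apply]
  | add a b ha hb => rw [map_add, LinearMap.add_apply, ha, hb, add_zero]
  | single u r =>
    have h : labelField u n fock.vacuum = 0 :=
      (isProductField_labelField u).apply_vacuum_of_nonneg n hn
    rw [fock_prod_single, LinearMap.smul_apply, h, smul_zero]

theorem fock_prod_neg_one_vacuum (a : Fock) : fock.prod (-1) a fock.vacuum = a := by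
  induction a using Finsupp.induction_linear with
  | zero => rw [map_zero, LinearMap.zero_apply]
  | add a b ha hb => rw [map_add, LinearMap.add_apply, ha, hb]
  | single u r =>
    have h : labelField u (-1) fock.vacuum = ket u.1 u.2.1 u.2.2 := labelField_vacuum u
    rw [fock_prod_single, LinearMap.smul_apply, h, ket, Finsupp.smul_single, smul_eq_mul, mul_one]

/-- Covariance at mode `-1`, together with `T vacuum = 0`, identifies the operator of the axioms
with the explicit one. -/
theorem fock_prod_neg_two_vacuum (a : Fock) : fock.prod (-2) a fock.vacuum = translationOp a := by
  have h := isCovariant_fock_prod a (-1) fock.vacuum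
  have h0 : translationOp fock.vacuum = 0 := translationOp_vacuum_zero
  rw [h0, map_zero, sub_zero, fock_prod_neg_one_vacuum] at h
  rw [h]
  norm_num

theorem latticeBoson_zero (n : ℤ) : latticeBoson 0 n = 0 :=
  Finset.sum_eq_zero fun g _ => by rw [coord_zero, zero_smul]

theorem form_zero_left (l : Sector) : Sector.form 0 l = 0 := by
  rw [form_comm, form_zero]

theorem pairing_zero_left (n : latN) : pairing 0 n = 0 := by
  have := pairing_add_left 0 0 n
  rw [add_zero] at this
  omega

theorem cocycle_zero_left (l : Sector) : Sector.cocycle 0 l = 1 := by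
  rw [Sector.cocycle, Prod.fst_zero, pairing_zero_left, zpow_zero]

theorem vertexOp_zero (n : ℤ) : vertexOp 0 n = if n = -1 then 1 else 0 := by
  have hc : ∀ (a : ℤ) (v : Fock), creationExp 0 a v = if a = 0 then v else 0 := fun a v =>
    expZ_apply_of_forall_eq_zero (commute_creation 0 0)
      (fun k => by rw [latticeBoson_zero, smul_zero, LinearMap.zero_apply]) a
  have ha : ∀ (a : ℤ) (v : Fock), annihilationExp 0 a v = if a = 0 then v else 0 := fun a v =>
    expZ_apply_of_forall_eq_zero (commute_annihilation 0 0)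
      (fun k => by rw [latticeBoson_zero, smul_zero, LinearMap.zero_apply]) a
  refine end_ext fun μ f S => ?_
  obtain ⟨B, h⟩ := vertexOp_apply 0 μ (ket_mem_sector μ f S)
  rw [h (B + 1) (by omega), Finset.sum_range_succ', Finset.sum_eq_zero, cocycle_zero_left,
    form_zero_left, shift_ket, zero_add, zero_add, one_smul, Nat.cast_zero, ha, if_pos rfl, hc]
  · by_cases hn : n = -1
    · rw [if_pos hn, if_pos (by omega)]
      rfl
    · rw [if_neg hn, if_neg (by omega)]
      rfl
  · intro b _
    rw [ha, if_neg (by positivity), map_zero]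

theorem fock_vacuum_prod (n : ℤ) (a : Fock) :
    fock.prod n fock.vacuum a = if n = -1 then a else 0 := by
  have h : fock.prod n fock.vacuum = vertexOp 0 n := by
    refine (fock_prod_ket n 0 0 ∅).trans ?_
    simp [labelField, bosonicProduct, fermionicProduct]
  rw [h, vertexOp_zero]
  split_ifs <;> rfl

theorem mutLocal_fock_prod_left {σ : ℂ} {p : ZMod 2} {c : ℤ → Module.End ℂ Fock}
    (h : ∀ u : Label, (u.2.2.card : ZMod 2) = p → MutLocal σ (labelField u) c) {a : Fock}
    (ha : a ∈ fock.parity p) : MutLocal σ (fun n => fock.prod n a) c := by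
  refine mem_parity_induction (P := fun a => MutLocal σ (fun n => fock.prod n a) c) ?_ ?_ ?_ ?_ ha
  · refine ⟨0, fun v => ?_⟩
    rw [pow_zero, Module.End.one_apply]
    funext i j
    simp [superComm]
  · intro a b ha hb
    have e : (fun n => fock.prod n (a + b)) = (fun n => fock.prod n a) + fun n => fock.prod n b :=
      funext fun n => map_add _ _ _
    rw [e]
    exact ha.add hb
  · intro r a ha
    have e : (fun n => fock.prod n (r • a)) = r • fun n => fock.prod n a :=
      funext fun n => map_smul _ _ _
    rw [e]
    exact ha.smul r
  · intro μ f S hS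
    simp only [fock_prod_ket]
    exact h (μ, f, S) hS

theorem neg_one_pow_mul_eq (m n : ℕ) :
    (-1 : ℂ) ^ (m * n) = (-1) ^ ((m : ZMod 2).val * (n : ZMod 2).val) := by
  rw [neg_one_pow_eq_pow_mod_two, Nat.mul_mod, ZMod.val_natCast, ZMod.val_natCast,
    ← neg_one_pow_eq_pow_mod_two]

theorem mutLocal_fock_prod {p q : ZMod 2} {a b : Fock} (ha : a ∈ fock.parity p)
    (hb : b ∈ fock.parity q) :
    MutLocal ((-1) ^ (p.val * q.val)) (fun n => fock.prod n a) (fun n => fock.prod n b) := by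
  refine mutLocal_fock_prod_left (fun u hu => ?_) ha
  refine (mutLocal_fock_prod_left (fun u' hu' => ?_) hb).symm (neg_one_pow_mul_self _)
  subst hu hu'
  rw [← neg_one_pow_mul_eq]
  exact ((isProductField_labelField u).mutLocal (isProductField_labelField u')).symm
    (neg_one_pow_mul_self _)

theorem fock_prod_mem {p q : ZMod 2} (n : ℤ) {a b : Fock} (ha : a ∈ fock.parity p)
    (hb : b ∈ fock.parity q) : fock.prod n a b ∈ fock.parity (p + q) := by
  refine mem_parity_induction (P := fun a => fock.prod n a b ∈ fock.parity (p + q))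
    ?_ ?_ ?_ ?_ ha
  · rw [map_zero, LinearMap.zero_apply]
    exact zero_mem _
  · intro a a' h h'
    rw [map_add, LinearMap.add_apply]
    exact add_mem h h'
  · intro r a h
    rw [map_smul, LinearMap.smul_apply]
    exact Submodule.smul_mem _ r h
  · rintro μ f S rfl
    rw [fock_prod_ket, add_comm]
    exact (isProductField_labelField (μ, f, S)).mem_parity n hb

theorem fock_isInternal : DirectSum.IsInternal fock.parity := by
  rw [VertexData.isInternal_iff_isCompl]
  have e : {u : Label | (u.2.2.card : ZMod 2) = 0}ᶜ = {u : Label | (u.2.2.card : ZMod 2) = 1} := by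
    ext u
    simp only [Set.mem_compl_iff, Set.mem_ofPred_eq]
    generalize (u.2.2.card : ZMod 2) = x
    revert x
    decide
  change IsCompl (Finsupp.supported ℂ ℂ {u : Label | (u.2.2.card : ZMod 2) = 0})
    (Finsupp.supported ℂ ℂ {u : Label | (u.2.2.card : ZMod 2) = 1})
  rw [← e]
  constructor
  · exact Finsupp.disjoint_supported_supported isCompl_compl.disjoint
  · exact Finsupp.codisjoint_supported_supported isCompl_compl.codisjoint

/-- The Fock space of `M ⊕ K^∨` is a vertex superalgebra. -/
theorem fock_isVertexSuperalgebra : fock.IsVertexSuperalgebra where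
  isInternal := fock_isInternal
  vacuum_even := ket_mem_parity 0 0 ∅
  prod_mem _ _ n _ _ ha hb := fock_prod_mem n ha hb
  truncation := isTruncated_fock_prod
  vacuum_prod := fock_vacuum_prod
  prod_vacuum := fock_prod_neg_one_vacuum
  prod_vacuum_nonneg := fock_prod_vacuum_nonneg
  translation n a b := by
    rw [fock_prod_neg_two_vacuum, fock_prod_neg_two_vacuum]
    exact isCovariant_fock_prod a n b
  locality p q a b ha hb := by
    obtain ⟨N, hN⟩ := mutLocal_fock_prod ha hb
    refine ⟨N, fun k l c => ?_⟩
    have h := congrFun (congrFun (hN c) k) l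
    rwa [diffShift_pow_apply] at h

end QuinticFock

end

/-! ### Nonsingularity of the field of the differential with itself. -/

noncomputable section

/-- The coefficients of monomials without `X i` are not affected by setting `X i` to zero. -/
theorem MvPolynomial.coeff_aeval_ite_zero {σ R : Type*} [DecidableEq σ] [CommSemiring R] (i : σ)
    (F : MvPolynomial σ R) {e : σ →₀ ℕ} (he : e i = 0) :
    MvPolynomial.coeff e (MvPolynomial.aeval
      (fun j => if j = i then (0 : MvPolynomial σ R) else MvPolynomial.X j) F)
      = MvPolynomial.coeff e F := by
  induction F using MvPolynomial.induction_on' with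
  | monomial s c =>
    rw [MvPolynomial.aeval_monomial]
    by_cases hs : s i = 0
    · rw [MvPolynomial.monomial_eq, MvPolynomial.algebraMap_eq]
      congr 2
      refine Finsupp.prod_congr fun j hj => ?_
      rw [if_neg]
      rintro rfl
      exact (Finsupp.mem_support_iff.1 hj) hs
    · have h0 : (s.prod fun j k =>
          (if j = i then (0 : MvPolynomial σ R) else MvPolynomial.X j) ^ k) = 0 := by
        refine Finset.prod_eq_zero (Finsupp.mem_support_iff.2 hs) ?_
        simp only [if_true, zero_pow hs]
      rw [h0, mul_zero, MvPolynomial.coeff_zero, MvPolynomial.coeff_monomial, if_neg]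
      rintro rfl
      exact hs he
  | add p q hp hq => rw [map_add, MvPolynomial.coeff_add, MvPolynomial.coeff_add, hp, hq]

namespace QuinticFock

/-! ## The differential -/

theorem labelField_singleton (l : Sector) (g : Gen) :
    labelField (l, 0, {mode g 0}) = normalOrdered 0 (fermion g) 1 (vertexOp l) := by
  simp only [labelField, map_zero, Multiset.toList_zero, bosonicProduct, Finset.sort_singleton,
    fermionicProduct, List.length_nil, pow_zero]
  rfl

theorem vertexOp_vacuum_eq_zero {l ν : Sector} {n : ℤ} (h : 0 ≤ n + l.form ν) (S : Finset Mode) :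
    vertexOp l n (ket ν 0 S) = 0 := by
  rw [vertexOp_vacuum, creationExp, expZ_neg _ (by omega), LinearMap.zero_apply, smul_zero]

/-- The vertex operator contributes powers of `z` from `z^(l,ν)` upwards, and contraction of the
fermions costs one power, only for dual generators. Under the hypotheses no pole remains. -/
theorem fock_prod_zero_ket {l ν : Sector} {g t : Gen} (h0 : 0 ≤ l.form ν)
    (h1 : t = g.dual → 0 < l.form ν) :
    fock.prod 0 (ket l 0 {mode g 0}) (ket ν 0 {mode t 0}) = 0 := by
  rw [fock_prod_ket, labelField_singleton,
    isResProd_normalOrdered 0 1 (isTruncated_fermion g) (isTruncated_vertexOp l),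
    finsum_eq_zero_of_forall_eq_zero, finsum_eq_zero_of_forall_eq_zero, smul_zero, sub_zero]
  · intro j
    rw [fermion_natCast_ket]
    split_ifs with hj
    · rw [Finset.mem_singleton, mode_eq_mode] at hj
      obtain ⟨ht, rfl⟩ := hj
      -- After the contraction the mode `-1` of the vertex operator acts on the lattice state; it
      -- vanishes exactly because `(l,ν) ≥ 1`.
      have := h1 ht.symm
      rw [map_smul, vertexOp_vacuum_eq_zero (by push_cast; omega), smul_zero, smul_zero]
    · rw [map_zero, smul_zero]
  · intro j
    rw [vertexOp_vacuum_eq_zero (by positivity), map_zero, smul_zero]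

theorem pairing_nonneg {m : latM} {n : coneKdual} (hm : ∀ i, 0 ≤ (m : Fin 5 → ℤ) i) :
    0 ≤ pairing m n := by
  have h : (0 : ℚ) ≤ pairing m n := by
    rw [pairing_cast]
    exact Finset.sum_nonneg fun i _ => mul_nonneg (by exact_mod_cast hm i) (n.2 i)
  exact_mod_cast h

theorem pairing_pos {m : latM} {n : coneKdual} (hm : ∀ i, 0 ≤ (m : Fin 5 → ℤ) i) {i : Fin 5}
    (hmi : (m : Fin 5 → ℤ) i ≠ 0) (hni : ((n : latN) : Fin 5 → ℚ) i ≠ 0) : 0 < pairing m n := by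
  have h : (0 : ℚ) < pairing m n := by
    rw [pairing_cast]
    refine Finset.sum_pos' (fun i _ => mul_nonneg (by exact_mod_cast hm i) (n.2 i))
      ⟨i, Finset.mem_univ i, mul_pos ?_ ?_⟩
    · exact_mod_cast (hm i).lt_of_ne' hmi
    · exact (n.2 i).lt_of_ne' hni
  exact_mod_cast h

theorem form_nonneg {l ν : Sector} (hl : ∀ i, 0 ≤ (l.1 : Fin 5 → ℤ) i)
    (hν : ∀ i, 0 ≤ (ν.1 : Fin 5 → ℤ) i) : 0 ≤ l.form ν :=
  add_nonneg (pairing_nonneg hl) (pairing_nonneg hν)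

/-- All terms of the form are nonnegative on `K ⊕ K^∨`, and the product of the two nonzero
coordinates is a strictly positive one. -/
theorem form_pos {l ν : Sector} (hl : ∀ i, 0 ≤ (l.1 : Fin 5 → ℤ) i)
    (hν : ∀ i, 0 ≤ (ν.1 : Fin 5 → ℤ) i) {g : Gen} (hg : l.coord g ≠ 0)
    (hg' : ν.coord g.dual ≠ 0) : 0 < l.form ν := by
  induction g using Lex.rec with
  | _ g =>
  rcases g with i | i
  · have h₁ : (l.1 : Fin 5 → ℤ) i ≠ 0 := by
      simpa [Sector.coord] using hg
    have h₂ : ((ν.2 : latN) : Fin 5 → ℚ) i ≠ 0 := by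
      simpa [Sector.coord, Gen.dual] using hg'
    exact add_pos_of_pos_of_nonneg (pairing_pos hl h₁ h₂) (pairing_nonneg hν)
  · have h₁ : ((l.2 : latN) : Fin 5 → ℚ) i ≠ 0 := by
      simpa [Sector.coord] using hg
    have h₂ : (ν.1 : Fin 5 → ℤ) i ≠ 0 := by
      simpa [Sector.coord, Gen.dual] using hg'
    exact add_pos_of_nonneg_of_pos (pairing_nonneg hl) (pairing_pos hν h₂ h₁)

/-- The states `g^ferm_(-1) |l⟩` for `l` in `K ⊕ K^∨` with nonzero coordinate at `g`. -/
def coneStates : Set Fock :=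
  {v | ∃ (l : Sector) (g : Gen), (∀ i, 0 ≤ (l.1 : Fin 5 → ℤ) i) ∧ l.coord g ≠ 0 ∧
    v = ket l 0 {mode g 0}}

theorem fock_prod_zero_of_mem_span {v w : Fock} (hv : v ∈ Submodule.span ℂ coneStates)
    (hw : w ∈ Submodule.span ℂ coneStates) : fock.prod 0 v w = 0 := by
  induction hv using Submodule.span_induction with
  | zero => rw [map_zero, LinearMap.zero_apply]
  | add v v' _ _ h h' => rw [map_add, LinearMap.add_apply, h, h', add_zero]
  | smul r v _ h => rw [map_smul, LinearMap.smul_apply, h, smul_zero]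
  | mem v hv =>
    obtain ⟨l, g, hl, hg, rfl⟩ := hv
    induction hw using Submodule.span_induction with
    | zero => rw [map_zero]
    | add w w' _ _ h h' => rw [map_add, h, h', add_zero]
    | smul r w _ h => rw [map_smul, h, smul_zero]
    | mem w hw =>
      obtain ⟨ν, t, hν, ht, rfl⟩ := hw
      refine fock_prod_zero_ket (form_nonneg hl hν) ?_
      rintro rfl
      exact form_pos hl hν hg ht

theorem span_coneStates_le : Submodule.span ℂ coneStates ≤ fock.parity 1 := by
  rw [Submodule.span_le]
  rintro _ ⟨l, g, -, -, rfl⟩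
  simpa using ket_mem_parity l 0 {mode g 0}

/-- A summand is admissible when its lattice vector has a nonzero coordinate at the fermion's
generator, and inadmissible summands have coefficient zero. For the `F`-part this is the vanishing
on `x_i = 0`; for the `g`-part the coefficient of the `i`-th fermion contains the coordinate `n_i`
itself. -/
theorem stateFg_mem_span {F : Fin 5 → MvPolynomial (Fin 5) ℂ}
    (hvan : ∀ i, MvPolynomial.aeval
      (fun j => if j = i then (0 : MvPolynomial (Fin 5) ℂ) else MvPolynomial.X j) (F i) = 0)
    (g : polyΔdual → ℂ) : stateFg F g ∈ Submodule.span ℂ coneStates := by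
  refine add_mem ?_ ?_
  · refine finsum_induction (p := (· ∈ Submodule.span ℂ coneStates)) (zero_mem _)
      (fun _ _ => add_mem) fun m => Submodule.sum_mem _ fun i _ => ?_
    by_cases hi : ((m : latM) : Fin 5 → ℤ) i = 0
    · have h := MvPolynomial.coeff_aeval_ite_zero i (F i) (e := exponent m) (by simp [exponent, hi])
      rw [hvan, MvPolynomial.coeff_zero] at h
      rw [← h, zero_smul]
      exact zero_mem _
    · refine Submodule.smul_mem _ _ (Submodule.subset_span ⟨(m, 0), Sum.inlₗ i, m.2.1, ?_, rfl⟩)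
      simpa [Sector.coord] using hi
  · refine finsum_induction (p := (· ∈ Submodule.span ℂ coneStates)) (zero_mem _)
      (fun _ _ => add_mem) fun n => Submodule.smul_mem _ _ (Submodule.sum_mem _ fun i _ => ?_)
    by_cases hi : (((n : coneKdual) : latN) : Fin 5 → ℚ) i = 0
    · rw [hi, Rat.cast_zero, zero_smul]
      exact zero_mem _
    · refine Submodule.smul_mem _ _ (Submodule.subset_span
        ⟨(0, n), Sum.inrₗ i, fun _ => le_rfl, ?_, rfl⟩)
      simpa [Sector.coord] using hi

end QuinticFock

end

theorem proposition3p2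
    (F : Fin 5 → MvPolynomial (Fin 5) ℂ)
    (hdeg : ∀ i, (F i).IsHomogeneous 5)
    (hvan : ∀ i, MvPolynomial.aeval
      (fun j => if j = i then (0 : MvPolynomial (Fin 5) ℂ) else MvPolynomial.X j) (F i) = 0)
    (g : QuinticFock.polyΔdual → ℂ) :
    QuinticFock.fock.IsVertexSuperalgebra ∧
    (∀ (p : ZMod 2), ∀ v ∈ QuinticFock.fock.parity p,
      QuinticFock.diffD F g v ∈ QuinticFock.fock.parity (p + 1)) ∧
    QuinticFock.diffD F g ∘ₗ QuinticFock.diffD F g = 0 ∧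
    ∃ B : VertexData (Cohomology (QuinticFock.diffD F g)),
      QuinticFock.fock.InducedOnCohomology (QuinticFock.diffD F g) B ∧
      B.IsVertexSuperalgebra := by
  have hA := QuinticFock.fock_isVertexSuperalgebra
  have hs := QuinticFock.stateFg_mem_span hvan g
  have ha := QuinticFock.span_coneStates_le hs
  have hD := hA.odd_prod_zero_comp_self ha (QuinticFock.fock_prod_zero_of_mem_span hs hs)
  exact ⟨hA, fun p v hv => hA.odd_prod_zero_mem ha hv, hD,
    hA.cohomology ha, hA.inducedOnCohomology ha, hA.cohomology_isVertexSuperalgebra ha⟩
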